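/- Let $d\ge 1$ and $1\le p\le\infty$. There is $q>0$, depending only on $d$ and $p$, such that the following holds. For all $c_0,r_0,T,\alpha_H,\beta_H>0$, all $\Lambda\ge 0$ and all $v,D$ there are constants $K_0,K_1>0$, depending only on $d,p,c_0,r_0,T,\alpha_H,\beta_H,\Lambda,v,D$, with this property. Let $\Omega\subset\mathbb{R}^d$ be a non-empty bounded open convex set of class $C^3$ (its boundary is locally the graph of a $C^3$ function) with Lebesgue measure $|\Omega|=v$ and diameter $D$, and let $\nu$ be its outward unit normal. Let $H\in C^2(\mathbb{R}^d)$ satisfy $\alpha_H|\xi|^2\le H_{pp}(p)\xi\cdot\xi\le\beta_H|\xi|^2$ for all $p,\xi\in\mathbb{R}^d$, let $V:\Omega\to\mathbb{R}$ be Lipschitz continuous with constant $\Lambda$ (that is, $V\in W^{1,\infty}(\Omega)$ with $\|DV\|_\infty\le\Lambda$), and let $f\in C^1(0,\infty)$ satisfy $f'(r)\ge c_0/r$ for all $r\ge r_0$. Let $\varepsilon\ge 0$ and let $m_0,m_1$ be probability densities on $\Omega$. Let $(u,m)$ be a classical solution of the planning system $$ \begin{cases} -u_t+H(Du)=f(m)+\varepsilon\log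 m+V(x) & \text{in }(0,T)\times\Omega,\\ m_t-\operatorname{div}(m\,H_p(Du))=0 & \text{in }(0,T)\times\Omega,\\ H_p(Du)\cdot\nu=0 & \text{on }(0,T)\times\partial\Omega,\\ m(0,\cdot)=m_0,\quad m(T,\cdot)=m_1 & \text{in }\Omega, \end{cases} $$ in the sense that $u\in C^2((0,T)\times\overline\Omega)$, $m\in C^1((0,T)\times\overline\Omega)\cap C^0([0,T]\times\overline\Omega)$ and $m>0$ in $(0,T)\times\overline\Omega$. Then $$ \|m(t)\|_{L^p(\Omega)}\le K_0\big(\|m_0\|_{L^p(\Omega)}+\|m_1\|_{L^p(\Omega)}+1\big)\qquad\text{for all }t\in[0,T], $$ and $$ \|m(t)\|_{L^p(\Omega)}\le K_1\big(t^{-q}+(T-t)^{-q}\big)\qquad\text{for all }t\in(0,T). $$ In particular $K_0,K_1$ do not depend on $\varepsilon$ or on any positive lower bound of $m$, $m_0$, $m_1$. -/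

import Mathlib

open Set MeasureTheory
open scoped ENNReal NNReal

noncomputable section

/-- The boundary of `Ω` is locally the graph of a `C³` function, with `Ω` lying on one side: near
each boundary point there are a unit direction `e` and a `C³` function `g` (only its values on
the hyperplane orthogonal to `e` matter) such that `Ω` is the region below the graph of `g` in the
direction `e`. -/
def HasC3Boundary {d : ℕ} (Ω : Set (EuclideanSpace ℝ (Fin d))) : Prop :=
  ∀ x₀ ∈ frontier Ω, ∃ e : EuclideanSpace ℝ (Fin d), ‖e‖ = 1 ∧
    ∃ g : EuclideanSpace ℝ (Fin d) → ℝ, ContDiff ℝ 3 g ∧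
      ∃ U : Set (EuclideanSpace ℝ (Fin d)), IsOpen U ∧ x₀ ∈ U ∧
        ∀ x ∈ U, (x ∈ Ω ↔ inner ℝ x e < g (x - inner ℝ x e • e))

/-- `Ω` is a bounded convex domain of class `C³`. -/
structure IsSmoothConvexDomain {d : ℕ} (Ω : Set (EuclideanSpace ℝ (Fin d))) : Prop where
  isOpen : IsOpen Ω
  nonempty : Ω.Nonempty
  convex : Convex ℝ Ω
  isBounded : Bornology.IsBounded Ω
  boundary : HasC3Boundary Ω

/-- `ν` is an outward unit normal of the convex set `Ω` at its boundary point `x`: a unit vector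
whose orthogonal hyperplane through `x` supports `Ω`. If the boundary is `C¹` there is exactly one
such vector at each boundary point, the usual outward unit normal. -/
def IsOutwardUnitNormal {d : ℕ} (Ω : Set (EuclideanSpace ℝ (Fin d)))
    (x ν : EuclideanSpace ℝ (Fin d)) : Prop :=
  ‖ν‖ = 1 ∧ ∀ y ∈ Ω, inner ℝ ν (y - x) ≤ 0

/-- The gradient in the space variable, up to the boundary of `Ω`. For `x` in the open set `Ω`
it is the usual gradient. -/
def spaceGradient {d : ℕ} (Ω : Set (EuclideanSpace ℝ (Fin d)))
    (u : ℝ → EuclideanSpace ℝ (Fin d) → ℝ) (t : ℝ) (x : EuclideanSpace ℝ (Fin d)) :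
    EuclideanSpace ℝ (Fin d) :=
  gradientWithin (u t) (closure Ω) x

/-- The divergence of a vector field, `∑ i, ∂F_i/∂x_i`. -/
def divergence {d : ℕ} (F : EuclideanSpace ℝ (Fin d) → EuclideanSpace ℝ (Fin d))
    (x : EuclideanSpace ℝ (Fin d)) : ℝ :=
  ∑ i, (fderiv ℝ F x (EuclideanSpace.single i 1)) i

/-- `H` is of class `C²` with `α |ξ|² ≤ H_pp(p) ξ · ξ ≤ β |ξ|²` for all `p` and `ξ`. -/
structure IsUniformlyConvexHamiltonian {d : ℕ} (α β : ℝ)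
    (H : EuclideanSpace ℝ (Fin d) → ℝ) : Prop where
  contDiff : ContDiff ℝ 2 H
  lower : ∀ p ξ, α * ‖ξ‖ ^ 2 ≤ fderiv ℝ (fderiv ℝ H) p ξ ξ
  upper : ∀ p ξ, fderiv ℝ (fderiv ℝ H) p ξ ξ ≤ β * ‖ξ‖ ^ 2

/-- `f` is `C¹` on `(0, ∞)` and `f'(r) ≥ c₀ / r` for `r ≥ r₀`. -/
structure IsCoerciveCoupling (c₀ r₀ : ℝ) (f : ℝ → ℝ) : Prop where
  contDiffOn : ContDiffOn ℝ 1 f (Ioi 0)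
  coercive : ∀ r, r₀ ≤ r → c₀ / r ≤ deriv f r

/-- `μ` is the density of a probability measure on `Ω`. -/
def IsProbabilityDensity {d : ℕ} (Ω : Set (EuclideanSpace ℝ (Fin d)))
    (μ : EuclideanSpace ℝ (Fin d) → ℝ) : Prop :=
  (∀ x ∈ Ω, 0 ≤ μ x) ∧ ∫ x in Ω, μ x = 1

/-- `(u, m)` is a classical solution on `(0, T) × Ω` of the planning system
`-u_t + H(Du) = f(m) + ε log m + V`, `m_t - div (m H_p(Du)) = 0`,
with `H_p(Du) · ν = 0` on `(0, T) × ∂Ω` and `m(0) = m₀`, `m(T) = m₁` in `Ω`.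
Here `u` is `C²` and `m` is `C¹` and positive up to the lateral boundary, and `m` is continuous
up to the initial and final times. -/
structure IsClassicalPlanningSolution {d : ℕ} (Ω : Set (EuclideanSpace ℝ (Fin d))) (T ε : ℝ)
    (H : EuclideanSpace ℝ (Fin d) → ℝ) (f : ℝ → ℝ) (V : EuclideanSpace ℝ (Fin d) → ℝ)
    (m₀ m₁ : EuclideanSpace ℝ (Fin d) → ℝ)
    (u m : ℝ → EuclideanSpace ℝ (Fin d) → ℝ) : Prop where
  contDiffOn_u : ContDiffOn ℝ 2 (fun z : ℝ × EuclideanSpace ℝ (Fin d) => u z.1 z.2)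
    (Ioo 0 T ×ˢ closure Ω)
  contDiffOn_m : ContDiffOn ℝ 1 (fun z : ℝ × EuclideanSpace ℝ (Fin d) => m z.1 z.2)
    (Ioo 0 T ×ˢ closure Ω)
  continuousOn_m : ContinuousOn (fun z : ℝ × EuclideanSpace ℝ (Fin d) => m z.1 z.2)
    (Icc 0 T ×ˢ closure Ω)
  pos_m : ∀ t ∈ Ioo 0 T, ∀ x ∈ closure Ω, 0 < m t x
  hamilton_jacobi : ∀ t ∈ Ioo 0 T, ∀ x ∈ Ω,
    -deriv (fun s => u s x) t + H (spaceGradient Ω u t x)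
      = f (m t x) + ε * Real.log (m t x) + V x
  continuity : ∀ t ∈ Ioo 0 T, ∀ x ∈ Ω,
    deriv (fun s => m s x) t
      - divergence (fun y => m t y • gradient H (spaceGradient Ω u t y)) x = 0
  neumann : ∀ t ∈ Ioo 0 T, ∀ x ∈ frontier Ω, ∀ ν, IsOutwardUnitNormal Ω x ν →
    inner ℝ (gradient H (spaceGradient Ω u t x)) ν = 0
  initial : ∀ x ∈ Ω, m 0 x = m₀ x
  final : ∀ x ∈ Ω, m T x = m₁ x

end

/-! Write `b = H_p(Du)`, so that `m_t = div (m b)`, and let `P(s) = s h'(s) - h(s)` be the pressure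
of a convex energy density `h`. The proof rests on displacement convexity: `∫ h(m)` has time
derivative `∫ P(m) div b`, and its second derivative is at least `-∫ m h''(m) Dm · (b_t - Db b)`.
Three signs enter: McCann's condition `0 ≤ P ≤ s² h''`, `tr (Db)² = tr (H_pp D²u H_pp D²u) ≥ 0`, and
the convexity of `Ω`, which gives the boundary term its sign. Differentiating the Hamilton-Jacobi
equation in space shows that the acceleration `b_t - Db b` equals `-H_pp ((f'(m) + ε/m) Dm + DV)`.
If `h''` vanishes on `(0, r₀]`, only `f' ≥ c₀/r` is needed, the `ε` term has a good sign, and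
Young's inequality leaves `c₀ α / 2 ∫ h''(m) |Dm|²` minus a multiple of `∫ m² h''(m)`
(`IsClassicalPlanningSolution.le_energy_deriv2`).

The field `b` is only `C¹`, while the classical computation uses two derivatives of it. This is
avoided by working with weak divergences against Lipschitz functions: a weak Piola identity
(`hasWeakDivergence_piola`), a one-sided divergence theorem on convex sets
(`HasWeakDivergence.integral_nonpos`), and a first-order argument for the curvature sign on the
boundary (`inner_apply_self_nonpos`).

The uniform bounds come from Moser's iteration in time. For `h` proportional to a power of the
excess `n = (m - r₀)⁺`, Nash's inequality (`nash_inequality`, with constants depending on `|Ω|` and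
the diameter only) turns the gradient term into control of `∫ n^(2k)` by `(∫ n^k)²`. There is no
parabolic evolution to run. Instead the second derivative test is applied at a maximum in time of
`ζ^a ∫ n^(2k)` (`IsTimeWeight.pow_mul_le`). Unit mass starts the iteration and
`IsTimeWeight.moment_le` carries it through all exponents. The parabola `t (T - t) / T²` as weight
`ζ` gives an interior bound free of the end data; the constant weight propagates `L^∞` bounds from
the ends.

For `1 < p < ∞` the energy is a `C²` substitute for `m^p` that is flat near `r₀`. It satisfies `φ''
≥ -C (φ + 10)`, and a maximum of `(φ + 10) / (1 + 2 C t (T - t))` is either at an end time or so far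
from both that the interior bound applies (`integral_rpow_le`). For `p = 1` the mass is conserved.
-/

noncomputable section

open Filter Topology Metric

set_option linter.unusedSectionVars false

/-! ### Integration by parts against compactly supported Lipschitz functions -/

section WeakDerivatives

variable {E : Type*} [NormedAddCommGroup E] [InnerProductSpace ℝ E] [FiniteDimensional ℝ E]
  [MeasurableSpace E] [BorelSpace E]

/-- Lipschitz functions whose support is a compact subset of `Ω`. -/
structure IsLipschitzTest (Ω : Set E) (χ : E → ℝ) : Prop where
  lipschitz : ∃ C, LipschitzWith C χ
  compact : HasCompactSupport χ
  subset : tsupport χ ⊆ Ω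

/-- A `C¹` function on an open set agrees near a compact subset with a compactly supported `C¹`
function on the whole space. -/
theorem exists_contDiff_eventuallyEq {Ω A : Set E} (hΩ : IsOpen Ω) (hA : IsCompact A)
    (hAΩ : A ⊆ Ω) {f : E → ℝ} (hf : ContDiffOn ℝ 1 f Ω) :
    ∃ g : E → ℝ, ContDiff ℝ 1 g ∧ HasCompactSupport g ∧ ∀ x ∈ A, g =ᶠ[𝓝 x] f := by
  obtain ⟨K, hK, hAK, hKΩ⟩ := exists_compact_between hA hΩ hAΩ
  obtain ⟨ρ, hρ1, hρ0, -⟩ := exists_contMDiffMap_one_nhds_of_subset_interior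
    (n := 1) (modelWithCornersSelf ℝ E) hA.isClosed hAK
  have hρ : ContDiff ℝ 1 ρ := ρ.contMDiff.contDiff
  have hsupp : tsupport ρ ⊆ K := closure_minimal (fun x hx => by
    by_contra h; exact hx (hρ0 x h)) hK.isClosed
  refine ⟨fun x => ρ x * f x, ?_, ?_, ?_⟩
  · rw [contDiff_iff_contDiffAt]
    intro x
    by_cases hx : x ∈ tsupport ρ
    · exact hρ.contDiffAt.mul (hf.contDiffAt (hΩ.mem_nhds (hKΩ (hsupp hx))))
    · have : (fun x => ρ x * f x) =ᶠ[𝓝 x] fun _ => 0 := by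
        filter_upwards [(isClosed_tsupport ρ).isOpen_compl.mem_nhds hx] with y hy
        rw [image_eq_zero_of_notMem_tsupport hy, zero_mul]
      exact contDiffAt_const.congr_of_eventuallyEq this
  · exact HasCompactSupport.mul_right (HasCompactSupport.intro' hK hK.isClosed fun x hx => hρ0 x hx)
  · intro x hx
    filter_upwards [Filter.Eventually.filter_mono (nhds_le_nhdsSet hx) hρ1] with y hy
    rw [hy, one_mul]

theorem LipschitzWith.mul_of_bounded {f g : E → ℝ} {C D A B : ℝ≥0} (hf : LipschitzWith C f)
    (hg : LipschitzWith D g) (hA : ∀ x, |f x| ≤ A) (hB : ∀ x, |g x| ≤ B) :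
    LipschitzWith (C * B + A * D) (fun x => f x * g x) := by
  refine LipschitzWith.of_dist_le_mul fun x y => ?_
  have h1 := hf.dist_le_mul x y
  have h2 := hg.dist_le_mul x y
  rw [Real.dist_eq] at *
  have : f x * g x - f y * g y = (f x - f y) * g x + f y * (g x - g y) := by ring
  rw [this]
  refine (abs_add_le _ _).trans ?_
  rw [abs_mul, abs_mul]
  push_cast
  have := mul_le_mul h1 (hB x) (abs_nonneg _) (by positivity)
  have := mul_le_mul (hA y) h2 (abs_nonneg _) (by positivity)
  nlinarith

namespace IsLipschitzTest

variable {Ω : Set E} {χ : E → ℝ}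

theorem continuous (h : IsLipschitzTest Ω χ) : Continuous χ := h.lipschitz.choose_spec.continuous

theorem exists_bound (h : IsLipschitzTest Ω χ) : ∃ A : ℝ≥0, ∀ x, |χ x| ≤ A := by
  obtain ⟨A, hA⟩ := h.compact.exists_bound_of_continuous h.continuous
  exact ⟨A.toNNReal, fun x => (hA x).trans (Real.le_coe_toNNReal A)⟩

theorem ae_differentiableAt (h : IsLipschitzTest Ω χ) : ∀ᵐ x, DifferentiableAt ℝ χ x :=
  h.lipschitz.choose_spec.ae_differentiableAt

/-- The factor `f` may blow up at the boundary of `Ω`, but only its values near the compact support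
of `χ` matter. There it agrees with a compactly supported `C¹` function, which is bounded and
Lipschitz. -/
theorem mul_contDiffOn (h : IsLipschitzTest Ω χ) (hΩ : IsOpen Ω) {f : E → ℝ}
    (hf : ContDiffOn ℝ 1 f Ω) : IsLipschitzTest Ω (fun x => χ x * f x) := by
  obtain ⟨g, hg, hgc, hgf⟩ := exists_contDiff_eventuallyEq hΩ h.compact h.subset hf
  have heq : (fun x => χ x * f x) = fun x => χ x * g x := by
    funext x
    by_cases hx : x ∈ tsupport χ
    · rw [(hgf x hx).self_of_nhds]
    · rw [image_eq_zero_of_notMem_tsupport hx]; simp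
  obtain ⟨C, hC⟩ := h.lipschitz
  obtain ⟨D, hD⟩ := hg.lipschitzWith_of_hasCompactSupport hgc (by simp)
  obtain ⟨A, hA⟩ := h.exists_bound
  obtain ⟨B, hB⟩ := hgc.exists_bound_of_continuous hg.continuous
  refine ⟨⟨C * B.toNNReal + A * D, ?_⟩, h.compact.mul_right, (tsupport_mul_subset_left (f := χ) (g := f)).trans h.subset⟩
  rw [heq]
  exact hC.mul_of_bounded hD hA (B := B.toNNReal) fun x => (hB x).trans (Real.le_coe_toNNReal B)

theorem setIntegral_eq_of_forall {G : Type*} [NormedAddCommGroup G] [NormedSpace ℝ G]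
    {μ : Measure E} (h : IsLipschitzTest Ω χ) {F : E → G} (hF : ∀ x ∉ tsupport χ, F x = 0) :
    ∫ x in Ω, F x ∂μ = ∫ x, F x ∂μ :=
  setIntegral_eq_integral_of_forall_compl_eq_zero fun x hx => hF x fun h' => hx (h.subset h')

theorem fderiv_eq_zero {x : E} (hx : x ∉ tsupport χ) : fderiv ℝ χ x = 0 :=
  image_eq_zero_of_notMem_tsupport fun h' => hx (tsupport_fderiv_subset ℝ h')

theorem integral_mul_fderiv (h : IsLipschitzTest Ω χ) (hΩ : IsOpen Ω) {f : E → ℝ}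
    (hf : ContDiffOn ℝ 1 f Ω) (v : E) :
    ∫ x in Ω, χ x * fderiv ℝ f x v = - ∫ x in Ω, fderiv ℝ χ x v * f x := by
  obtain ⟨g, hg, hgc, hgf⟩ := exists_contDiff_eventuallyEq hΩ h.compact h.subset hf
  obtain ⟨C, hC⟩ := h.lipschitz
  obtain ⟨D, hD⟩ := hg.lipschitzWith_of_hasCompactSupport hgc (by simp)
  rw [h.setIntegral_eq_of_forall (fun x hx => by
    rw [image_eq_zero_of_notMem_tsupport hx, zero_mul]),
    h.setIntegral_eq_of_forall (fun x hx => by rw [fderiv_eq_zero hx]; simp)]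
  have key := hD.integral_lineDeriv_mul_eq (μ := volume) hC h.compact v
  have e1 : ∫ x, χ x * fderiv ℝ f x v = ∫ x, lineDeriv ℝ g x v * χ x := by
    refine integral_congr_ae (Eventually.of_forall fun x => ?_)
    by_cases hx : x ∈ tsupport χ
    · simp only
      rw [(hg.differentiable (by simp) x).lineDeriv_eq_fderiv, (hgf x hx).fderiv_eq, mul_comm]
    · simp [image_eq_zero_of_notMem_tsupport hx]
  have e2 : ∫ x, fderiv ℝ χ x v * f x = - ∫ x, lineDeriv ℝ χ x (-v) * g x := by
    rw [← integral_neg]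
    refine integral_congr_ae ?_
    filter_upwards [h.ae_differentiableAt] with x hdx
    rw [lineDeriv_neg, hdx.lineDeriv_eq_fderiv]
    by_cases hx : x ∈ tsupport χ
    · rw [(hgf x hx).self_of_nhds]; ring
    · simp [fderiv_eq_zero hx]
  rw [e1, e2, key]; ring

/-- Mixed partial derivatives commute in the weak sense. -/
theorem integral_fderiv_mul_fderiv_comm (h : IsLipschitzTest Ω χ) (hΩ : IsOpen Ω) {f : E → ℝ}
    (hf : ContDiffOn ℝ 1 f Ω) (v w : E) :
    ∫ x in Ω, fderiv ℝ χ x v * fderiv ℝ f x w = ∫ x in Ω, fderiv ℝ χ x w * fderiv ℝ f x v := by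
  obtain ⟨g, hg, hgc, hgf⟩ := exists_contDiff_eventuallyEq hΩ h.compact h.subset hf
  obtain ⟨C, hC⟩ := h.lipschitz
  obtain ⟨D, hD⟩ := hg.lipschitzWith_of_hasCompactSupport hgc (by simp)
  have hgd : Differentiable ℝ g := hg.differentiable (by simp)
  have red : ∀ v w : E, ∫ x in Ω, fderiv ℝ χ x v * fderiv ℝ f x w
      = ∫ x, lineDeriv ℝ χ x v * lineDeriv ℝ g x w := by
    intro v w
    rw [h.setIntegral_eq_of_forall (fun x hx => by rw [fderiv_eq_zero hx]; simp)]
    refine integral_congr_ae ?_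
    filter_upwards [h.ae_differentiableAt] with x hdx
    rw [hdx.lineDeriv_eq_fderiv, (hgd x).lineDeriv_eq_fderiv]
    by_cases hx : x ∈ tsupport χ
    · rw [(hgf x hx).fderiv_eq]
    · simp [fderiv_eq_zero hx]
  rw [red, red]
  -- both sides are limits of the same difference quotients
  have hgcont : ∀ v : E, Continuous fun x => lineDeriv ℝ g x v := fun v => by
    have : (fun x => lineDeriv ℝ g x v) = fun x => fderiv ℝ g x v :=
      funext fun x => (hgd x).lineDeriv_eq_fderiv
    rw [this]
    exact (hg.continuous_fderiv (by simp)).clm_apply continuous_const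
  have hgint : Integrable (fun x => lineDeriv ℝ g x v) := by
    refine (hgcont v).integrable_of_hasCompactSupport ?_
    refine HasCompactSupport.intro' hgc (isClosed_tsupport g) fun x hx => ?_
    rw [(hgd x).lineDeriv_eq_fderiv, image_eq_zero_of_notMem_tsupport
      (f := fderiv ℝ g) fun h' => hx (tsupport_fderiv_subset ℝ h')]
    rfl
  have A := hD.integral_inv_smul_sub_mul_tendsto_integral_lineDeriv_mul (μ := volume) (v := w)
    (g := fun x => lineDeriv ℝ χ x v) (by
      have hb : Integrable (fun x => lineDeriv ℝ χ x v) := by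
        obtain ⟨A, hA⟩ := h.exists_bound
        refine Measure.integrableOn_of_bounded (s := tsupport χ) (M := C * ‖v‖)
          h.compact.measure_lt_top.ne
          (aestronglyMeasurable_lineDeriv hC.continuous volume)
          (Eventually.of_forall fun x => norm_lineDeriv_le_of_lipschitz ℝ hC) |>.integrable_of_forall_notMem_eq_zero ?_
        intro x hx
        by_cases hdx : LineDifferentiableAt ℝ χ x v
        · have : χ =ᶠ[𝓝 x] fun _ => (0 : ℝ) := by
            filter_upwards [(isClosed_tsupport χ).isOpen_compl.mem_nhds hx] with y hy
            exact image_eq_zero_of_notMem_tsupport hy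
          rw [this.lineDeriv_eq]; simp [lineDeriv]
        · exact lineDeriv_zero_of_not_lineDifferentiableAt hdx
      exact hb)
  have B := hC.integral_inv_smul_sub_mul_tendsto_integral_lineDeriv_mul (μ := volume) (v := -w)
    hgint
  -- Integrating by parts along `v` moves that derivative from `χ` to `g`; translating by `s • w`
  -- then moves the difference quotient from `g` to `χ`. Neither function is differentiated twice.
  have hshift : ∀ s : ℝ, ∫ x, (s⁻¹ • (g (x + s • w) - g x)) * lineDeriv ℝ χ x v
      = - ∫ x, (s⁻¹ • (χ (x + s • (-w)) - χ x)) * lineDeriv ℝ g x v := by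
    intro s
    have hgs : LipschitzWith (D) (fun x => g (x + s • w)) := by
      refine LipschitzWith.of_dist_le_mul fun x y => ?_
      simpa using hD.dist_le_mul (x + s • w) (y + s • w)
    have hgsd : LipschitzWith (D + D) (fun x => g (x + s • w) - g x) := hgs.sub hD
    have k := hgsd.integral_lineDeriv_mul_eq (μ := volume) hC h.compact (-v)
    simp only [neg_neg] at k
    have hl : ∀ x, lineDeriv ℝ (fun x => g (x + s • w) - g x) x (-v)
        = - (lineDeriv ℝ g (x + s • w) v - lineDeriv ℝ g x v) := by
      intro x
      have h1 : HasFDerivAt (fun x => g (x + s • w) - g x)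
          (fderiv ℝ g (x + s • w) - fderiv ℝ g x) x := by
        have : HasFDerivAt (fun x => x + s • w) (ContinuousLinearMap.id ℝ E) x :=
          (hasFDerivAt_id x).add_const _
        exact ((hgd (x + s • w)).hasFDerivAt.comp x this).sub (hgd x).hasFDerivAt
      rw [lineDeriv_neg, h1.differentiableAt.lineDeriv_eq_fderiv, h1.fderiv,
        (hgd x).lineDeriv_eq_fderiv, (hgd _).lineDeriv_eq_fderiv]
      rfl
    have i1 : Integrable fun x => lineDeriv ℝ g (x + s • w) v * χ x :=
      (((hgcont v).comp (continuous_add_const (s • w))).mul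
        hC.continuous).integrable_of_hasCompactSupport h.compact.mul_left
    have i2 : Integrable fun x => lineDeriv ℝ g x v * χ x :=
      ((hgcont v).mul hC.continuous).integrable_of_hasCompactSupport h.compact.mul_left
    have i3 : Integrable fun x => lineDeriv ℝ g x v * χ (x + s • (-w)) := by
      have := i1.comp_add_right (s • (-w))
      refine this.congr (Eventually.of_forall fun x => ?_)
      simp
    have sh : ∫ x, lineDeriv ℝ g (x + s • w) v * χ x
        = ∫ x, lineDeriv ℝ g x v * χ (x + s • (-w)) := by
      rw [← integral_add_right_eq_self (fun x => lineDeriv ℝ g x v * χ (x + s • (-w))) (s • w)]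
      refine integral_congr_ae (Eventually.of_forall fun x => ?_)
      simp
    calc ∫ x, (s⁻¹ • (g (x + s • w) - g x)) * lineDeriv ℝ χ x v
        = s⁻¹ * ∫ x, lineDeriv ℝ χ x v * (g (x + s • w) - g x) := by
          rw [← integral_const_mul]
          refine integral_congr_ae (Eventually.of_forall fun x => ?_)
          simp only [smul_eq_mul]; ring
      _ = s⁻¹ * ∫ x, -(lineDeriv ℝ g (x + s • w) v - lineDeriv ℝ g x v) * χ x := by
          rw [← k]; simp_rw [hl]
      _ = - (s⁻¹ * ((∫ x, lineDeriv ℝ g (x + s • w) v * χ x) - ∫ x, lineDeriv ℝ g x v * χ x)) := by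
          rw [← integral_sub i1 i2, ← mul_neg, ← integral_neg]
          congr 1
          refine integral_congr_ae (Eventually.of_forall fun x => ?_)
          simp only; ring
      _ = _ := by
          rw [sh, ← integral_sub i3 i2, ← integral_const_mul]
          congr 1
          refine integral_congr_ae (Eventually.of_forall fun x => ?_)
          simp only [smul_eq_mul]; ring
  simp_rw [hshift] at A
  have := tendsto_nhds_unique A B.neg
  calc ∫ x, lineDeriv ℝ χ x v * lineDeriv ℝ g x w
      = ∫ x, lineDeriv ℝ g x w * lineDeriv ℝ χ x v :=
        integral_congr_ae (Eventually.of_forall fun x => mul_comm _ _)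
    _ = _ := by
      rw [this, ← integral_neg]
      refine integral_congr_ae (Eventually.of_forall fun x => ?_)
      simp only [lineDeriv_neg, neg_mul, neg_neg]

end IsLipschitzTest

end WeakDerivatives

end

noncomputable section

open Filter Topology Metric

set_option linter.unusedSectionVars false

/-! ### The trace of an endomorphism -/

section Trace

variable {E : Type*} [NormedAddCommGroup E] [InnerProductSpace ℝ E] [FiniteDimensional ℝ E]

/-- The trace as a continuous linear functional on the endomorphisms of `E`. -/
def ctrace : (E →L[ℝ] E) →L[ℝ] ℝ :=
  LinearMap.toContinuousLinearMap ((LinearMap.trace ℝ E).comp (ContinuousLinearMap.coeLM ℝ))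

theorem ctrace_eq_sum {ι : Type*} [Fintype ι] (e : OrthonormalBasis ι ℝ E) (L : E →L[ℝ] E) :
    ctrace L = ∑ i, inner ℝ (e i) (L (e i)) := by
  simp only [ctrace, LinearMap.coe_toContinuousLinearMap', LinearMap.comp_apply]
  exact LinearMap.trace_eq_sum_inner _ e

/-- Produces the term `Dm · b` in the expansion of `div (m b)`. -/
theorem ctrace_smulRight (l : E →L[ℝ] ℝ) (w : E) : ctrace (l.smulRight w) = l w := by
  rw [ctrace_eq_sum (stdOrthonormalBasis ℝ E)]
  have := (stdOrthonormalBasis ℝ E).sum_repr' w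
  conv_rhs => rw [← this]
  simp [map_sum, inner_smul_right, mul_comm]

theorem ctrace_comp_eq_sum {ι : Type*} [Fintype ι] (e : OrthonormalBasis ι ℝ E)
    (L M : E →L[ℝ] E) :
    ctrace (L.comp M) = ∑ i, ∑ j, inner ℝ (e i) (L (e j)) * inner ℝ (e j) (M (e i)) := by
  rw [ctrace_eq_sum e]
  refine Finset.sum_congr rfl fun i _ => ?_
  conv_lhs => rw [ContinuousLinearMap.comp_apply, ← e.sum_repr' (M (e i))]
  simp [map_sum, inner_sum, inner_smul_right, mul_comm]

end Trace

/-! ### Weak divergences and the Piola identity -/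

section WeakDivergence

variable {E : Type*} [NormedAddCommGroup E] [InnerProductSpace ℝ E] [FiniteDimensional ℝ E]
  [MeasurableSpace E] [BorelSpace E]

/-- `θ` is the divergence of `F` in `Ω` in the sense of distributions. -/
def HasWeakDivergence (Ω : Set E) (F : E → E) (θ : E → ℝ) : Prop :=
  ∀ χ, IsLipschitzTest Ω χ → ∫ x in Ω, χ x * θ x = - ∫ x in Ω, fderiv ℝ χ x (F x)

variable {Ω : Set E} {χ : E → ℝ}

theorem IsLipschitzTest.integrableOn_of_forall (h : IsLipschitzTest Ω χ) (hΩ : MeasurableSet Ω)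
    {G : E → ℝ} (hm : AEStronglyMeasurable G (volume.restrict Ω)) {M : ℝ}
    (hM : ∀ x ∈ tsupport χ, |G x| ≤ M) (h0 : ∀ x ∉ tsupport χ, G x = 0) :
    IntegrableOn G Ω := by
  have : IntegrableOn G (tsupport χ) := by
    refine IntegrableOn.of_bound h.compact.measure_lt_top
      (hm.mono_measure (Measure.restrict_mono h.subset le_rfl)) M ?_
    exact (ae_restrict_iff' (isClosed_tsupport χ).measurableSet).2
      (Eventually.of_forall fun x hx => hM x hx)
  exact this.of_forall_sdiff_eq_zero hΩ fun x hx => h0 x hx.2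

theorem IsLipschitzTest.integrableOn_mul (h : IsLipschitzTest Ω χ) (hΩ : IsOpen Ω)
    {g : E → ℝ} (hg : ContinuousOn g Ω) : IntegrableOn (fun x => χ x * g x) Ω := by
  have hc : ContinuousOn (fun x => χ x * g x) Ω := h.continuous.continuousOn.mul hg
  obtain ⟨M, hM⟩ := h.compact.isCompact.exists_bound_of_continuousOn (hc.mono h.subset)
  exact h.integrableOn_of_forall hΩ.measurableSet (hc.aestronglyMeasurable hΩ.measurableSet) hM
    fun x hx => by rw [image_eq_zero_of_notMem_tsupport hx, zero_mul]

theorem IsLipschitzTest.integrableOn_fderiv_apply (h : IsLipschitzTest Ω χ) (hΩ : IsOpen Ω)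
    {F : E → E} (hF : ContinuousOn F Ω) :
    IntegrableOn (fun x => fderiv ℝ χ x (F x)) Ω := by
  obtain ⟨C, hC⟩ := h.lipschitz
  obtain ⟨M, hM⟩ := h.compact.isCompact.exists_bound_of_continuousOn (hF.mono h.subset)
  refine h.integrableOn_of_forall hΩ.measurableSet ?_ (M := C * M) (fun x hx => ?_) fun x hx => ?_
  · exact (ContinuousLinearMap.id ℝ (E →L[ℝ] ℝ)).aestronglyMeasurable_comp₂
      (measurable_fderiv ℝ χ).aestronglyMeasurable (hF.aestronglyMeasurable hΩ.measurableSet)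
  · refine ((fderiv ℝ χ x).le_opNorm _).trans ?_
    exact mul_le_mul (norm_fderiv_le_of_lipschitz ℝ hC) (hM x hx) (norm_nonneg _) C.2
  · rw [IsLipschitzTest.fderiv_eq_zero hx]; rfl

theorem IsLipschitzTest.integrableOn_fderiv_mul (h : IsLipschitzTest Ω χ) (hΩ : IsOpen Ω)
    {g : E → ℝ} (hg : ContinuousOn g Ω) (v : E) :
    IntegrableOn (fun x => fderiv ℝ χ x v * g x) Ω := by
  refine (h.integrableOn_fderiv_apply hΩ (F := fun x => g x • v)
    (hg.smul continuousOn_const)).congr_fun (fun x _ => ?_) hΩ.measurableSet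
  simp [mul_comm]

theorem hasWeakDivergence_of_contDiffOn (hΩ : IsOpen Ω) {F : E → E} (hF : ContDiffOn ℝ 1 F Ω) :
    HasWeakDivergence Ω F (fun x => ctrace (fderiv ℝ F x)) := by
  intro χ h
  let e := stdOrthonormalBasis ℝ E
  have hFd : ∀ x ∈ Ω, DifferentiableAt ℝ F x := fun x hx =>
    (hF.contDiffAt (hΩ.mem_nhds hx)).differentiableAt (by simp)
  have hFi : ∀ i, ContDiffOn ℝ 1 (fun x => inner ℝ (e i) (F x)) Ω := fun i =>
    contDiffOn_const.inner ℝ hF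
  have hfd : ∀ i, ∀ x ∈ Ω, ∀ v, fderiv ℝ (fun x => inner ℝ (e i) (F x)) x v
      = inner ℝ (e i) (fderiv ℝ F x v) := by
    intro i x hx v
    rw [fderiv_inner_apply ℝ (differentiableAt_const _) (hFd x hx)]
    simp
  have hDF : ContinuousOn (fun x => fderiv ℝ F x) Ω := hF.continuousOn_fderiv_of_isOpen hΩ le_rfl
  calc ∫ x in Ω, χ x * ctrace (fderiv ℝ F x)
      = ∫ x in Ω, ∑ i, χ x * fderiv ℝ (fun x => inner ℝ (e i) (F x)) x (e i) := by
        refine setIntegral_congr_fun hΩ.measurableSet fun x hx => ?_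
        simp only [ctrace_eq_sum e, Finset.mul_sum]
        exact Finset.sum_congr rfl fun i _ => by rw [hfd i x hx]
    _ = ∑ i, ∫ x in Ω, χ x * fderiv ℝ (fun x => inner ℝ (e i) (F x)) x (e i) := by
        refine integral_finsetSum _ fun i _ => h.integrableOn_mul hΩ ?_
        exact ((hFi i).continuousOn_fderiv_of_isOpen hΩ le_rfl).clm_apply continuousOn_const
    _ = ∑ i, - ∫ x in Ω, fderiv ℝ χ x (e i) * inner ℝ (e i) (F x) :=
        Finset.sum_congr rfl fun i _ => h.integral_mul_fderiv hΩ (hFi i) _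
    _ = - ∫ x in Ω, ∑ i, fderiv ℝ χ x (e i) * inner ℝ (e i) (F x) := by
        rw [Finset.sum_neg_distrib, integral_finsetSum _ fun i _ =>
          h.integrableOn_fderiv_mul hΩ (hFi i).continuousOn _]
    _ = _ := by
        congr 1
        refine setIntegral_congr_fun hΩ.measurableSet fun x hx => ?_
        conv_rhs => rw [← e.sum_repr' (F x)]
        simp [map_sum, mul_comm]

/-- The Piola identity: `b div b - Db b` has divergence `(div b)² - tr (Db)²`. -/
theorem hasWeakDivergence_piola (hΩ : IsOpen Ω) {b : E → E} (hb : ContDiffOn ℝ 1 b Ω) :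
    HasWeakDivergence Ω (fun x => ctrace (fderiv ℝ b x) • b x - fderiv ℝ b x (b x))
      (fun x => ctrace (fderiv ℝ b x) ^ 2 - ctrace ((fderiv ℝ b x).comp (fderiv ℝ b x))) := by
  intro ψ h
  let e := stdOrthonormalBasis ℝ E
  have hbd : ∀ x ∈ Ω, DifferentiableAt ℝ b x := fun x hx =>
    (hb.contDiffAt (hΩ.mem_nhds hx)).differentiableAt (by simp)
  have hbi : ∀ i, ContDiffOn ℝ 1 (fun x => inner ℝ (e i) (b x)) Ω := fun i =>
    contDiffOn_const.inner ℝ hb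
  have hDb : ContinuousOn (fun x => fderiv ℝ b x) Ω := hb.continuousOn_fderiv_of_isOpen hΩ le_rfl
  have hfd : ∀ i, ∀ x ∈ Ω, ∀ v, fderiv ℝ (fun x => inner ℝ (e i) (b x)) x v
      = inner ℝ (e i) (fderiv ℝ b x v) := by
    intro i x hx v
    rw [fderiv_inner_apply ℝ (differentiableAt_const _) (hbd x hx)]
    simp
  have hcont : ∀ i j, ContinuousOn (fun x => inner ℝ (e i) (fderiv ℝ b x (e j))) Ω := fun i j =>
    continuousOn_const.inner (hDb.clm_apply continuousOn_const)
  -- Here `p i j` is `∂_j (ψ b_j) ∂_i b_i` and `q i j` is `∂_i (ψ b_j) ∂_j b_i`. Weak symmetry of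
  -- mixed derivatives gives them equal integrals. Expanding the products, the sum of `p - q` is `ψ
  -- ((div b)² - tr (Db)²)` plus `Dψ` applied to `div b · b - Db b`.
  set p : _ → _ → E → ℝ := fun i j x =>
    fderiv ℝ (fun x => ψ x * inner ℝ (e j) (b x)) x (e j) * inner ℝ (e i) (fderiv ℝ b x (e i))
      with hp
  set q : _ → _ → E → ℝ := fun i j x =>
    fderiv ℝ (fun x => ψ x * inner ℝ (e j) (b x)) x (e i) * inner ℝ (e i) (fderiv ℝ b x (e j))
      with hq
  have hpi : ∀ i j, IntegrableOn (p i j) Ω := fun i j =>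
    (h.mul_contDiffOn hΩ (hbi j)).integrableOn_fderiv_mul hΩ (hcont i i) _
  have hqi : ∀ i j, IntegrableOn (q i j) Ω := fun i j =>
    (h.mul_contDiffOn hΩ (hbi j)).integrableOn_fderiv_mul hΩ (hcont i j) _
  have hpq : ∀ i j, ∫ x in Ω, p i j x = ∫ x in Ω, q i j x := by
    intro i j
    have := (h.mul_contDiffOn hΩ (hbi j)).integral_fderiv_mul_fderiv_comm hΩ (hbi i) (e j) (e i)
    convert this using 1
    · exact setIntegral_congr_fun hΩ.measurableSet fun x hx => by simp only [hp, hfd i x hx]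
    · exact setIntegral_congr_fun hΩ.measurableSet fun x hx => by simp only [hq, hfd i x hx]
  have hpqi : ∀ i j, IntegrableOn (fun x => p i j x - q i j x) Ω := fun i j =>
    (hpi i j).sub (hqi i j)
  have hsum : ∫ x in Ω, ∑ i, ∑ j, (p i j x - q i j x) = 0 := by
    rw [integral_finsetSum _ fun i _ => integrable_finsetSum _ fun j _ => hpqi i j]
    refine Finset.sum_eq_zero fun i _ => ?_
    rw [integral_finsetSum _ fun j _ => hpqi i j]
    refine Finset.sum_eq_zero fun j _ => ?_
    rw [integral_sub (hpi i j) (hqi i j), hpq, sub_self]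
  have hid : ∀ᵐ x ∂(volume.restrict Ω), ∑ i, ∑ j, (p i j x - q i j x)
      = ψ x * (ctrace (fderiv ℝ b x) ^ 2 - ctrace ((fderiv ℝ b x).comp (fderiv ℝ b x)))
        + fderiv ℝ ψ x (ctrace (fderiv ℝ b x) • b x - fderiv ℝ b x (b x)) := by
    filter_upwards [ae_restrict_of_ae h.ae_differentiableAt, ae_restrict_mem hΩ.measurableSet]
      with x hdx hx
    have hprod : ∀ j v, fderiv ℝ (fun x => ψ x * inner ℝ (e j) (b x)) x v
        = ψ x * inner ℝ (e j) (fderiv ℝ b x v) + inner ℝ (e j) (b x) * fderiv ℝ ψ x v := by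
      intro j v
      rw [fderiv_fun_mul hdx (((hbi j).contDiffAt (hΩ.mem_nhds hx)).differentiableAt (by simp))]
      simp [hfd j x hx]
    have e1 : ∑ j, inner ℝ (e j) (b x) * fderiv ℝ ψ x (e j) = fderiv ℝ ψ x (b x) := by
      conv_rhs => rw [← e.sum_repr' (b x)]
      simp [map_sum]
    have e2 : ∀ v, ∑ i, inner ℝ (e i) v * fderiv ℝ ψ x (e i) = fderiv ℝ ψ x v := by
      intro v
      conv_rhs => rw [← e.sum_repr' v]
      simp [map_sum]
    have e3 : ∀ i, ∑ j, inner ℝ (e j) (b x) * inner ℝ (e i) (fderiv ℝ b x (e j))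
        = inner ℝ (e i) (fderiv ℝ b x (b x)) := by
      intro i
      conv_rhs => rw [← e.sum_repr' (b x)]
      simp [map_sum, inner_sum, inner_smul_right]
    have lhs1 : ∑ i, ∑ j, p i j x = ψ x * ctrace (fderiv ℝ b x) ^ 2
        + ctrace (fderiv ℝ b x) * fderiv ℝ ψ x (b x) := by
      simp only [hp, hprod, ← Finset.sum_mul, Finset.sum_add_distrib, ← Finset.mul_sum, e1]
      rw [ctrace_eq_sum e]
      ring
    have lhs2 : ∑ i, ∑ j, q i j x = ψ x * ctrace ((fderiv ℝ b x).comp (fderiv ℝ b x))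
        + fderiv ℝ ψ x (fderiv ℝ b x (b x)) := by
      rw [ctrace_comp_eq_sum e, ← e2 (fderiv ℝ b x (b x))]
      simp only [hq, hprod, Finset.mul_sum, ← Finset.sum_add_distrib]
      refine Finset.sum_congr rfl fun i _ => ?_
      rw [← e3 i, Finset.sum_mul, ← Finset.sum_add_distrib]
      refine Finset.sum_congr rfl fun j _ => ?_
      ring
    simp only [Finset.sum_sub_distrib, lhs1, lhs2, map_sub, map_smul, smul_eq_mul]
    ring
  rw [integral_congr_ae hid, integral_add] at hsum
  · linarith
  · refine h.integrableOn_mul hΩ ?_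
    exact ((ctrace.continuous.comp_continuousOn hDb).pow 2).sub
      (ctrace.continuous.comp_continuousOn (hDb.clm_comp hDb))
  · refine h.integrableOn_fderiv_apply hΩ ?_
    exact ((ctrace.continuous.comp_continuousOn hDb).smul hb.continuousOn).sub
      (hDb.clm_apply hb.continuousOn)

/-- Testing the divergence of `F` with `χ P` and using the product rule for `D(χ P)` almost
everywhere. Since `F` is merely continuous, this applies to the Piola field multiplied by the
pressure. -/
theorem HasWeakDivergence.smul (hΩ : IsOpen Ω) {F : E → E} {θ : E → ℝ}
    (h : HasWeakDivergence Ω F θ) (hF : ContinuousOn F Ω) (hθ : ContinuousOn θ Ω) {P : E → ℝ}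
    (hP : ContDiffOn ℝ 1 P Ω) :
    HasWeakDivergence Ω (fun x => P x • F x) (fun x => fderiv ℝ P x (F x) + P x * θ x) := by
  intro χ hχ
  have h1 := h _ (hχ.mul_contDiffOn hΩ hP)
  have hDP : ContinuousOn (fun x => fderiv ℝ P x) Ω := hP.continuousOn_fderiv_of_isOpen hΩ le_rfl
  have e1 : ∫ x in Ω, fderiv ℝ (fun x => χ x * P x) x (F x)
      = (∫ x in Ω, χ x * fderiv ℝ P x (F x)) + ∫ x in Ω, fderiv ℝ χ x (P x • F x) := by
    rw [← integral_add (hχ.integrableOn_mul hΩ (hDP.clm_apply hF))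
      (hχ.integrableOn_fderiv_apply hΩ (F := fun x => P x • F x) (hP.continuousOn.smul hF))]
    refine integral_congr_ae ?_
    filter_upwards [ae_restrict_of_ae hχ.ae_differentiableAt, ae_restrict_mem hΩ.measurableSet]
      with x hdx hx
    rw [fderiv_fun_mul hdx ((hP.contDiffAt (hΩ.mem_nhds hx)).differentiableAt (by simp))]
    simp
  have e2 : ∫ x in Ω, χ x * (fderiv ℝ P x (F x) + P x * θ x)
      = (∫ x in Ω, χ x * fderiv ℝ P x (F x)) + ∫ x in Ω, χ x * P x * θ x := by
    rw [← integral_add (hχ.integrableOn_mul hΩ (hDP.clm_apply hF))]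
    · refine integral_congr_ae (Eventually.of_forall fun x => ?_)
      simp only; ring
    · simp_rw [mul_assoc]
      exact hχ.integrableOn_mul hΩ (hP.continuousOn.mul hθ)
  rw [e2, h1, e1]
  ring

end WeakDivergence

end

noncomputable section

open Filter Topology Metric

set_option linter.unusedSectionVars false

/-! ### The gauge of a convex domain and its level sets -/

section Gauge

variable {E : Type*} [NormedAddCommGroup E] [InnerProductSpace ℝ E] [FiniteDimensional ℝ E]
  [MeasurableSpace E] [BorelSpace E]

/-- `ν` is an outward normal vector (of any length) of the convex set `Ω` at `x`. -/
def IsNormalVector (Ω : Set E) (x ν : E) : Prop := ∀ y ∈ Ω, inner ℝ ν (y - x) ≤ 0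

/-- The gauge of `Ω` centred at the point `o`. -/
def gaugeAt (Ω : Set E) (o x : E) : ℝ := gauge ((fun y => y + o) ⁻¹' Ω) (x - o)

variable {Ω : Set E} {o : E}

theorem isOpen_translate (hΩ : IsOpen Ω) : IsOpen ((fun y => y + o) ⁻¹' Ω) :=
  hΩ.preimage (continuous_add_const o)

theorem convex_translate (hc : Convex ℝ Ω) : Convex ℝ ((fun y => y + o) ⁻¹' Ω) :=
  hc.translate_preimage_left o

theorem translate_mem_nhds (hΩ : IsOpen Ω) (ho : o ∈ Ω) : (fun y => y + o) ⁻¹' Ω ∈ 𝓝 (0 : E) :=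
  (isOpen_translate hΩ).mem_nhds (by simpa using ho)

theorem gaugeAt_lt_one_iff (hΩ : IsOpen Ω) (hc : Convex ℝ Ω) (ho : o ∈ Ω) {x : E} :
    gaugeAt Ω o x < 1 ↔ x ∈ Ω := by
  rw [gaugeAt, gauge_lt_one_iff_mem_interior (convex_translate hc) (translate_mem_nhds hΩ ho),
    (isOpen_translate hΩ).interior_eq]
  simp

theorem gaugeAt_eq_one_iff (hΩ : IsOpen Ω) (hc : Convex ℝ Ω) (ho : o ∈ Ω) {x : E} :
    gaugeAt Ω o x = 1 ↔ x ∈ frontier Ω := by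
  rw [gaugeAt, gauge_eq_one_iff_mem_frontier (convex_translate hc) (translate_mem_nhds hΩ ho)]
  have := (Homeomorph.addRight o).preimage_frontier Ω
  simp only [Homeomorph.coe_addRight] at this
  rw [← this]
  simp

theorem exists_lipschitzWith_gaugeAt (hΩ : IsOpen Ω) (hc : Convex ℝ Ω) (ho : o ∈ Ω) :
    ∃ C, LipschitzWith C (gaugeAt Ω o) := by
  obtain ⟨C, hC⟩ := (convex_translate hc).lipschitz_gauge (translate_mem_nhds hΩ ho)
  refine ⟨C, LipschitzWith.of_dist_le_mul fun x y => ?_⟩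
  simpa [gaugeAt] using hC.dist_le_mul (x - o) (y - o)

theorem gaugeAt_nonneg (x : E) : 0 ≤ gaugeAt Ω o x := gauge_nonneg _

theorem gaugeAt_homothety {r : ℝ} (hr : 0 ≤ r) (x : E) :
    gaugeAt Ω o (o + r • (x - o)) = r * gaugeAt Ω o x := by
  rw [gaugeAt, add_sub_cancel_left, gauge_smul_of_nonneg hr]; rfl

theorem gaugeAt_add_le (hΩ : IsOpen Ω) (hc : Convex ℝ Ω) (ho : o ∈ Ω) {t : ℝ} (ht : 0 ≤ t)
    (x v : E) : gaugeAt Ω o (x + t • v) ≤ gaugeAt Ω o x + t * gaugeAt Ω o (o + v) := by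
  have h := gauge_add_le (convex_translate (o := o) hc)
    (absorbent_nhds_zero (translate_mem_nhds hΩ ho)) (x - o) (t • v)
  rw [gauge_smul_of_nonneg ht] at h
  have e : x + t • v - o = x - o + t • v := by abel
  simp only [gaugeAt, e, add_sub_cancel_left]
  exact h

/-- Subadditivity and homogeneity of the gauge bound every difference quotient. -/
theorem fderiv_gaugeAt_le (hΩ : IsOpen Ω) (hc : Convex ℝ Ω) (ho : o ∈ Ω) {x : E}
    (hx : DifferentiableAt ℝ (gaugeAt Ω o) x) (v : E) :
    fderiv ℝ (gaugeAt Ω o) x v ≤ gaugeAt Ω o (o + v) := by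
  have h := (hx.hasFDerivAt.hasLineDerivAt v).tendsto_slope_zero_right
  refine le_of_tendsto h ?_
  filter_upwards [self_mem_nhdsWithin] with t ht
  have ht : (0 : ℝ) < t := ht
  have := gaugeAt_add_le hΩ hc ho ht.le x v
  rw [smul_eq_mul, inv_mul_le_iff₀ ht]
  linarith

/-- Euler's identity for a positively homogeneous function of degree one. -/
theorem fderiv_gaugeAt_sub {x : E}
    (hx : DifferentiableAt ℝ (gaugeAt Ω o) x) :
    fderiv ℝ (gaugeAt Ω o) x (x - o) = gaugeAt Ω o x := by
  have h := (hx.hasFDerivAt.hasLineDerivAt (x - o)).tendsto_slope_zero_right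
  refine tendsto_nhds_unique h (tendsto_const_nhds.congr' ?_)
  filter_upwards [self_mem_nhdsWithin] with t ht
  have ht : (0 : ℝ) < t := ht
  have e : x + t • (x - o) = o + (1 + t) • (x - o) := by module
  rw [e, gaugeAt_homothety (by linarith), smul_eq_mul]
  field_simp
  ring

/-- The derivative in the direction `y - o` is at most the gauge of `y`, hence below `1` for `y ∈
Ω`, while at the radial projection of `x` Euler's identity makes it exactly `1`. Thus normals are
read off at interior points, without any smoothness of the boundary. -/
theorem isNormalVector_fderiv_gaugeAt (hΩ : IsOpen Ω) (hc : Convex ℝ Ω) (ho : o ∈ Ω) {x : E}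
    (hx : DifferentiableAt ℝ (gaugeAt Ω o) x) (hpos : 0 < gaugeAt Ω o x) :
    IsNormalVector Ω (o + (gaugeAt Ω o x)⁻¹ • (x - o)) (gradient (gaugeAt Ω o) x) := by
  intro y hy
  have e : y - (o + (gaugeAt Ω o x)⁻¹ • (x - o)) = (y - o) - (gaugeAt Ω o x)⁻¹ • (x - o) := by abel
  rw [gradient, InnerProductSpace.toDual_symm_apply, e, map_sub, map_smul,
    fderiv_gaugeAt_sub hx, smul_eq_mul, inv_mul_cancel₀ hpos.ne']
  have h1 := fderiv_gaugeAt_le hΩ hc ho hx (y - o)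
  rw [add_sub_cancel] at h1
  have h2 := (gaugeAt_lt_one_iff hΩ hc ho).2 hy
  linarith

theorem mem_frontier_homothety (hΩ : IsOpen Ω) (hc : Convex ℝ Ω) (ho : o ∈ Ω) {x : E}
    (hpos : 0 < gaugeAt Ω o x) : o + (gaugeAt Ω o x)⁻¹ • (x - o) ∈ frontier Ω := by
  rw [← gaugeAt_eq_one_iff hΩ hc ho, gaugeAt_homothety (by positivity),
    inv_mul_cancel₀ hpos.ne']

/-- The part of `Ω` where the gauge is at least `1 - τ` has small volume. -/
theorem measureReal_gaugeAt_strip_le (hΩ : IsOpen Ω) (hc : Convex ℝ Ω) (ho : o ∈ Ω)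
    (hb : Bornology.IsBounded Ω) {τ : ℝ} (h0 : 0 ≤ τ) (h1 : τ < 1) :
    volume.real {x ∈ Ω | 1 - τ < gaugeAt Ω o x} ≤ Module.finrank ℝ E * τ * volume.real Ω := by
  -- The strip misses the homothetic copy `A` of `Ω`, whose relative volume is `(1 - τ) ^ n`, with
  -- `n` the dimension; Bernoulli's inequality bounds this below by `1 - n τ`.
  set A := (AffineMap.homothety o (1 - τ)) '' Ω with hA
  have hAΩ : A ⊆ Ω := by
    rintro _ ⟨x, hx, rfl⟩
    rw [AffineMap.homothety_apply, vsub_eq_sub, vadd_eq_add, add_comm]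
    rw [← gaugeAt_lt_one_iff hΩ hc ho, gaugeAt_homothety (by linarith)]
    have := (gaugeAt_lt_one_iff hΩ hc ho).2 hx
    nlinarith [gaugeAt_nonneg (Ω := Ω) (o := o) x]
  have hsub : {x ∈ Ω | 1 - τ < gaugeAt Ω o x} ⊆ Ω \ A := by
    rintro x ⟨hx, hxτ⟩
    refine ⟨hx, ?_⟩
    rintro ⟨y, hy, rfl⟩
    rw [AffineMap.homothety_apply, vsub_eq_sub, vadd_eq_add, add_comm,
      gaugeAt_homothety (by linarith)] at hxτ
    have := (gaugeAt_lt_one_iff hΩ hc ho).2 hy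
    nlinarith
  have hvA : volume.real A = (1 - τ) ^ Module.finrank ℝ E * volume.real Ω := by
    rw [Measure.real, hA, Measure.addHaar_image_homothety, ENNReal.toReal_mul,
      ENNReal.toReal_ofReal (abs_nonneg _), abs_of_nonneg (by have : 0 ≤ 1 - τ := by linarith
                                                              positivity)]
    rfl
  have hAm : MeasurableSet A := by
    refine IsOpen.measurableSet ?_
    have : (1 - τ) ≠ 0 := by linarith
    exact AffineMap.homothety_isOpenMap o _ this _ hΩ
  have hfin : volume Ω ≠ ⊤ := hb.measure_lt_top.ne
  calc volume.real {x ∈ Ω | 1 - τ < gaugeAt Ω o x} ≤ volume.real (Ω \ A) :=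
        measureReal_mono hsub (measure_ne_top_of_subset sdiff_subset hfin)
    _ = volume.real Ω - volume.real A := by
        rw [measureReal_sdiff hAΩ hAm hfin]
    _ ≤ _ := by
        rw [hvA]
        have := one_add_mul_le_pow (a := -τ) (by linarith) (Module.finrank ℝ E)
        rw [← sub_eq_add_neg] at this
        nlinarith [measureReal_nonneg (μ := volume) (s := Ω)]

end Gauge

/-! ### A one-sided divergence theorem on convex sets -/

section DivergenceTheorem

variable {E : Type*} [NormedAddCommGroup E] [InnerProductSpace ℝ E] [FiniteDimensional ℝ E]
  [MeasurableSpace E] [BorelSpace E] {Ω : Set E} {o : E}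

/-- A cutoff function of a convex set: `1` where the gauge is at most `1 - 2δ` and `0` where it is
at least `1 - δ`. -/
def gaugeCutoff (Ω : Set E) (o : E) (δ : ℝ) (x : E) : ℝ :=
  max 0 (min 1 (δ⁻¹ * (1 - δ - gaugeAt Ω o x)))

theorem gaugeCutoff_nonneg (δ : ℝ) (x : E) : 0 ≤ gaugeCutoff Ω o δ x := le_max_left _ _

theorem gaugeCutoff_le_one (δ : ℝ) (x : E) : gaugeCutoff Ω o δ x ≤ 1 :=
  max_le zero_le_one (min_le_left _ _)

theorem gaugeCutoff_eq_one {δ : ℝ} (hδ : 0 < δ) {x : E} (hx : gaugeAt Ω o x ≤ 1 - 2 * δ) :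
    gaugeCutoff Ω o δ x = 1 := by
  have : 1 ≤ δ⁻¹ * (1 - δ - gaugeAt Ω o x) := by
    rw [le_inv_mul_iff₀ hδ]; linarith
  rw [gaugeCutoff, min_eq_left this, max_eq_right zero_le_one]

theorem gaugeCutoff_eq_zero {δ : ℝ} (hδ : 0 < δ) {x : E} (hx : 1 - δ ≤ gaugeAt Ω o x) :
    gaugeCutoff Ω o δ x = 0 := by
  have : δ⁻¹ * (1 - δ - gaugeAt Ω o x) ≤ 0 :=
    mul_nonpos_of_nonneg_of_nonpos (by positivity) (by linarith)
  rw [gaugeCutoff, max_eq_left ((min_le_right _ _).trans this)]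

theorem isLipschitzTest_gaugeCutoff (hΩ : IsOpen Ω) (hc : Convex ℝ Ω) (ho : o ∈ Ω)
    (hb : Bornology.IsBounded Ω) {δ : ℝ} (hδ : 0 < δ) :
    IsLipschitzTest Ω (gaugeCutoff Ω o δ) := by
  obtain ⟨C, hC⟩ := exists_lipschitzWith_gaugeAt hΩ hc ho
  have hclosed : IsClosed {x | gaugeAt Ω o x ≤ 1 - δ} := isClosed_le hC.continuous continuous_const
  have hsub : {x | gaugeAt Ω o x ≤ 1 - δ} ⊆ Ω := fun x hx =>
    (gaugeAt_lt_one_iff hΩ hc ho).1 (lt_of_le_of_lt hx (by linarith))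
  have hsupp : tsupport (gaugeCutoff Ω o δ) ⊆ {x | gaugeAt Ω o x ≤ 1 - δ} := by
    refine closure_minimal (fun x hx => ?_) hclosed
    by_contra h
    exact hx (gaugeCutoff_eq_zero hδ (not_le.1 h).le)
  refine ⟨?_, ?_, hsupp.trans hsub⟩
  · have h1 : LipschitzWith (δ⁻¹.toNNReal * C) (fun x => δ⁻¹ * (1 - δ - gaugeAt Ω o x)) := by
      refine LipschitzWith.of_dist_le_mul fun x y => ?_
      have := hC.dist_le_mul x y
      rw [Real.dist_eq] at *
      rw [← mul_sub, abs_mul, abs_of_pos (by positivity : (0:ℝ) < δ⁻¹), sub_sub_sub_cancel_left,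
        abs_sub_comm]
      push_cast
      rw [Real.coe_toNNReal _ (by positivity), mul_assoc]
      gcongr
    exact ⟨_, (h1.const_min 1).const_max 0⟩
  · exact (Metric.isCompact_of_isClosed_isBounded (isClosed_tsupport _)
      (hb.subset (hsupp.trans hsub)))

/-- Where the cutoff equals `1` or `0` it is at a global extremum, so its derivative vanishes even
at the corners of the truncation; in between the cutoff is affine in the gauge. -/
theorem fderiv_gaugeCutoff (hΩ : IsOpen Ω) (hc : Convex ℝ Ω) (ho : o ∈ Ω) {δ : ℝ} (hδ : 0 < δ)
    (x : E) (hd : DifferentiableAt ℝ (gaugeAt Ω o) x) :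
    fderiv ℝ (gaugeCutoff Ω o δ) x = 0 ∨ (1 - 2 * δ < gaugeAt Ω o x ∧
      fderiv ℝ (gaugeCutoff Ω o δ) x = -(δ⁻¹ • fderiv ℝ (gaugeAt Ω o) x)) := by
  obtain ⟨C, hC⟩ := exists_lipschitzWith_gaugeAt hΩ hc ho
  rcases le_or_gt (gaugeAt Ω o x) (1 - 2 * δ) with h1 | h1
  · left
    refine IsLocalMax.fderiv_eq_zero (Eventually.of_forall fun y => ?_)
    rw [gaugeCutoff_eq_one hδ h1]; exact gaugeCutoff_le_one _ _
  rcases le_or_gt (1 - δ) (gaugeAt Ω o x) with h2 | h2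
  · left
    refine IsLocalMin.fderiv_eq_zero (Eventually.of_forall fun y => ?_)
    rw [gaugeCutoff_eq_zero hδ h2]; exact gaugeCutoff_nonneg _ _
  right
  refine ⟨h1, ?_⟩
  have heq : gaugeCutoff Ω o δ =ᶠ[𝓝 x] fun y => δ⁻¹ * (1 - δ - gaugeAt Ω o y) := by
    filter_upwards [hC.continuous.continuousAt.eventually (lt_mem_nhds h1),
      hC.continuous.continuousAt.eventually (gt_mem_nhds h2)] with y hy1 hy2
    have a1 : δ⁻¹ * (1 - δ - gaugeAt Ω o y) ≤ 1 := by
      rw [inv_mul_le_iff₀ hδ]; linarith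
    have a2 : 0 ≤ δ⁻¹ * (1 - δ - gaugeAt Ω o y) := mul_nonneg (by positivity) (by linarith)
    rw [gaugeCutoff, min_eq_right a1, max_eq_right a2]
  rw [heq.fderiv_eq, ((hd.hasFDerivAt.const_sub (1 - δ)).const_mul δ⁻¹).fderiv]
  simp

/-- The divergence theorem, as an inequality, on a bounded convex open set: if the continuous field
`F` points inwards on the boundary, its integrable weak divergence has nonpositive integral. -/
theorem HasWeakDivergence.integral_nonpos (hΩ : IsOpen Ω) (hc : Convex ℝ Ω) (hne : Ω.Nonempty)
    (hb : Bornology.IsBounded Ω) {F : E → E} {θ : E → ℝ} (h : HasWeakDivergence Ω F θ)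
    (hF : ContinuousOn F (closure Ω)) (hθ : IntegrableOn θ Ω)
    (hsign : ∀ x ∈ frontier Ω, ∀ ν, IsNormalVector Ω x ν → inner ℝ ν (F x) ≤ 0) :
    ∫ x in Ω, θ x ≤ 0 := by
  obtain ⟨o, ho⟩ := hne
  obtain ⟨C, hC⟩ := exists_lipschitzWith_gaugeAt hΩ hc ho
  have hcomp : IsCompact (closure Ω) := hb.isCompact_closure
  have huc := hcomp.uniformContinuousOn_of_continuous hF
  rw [Metric.uniformContinuousOn_iff_le] at huc
  obtain ⟨R, hR, hRΩ⟩ : ∃ R > 0, ∀ x ∈ Ω, ‖x - o‖ ≤ R := by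
    obtain ⟨R, hR⟩ := hb.exists_norm_le
    refine ⟨R + ‖o‖ + 1, ?_, fun x hx => ?_⟩
    · have := (norm_nonneg _).trans (hR o ho); positivity
    · linarith [norm_sub_le x o, hR x hx]
  set n := (Module.finrank ℝ E : ℝ)
  -- the flux through the strips is arbitrarily small
  have key : ∀ η > 0, ∀ᶠ δ in 𝓝[>] (0 : ℝ),
      ∫ x in Ω, gaugeCutoff Ω o δ x * θ x ≤ 2 * n * volume.real Ω * (C * η) := by
    intro η hη
    obtain ⟨r, hr, hFr⟩ := huc η hη
    have hδ0 : (0 : ℝ) < min (1 / 4) (r / (4 * R)) := by positivity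
    filter_upwards [Ioo_mem_nhdsGT hδ0] with δ hδ
    obtain ⟨hδpos, hδlt⟩ := hδ
    have hδ4 : δ < 1 / 4 := hδlt.trans_le (min_le_left _ _)
    have hδr : 4 * δ * R ≤ r := by
      have := (hδlt.trans_le (min_le_right _ _)).le
      rw [le_div_iff₀ (by positivity)] at this
      linarith
    have htest := isLipschitzTest_gaugeCutoff hΩ hc ho hb hδpos
    rw [h _ htest, ← integral_neg]
    -- The derivative of the cutoff has size `1 / δ` but lives on a strip of volume `O(δ)`. It
    -- therefore suffices to bound the flux there by `δ⁻¹` times a quantity of order `η`.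
    set strip := {x ∈ Ω | 1 - 2 * δ < gaugeAt Ω o x} with hstrip
    have hsm : MeasurableSet strip :=
      hΩ.measurableSet.inter (isOpen_lt continuous_const hC.continuous).measurableSet
    have hfin : volume strip < ⊤ :=
      lt_of_le_of_lt (measure_mono fun x hx => hx.1) hb.measure_lt_top
    have hle : ∀ᵐ x ∂(volume.restrict Ω), -(fderiv ℝ (gaugeCutoff Ω o δ) x (F x))
        ≤ strip.indicator (fun _ => δ⁻¹ * (C * η)) x := by
      filter_upwards [ae_restrict_of_ae (hC.ae_differentiableAt (μ := volume)),
        ae_restrict_mem hΩ.measurableSet] with x hd hx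
      rcases fderiv_gaugeCutoff hΩ hc ho hδpos x hd with h0 | ⟨hgt, h1⟩
      · rw [h0]
        simp only [zero_apply, neg_zero]
        exact indicator_nonneg (fun _ _ => by positivity) _
      · have hxs : x ∈ strip := ⟨hx, hgt⟩
        rw [indicator_of_mem hxs, h1]
        simp only [neg_apply, neg_neg, smul_apply,
          smul_eq_mul]
        gcongr
        have hγ : 0 < gaugeAt Ω o x := by linarith
        have hγ1 := (gaugeAt_lt_one_iff hΩ hc ho).2 hx
        -- The gauge gradient at `x` is a normal vector at the radial projection `y`, where the sign
        -- hypothesis applies. Uniform continuity of `F` pays for replacing `F x` by `F y`.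
        set y := o + (gaugeAt Ω o x)⁻¹ • (x - o) with hy
        have hyf := mem_frontier_homothety hΩ hc ho hγ
        have h2 := hsign y hyf _ (isNormalVector_fderiv_gaugeAt hΩ hc ho hd hγ)
        rw [gradient, InnerProductSpace.toDual_symm_apply] at h2
        have hxy : dist x y ≤ r := by
          have e : x - y = (1 - (gaugeAt Ω o x)⁻¹) • (x - o) := by
            rw [hy]; module
          rw [dist_eq_norm, e, norm_smul]
          have e2 : ‖1 - (gaugeAt Ω o x)⁻¹‖ ≤ 4 * δ := by
            rw [Real.norm_eq_abs, abs_sub_comm, abs_of_nonneg]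
            · rw [sub_le_iff_le_add, inv_le_comm₀ hγ (by linarith)]
              rw [inv_le_iff_one_le_mul₀ (by linarith)]
              nlinarith
            · rw [sub_nonneg]; exact (one_le_inv₀ hγ).2 hγ1.le
          exact (mul_le_mul e2 (hRΩ x hx) (norm_nonneg _) (by linarith)).trans hδr
        have h3 := hFr x (subset_closure hx) y (frontier_subset_closure hyf) hxy
        rw [dist_eq_norm] at h3
        have h4 : fderiv ℝ (gaugeAt Ω o) x (F x - F y) ≤ C * η := by
          refine (le_abs_self _).trans (((fderiv ℝ (gaugeAt Ω o) x).le_opNorm _).trans ?_)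
          exact mul_le_mul (norm_fderiv_le_of_lipschitz ℝ hC) h3 (norm_nonneg _) C.2
        rw [map_sub] at h4
        linarith
    calc ∫ x in Ω, -(fderiv ℝ (gaugeCutoff Ω o δ) x (F x))
        ≤ ∫ x in Ω, strip.indicator (fun _ => δ⁻¹ * (C * η)) x := by
          refine integral_mono_ae ?_ ?_ hle
          · exact (htest.integrableOn_fderiv_apply hΩ (hF.mono subset_closure)).neg
          · exact ((integrableOn_const (C := δ⁻¹ * (C * η)) hfin.ne).integrable_indicator
              hsm).integrableOn
      _ = volume.real strip * (δ⁻¹ * (C * η)) := by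
          rw [setIntegral_indicator hsm, setIntegral_const, smul_eq_mul,
            inter_eq_self_of_subset_right fun x hx => hx.1]
      _ ≤ (n * (2 * δ) * volume.real Ω) * (δ⁻¹ * (C * η)) := by
          gcongr
          exact measureReal_gaugeAt_strip_le hΩ hc ho hb (by linarith) (by linarith)
      _ = _ := by field_simp
  have hlim : Tendsto (fun δ => ∫ x in Ω, gaugeCutoff Ω o δ x * θ x) (𝓝[>] 0)
      (𝓝 (∫ x in Ω, θ x)) := by
    refine tendsto_integral_filter_of_dominated_convergence (fun x => ‖θ x‖) ?_ ?_ hθ.norm ?_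
    · filter_upwards [self_mem_nhdsWithin] with δ hδ
      exact (isLipschitzTest_gaugeCutoff hΩ hc ho hb hδ).continuous.aestronglyMeasurable.mul
        hθ.aestronglyMeasurable
    · refine Eventually.of_forall fun δ => Eventually.of_forall fun x => ?_
      rw [norm_mul, Real.norm_eq_abs, abs_of_nonneg (gaugeCutoff_nonneg _ _)]
      exact mul_le_of_le_one_left (norm_nonneg _) (gaugeCutoff_le_one _ _)
    · filter_upwards [ae_restrict_mem hΩ.measurableSet] with x hx
      have hγ1 := (gaugeAt_lt_one_iff hΩ hc ho).2 hx
      refine tendsto_const_nhds.congr' ?_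
      have : (0 : ℝ) < (1 - gaugeAt Ω o x) / 2 := by linarith
      filter_upwards [Ioo_mem_nhdsGT this] with δ hδ
      rw [gaugeCutoff_eq_one hδ.1 (by linarith [hδ.2]), one_mul]
  have hfinal : ∀ η > 0, ∫ x in Ω, θ x ≤ 2 * n * volume.real Ω * (C * η) := fun η hη =>
    le_of_tendsto hlim (key η hη)
  have ht : Tendsto (fun η : ℝ => 2 * n * volume.real Ω * (C * η)) (𝓝[>] 0) (𝓝 0) := by
    have : Tendsto (fun η : ℝ => 2 * n * volume.real Ω * (C * η)) (𝓝 0)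
        (𝓝 (2 * n * volume.real Ω * (C * 0))) := by
      exact (continuous_const.mul (continuous_const.mul continuous_id)).tendsto 0
    simpa using this.mono_left nhdsWithin_le_nhds
  exact ge_of_tendsto ht (by filter_upwards [self_mem_nhdsWithin] with η hη using hfinal η hη)

theorem HasWeakDivergence.neg {F : E → E} {θ : E → ℝ} (h : HasWeakDivergence Ω F θ) :
    HasWeakDivergence Ω (fun x => -F x) (fun x => -θ x) := by
  intro χ hχ
  simp only [mul_neg, map_neg, integral_neg, h χ hχ]

theorem HasWeakDivergence.integral_eq_zero (hΩ : IsOpen Ω) (hc : Convex ℝ Ω) (hne : Ω.Nonempty)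
    (hb : Bornology.IsBounded Ω) {F : E → E} {θ : E → ℝ} (h : HasWeakDivergence Ω F θ)
    (hF : ContinuousOn F (closure Ω)) (hθ : IntegrableOn θ Ω)
    (hsign : ∀ x ∈ frontier Ω, ∀ ν, IsNormalVector Ω x ν → inner ℝ ν (F x) = 0) :
    ∫ x in Ω, θ x = 0 := by
  refine le_antisymm (h.integral_nonpos hΩ hc hne hb hF hθ fun x hx ν hν => (hsign x hx ν hν).le) ?_
  have := h.neg.integral_nonpos hΩ hc hne hb hF.neg hθ.neg fun x hx ν hν => by
    rw [inner_neg_right, hsign x hx ν hν, neg_zero]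
  rw [integral_neg] at this
  linarith

end DivergenceTheorem

end

noncomputable section

open Filter Topology Metric

set_option linter.unusedSectionVars false

/-! ### The curvature sign on the boundary of a convex domain -/

section Boundary

variable {d : ℕ} {Ω : Set (EuclideanSpace ℝ (Fin d))}

theorem IsNormalVector.of_mem_closure {x ν y : EuclideanSpace ℝ (Fin d)}
    (h : IsNormalVector Ω x ν) (hy : y ∈ closure Ω) : inner ℝ ν (y - x) ≤ 0 := by
  have : closure Ω ⊆ {y | inner ℝ ν (y - x) ≤ 0} :=
    closure_minimal h (isClosed_le (by fun_prop) continuous_const)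
  exact this hy

/-- A `C¹` defining function of the domain near a boundary point. -/
theorem HasC3Boundary.exists_definingFunction (h : HasC3Boundary Ω) {x : EuclideanSpace ℝ (Fin d)}
    (hx : x ∈ frontier Ω) :
    ∃ (e : EuclideanSpace ℝ (Fin d)) (G : EuclideanSpace ℝ (Fin d) → ℝ), ContDiff ℝ 1 G ∧
      (∀ y τ, G (y + τ • e) = G y + τ) ∧ ∃ U, IsOpen U ∧ x ∈ U ∧ ∀ y ∈ U, (y ∈ Ω ↔ G y < 0) := by
  obtain ⟨e, he, g, hg, U, hU, hxU, hUΩ⟩ := h x hx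
  refine ⟨e, fun y => inner ℝ y e - g (y - inner ℝ y e • e), ?_, ?_, U, hU, hxU, ?_⟩
  · have h1 : ContDiff ℝ 1 g := hg.of_le (by norm_num)
    have h2 : ContDiff ℝ 1 fun y : EuclideanSpace ℝ (Fin d) => (inner ℝ y e : ℝ) :=
      contDiff_id.inner ℝ contDiff_const
    exact h2.sub (h1.comp (contDiff_id.sub (h2.smul contDiff_const)))
  · intro y τ
    have h1 : inner ℝ (y + τ • e) e = inner ℝ y e + τ := by
      rw [inner_add_left, real_inner_smul_left, real_inner_self_eq_norm_sq, he]; ring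
    have h2 : y + τ • e - (inner ℝ y e + τ) • e = y - inner ℝ y e • e := by module
    simp only [h1, h2]; ring
  · intro y hy
    rw [hUΩ y hy]; exact sub_neg.symm

/-- Formally, differentiating `b · ν = 0` along the tangent vector `b` gives `ν · Db b = -II(b, b)`,
and the second fundamental form of a convex domain is nonnegative. The proof uses difference
quotients along a boundary curve with velocity `b x`, and supporting hyperplanes in place of second
derivatives of the boundary. -/
theorem inner_apply_self_nonpos (hΩ : IsOpen Ω) (hc : Convex ℝ Ω) (h3 : HasC3Boundary Ω)
    {b : EuclideanSpace ℝ (Fin d) → EuclideanSpace ℝ (Fin d)}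
    (htan : ∀ x ∈ frontier Ω, ∀ ν, IsNormalVector Ω x ν → inner ℝ ν (b x) = 0)
    {x : EuclideanSpace ℝ (Fin d)} (hx : x ∈ frontier Ω)
    {L : EuclideanSpace ℝ (Fin d) →L[ℝ] EuclideanSpace ℝ (Fin d)}
    (hL : HasFDerivWithinAt b L (closure Ω) x) {ν : EuclideanSpace ℝ (Fin d)}
    (hν : IsNormalVector Ω x ν) : inner ℝ ν (L (b x)) ≤ 0 := by
  obtain ⟨e, G, hG, hGe, U, hU, hxU, hUΩ⟩ := h3.exists_definingFunction hx
  have hGd : ∀ y, DifferentiableAt ℝ G y := fun y => hG.differentiable (by simp) y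
  have hDG : Continuous (fderiv ℝ G) := hG.continuous_fderiv (by simp)
  have hDGe : ∀ y, fderiv ℝ G y e = 1 := by
    intro y
    have h := ((hGd y).hasFDerivAt.hasLineDerivAt e).tendsto_slope_zero_right
    refine tendsto_nhds_unique h (tendsto_const_nhds.congr' ?_)
    filter_upwards [self_mem_nhdsWithin] with t ht
    have ht : (0 : ℝ) < t := ht
    rw [hGe, smul_eq_mul]; field_simp; ring
  have hxcl : x ∈ closure Ω := frontier_subset_closure hx
  -- zeros of the defining function are boundary points
  have hfront : ∀ p ∈ U, G p = 0 → p ∈ frontier Ω := by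
    intro p hp h0
    rw [hΩ.frontier_eq]
    refine ⟨?_, fun h => by have := (hUΩ p hp).1 h; linarith⟩
    have ht : Tendsto (fun τ : ℝ => p + (-τ) • e) (𝓝[>] 0) (𝓝 p) := by
      have : Tendsto (fun τ : ℝ => p + (-τ) • e) (𝓝 0) (𝓝 (p + (-(0:ℝ)) • e)) :=
        Continuous.tendsto (by fun_prop) 0
      simpa using this.mono_left nhdsWithin_le_nhds
    refine mem_closure_of_tendsto ht ?_
    filter_upwards [self_mem_nhdsWithin, ht.eventually (hU.mem_nhds hp)] with τ hτ hτU
    have hτ : (0 : ℝ) < τ := hτ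
    rw [hUΩ _ hτU, hGe, h0]; linarith
  have hGx : G x = 0 := by
    refine le_antisymm ?_ ?_
    · by_contra h
      have h := not_le.1 h
      have : U ∩ {y | 0 < G y} ∈ 𝓝 x :=
        (hU.inter (isOpen_lt continuous_const hG.continuous)).mem_nhds ⟨hxU, h⟩
      obtain ⟨y, ⟨hyU, hy⟩, hyΩ⟩ := mem_closure_iff_nhds.1 hxcl _ this
      have := (hUΩ y hyU).1 hyΩ
      exact absurd hy (by simp only [mem_ofPred_eq]; linarith)
    · by_contra h
      have := (hUΩ x hxU).2 (not_le.1 h)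
      rw [hΩ.frontier_eq] at hx
      exact hx.2 this
  -- the gradient of the defining function is an outward normal
  have hnormal : ∀ p ∈ U, G p = 0 → IsNormalVector Ω p (gradient G p) := by
    intro p hp h0 y hy
    rw [gradient, InnerProductSpace.toDual_symm_apply]
    have h := ((hGd p).hasFDerivAt.hasLineDerivAt (y - p)).tendsto_slope_zero_right
    refine le_of_tendsto h ?_
    have ht : Tendsto (fun t : ℝ => p + t • (y - p)) (𝓝[>] 0) (𝓝 p) := by
      have : Tendsto (fun t : ℝ => p + t • (y - p)) (𝓝 0) (𝓝 (p + (0:ℝ) • (y - p))) :=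
        Continuous.tendsto (by fun_prop) 0
      simpa using this.mono_left nhdsWithin_le_nhds
    filter_upwards [Ioo_mem_nhdsGT (zero_lt_one' ℝ), ht.eventually (hU.mem_nhds hp)] with t ht htU
    have hmem : p + t • (y - p) ∈ Ω := by
      have := hc.add_smul_sub_mem_interior' (frontier_subset_closure (hfront p hp h0))
        (by rwa [hΩ.interior_eq]) ⟨ht.1, ht.2.le⟩
      rwa [hΩ.interior_eq] at this
    rw [h0, sub_zero, smul_eq_mul]
    exact mul_nonpos_of_nonneg_of_nonpos (inv_nonneg.2 ht.1.le) ((hUΩ _ htU).1 hmem).le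
  have hDGb : fderiv ℝ G x (b x) = 0 := by
    have := htan x hx _ (hnormal x hxU hGx)
    rwa [gradient, InnerProductSpace.toDual_symm_apply] at this
  -- The point `x + D s` is `x + s • b x` moved along `e` onto the zero set of `G`. The correction
  -- is exact since `G` grows at unit speed along `e`, and it is `o(s)` since `b x` is tangent.
  set D : ℝ → EuclideanSpace ℝ (Fin d) := fun s => s • b x - G (x + s • b x) • e with hD
  have hslope : Tendsto (fun s : ℝ => s⁻¹ • D s) (𝓝[>] 0) (𝓝 (b x)) := by
    have h := ((hGd x).hasFDerivAt.hasLineDerivAt (b x)).tendsto_slope_zero_right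
    rw [hDGb, hGx] at h
    have h2 : Tendsto (fun s : ℝ => b x - (s⁻¹ • (G (x + s • b x) - 0)) • e) (𝓝[>] 0)
        (𝓝 (b x - (0 : ℝ) • e)) := tendsto_const_nhds.sub (h.smul_const e)
    rw [zero_smul, sub_zero] at h2
    refine h2.congr' ?_
    filter_upwards [self_mem_nhdsWithin] with s hs
    have hs : (0 : ℝ) < s := hs
    rw [hD]; simp only [smul_sub, smul_smul, sub_zero, smul_eq_mul]
    rw [inv_mul_cancel₀ hs.ne', one_smul]
  have hxs : Tendsto (fun s : ℝ => x + D s) (𝓝[>] 0) (𝓝 x) := by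
    have : Continuous fun s : ℝ => x + D s := by
      have := hG.continuous
      fun_prop
    have h := this.tendsto 0
    simp only [hD, zero_smul, add_zero, hGx, sub_zero] at h
    exact h.mono_left nhdsWithin_le_nhds
  have hxb : Tendsto (fun s : ℝ => x + s • b x) (𝓝[>] 0) (𝓝 x) := by
    have : Tendsto (fun t : ℝ => x + t • b x) (𝓝 0) (𝓝 (x + (0:ℝ) • b x)) :=
      Continuous.tendsto (by fun_prop) 0
    simpa using this.mono_left nhdsWithin_le_nhds
  have hGxs : ∀ s, G (x + D s) = 0 := by
    intro s
    have : x + D s = (x + s • b x) + (-G (x + s • b x)) • e := by rw [hD]; module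
    rw [this, hGe]; ring
  have hxsU := hxs.eventually (hU.mem_nhds hxU)
  have hxbU := hxb.eventually (hU.mem_nhds hxU)
  have hD0 : Tendsto D (𝓝[>] 0) (𝓝 0) := by simpa using hxs.sub_const x
  have hlim := hL.lim (l := 𝓝[>] (0 : ℝ)) hD0 (c := fun s => s⁻¹) (d := D) (v := b x)
    (by filter_upwards [hxsU] with s hs using frontier_subset_closure (hfront _ hs (hGxs s)))
    hslope
  have hlim2 : Tendsto (fun s : ℝ => fderiv ℝ G (x + D s) (s⁻¹ • (b (x + D s) - b x)))
      (𝓝[>] 0) (𝓝 (fderiv ℝ G x (L (b x)))) :=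
    ((isBoundedBilinearMap_apply (𝕜 := ℝ) (E := EuclideanSpace ℝ (Fin d))
      (F := ℝ)).continuous.tendsto (fderiv ℝ G x, L (b x))).comp
      (((hDG.tendsto x).comp hxs).prodMk_nhds hlim)
  have hle : fderiv ℝ G x (L (b x)) ≤ 0 := by
    refine le_of_tendsto hlim2 ?_
    filter_upwards [hxsU, hxbU, self_mem_nhdsWithin] with s hsU hsbU hs
    have hs : (0 : ℝ) < s := hs
    have hN := hnormal _ hsU (hGxs s)
    have h1 := htan _ (hfront _ hsU (hGxs s)) _ hN
    have h2 := hN.of_mem_closure hxcl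
    rw [gradient, InnerProductSpace.toDual_symm_apply] at h1 h2
    -- The tangent point `x + s • b x` lies in the supporting hyperplane at `x`. Were it in `Ω`,
    -- moving a little further along `e` would cross that hyperplane inside `Ω`.
    have h3 : 0 ≤ G (x + s • b x) := by
      by_contra hneg
      have hmem := (hUΩ _ hsbU).2 (not_le.1 hneg)
      have ht : Tendsto (fun τ : ℝ => x + s • b x + τ • e) (𝓝[>] 0) (𝓝 (x + s • b x)) := by
        have : Tendsto (fun τ : ℝ => x + s • b x + τ • e) (𝓝 0)
            (𝓝 (x + s • b x + (0:ℝ) • e)) := Continuous.tendsto (by fun_prop) 0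
        simpa using this.mono_left nhdsWithin_le_nhds
      obtain ⟨τ, hτΩ, hτ⟩ := ((ht.eventually (hΩ.mem_nhds hmem)).and self_mem_nhdsWithin).exists
      have hτ : (0 : ℝ) < τ := hτ
      have := hnormal x hxU hGx _ hτΩ
      rw [gradient, InnerProductSpace.toDual_symm_apply] at this
      have e1 : x + s • b x + τ • e - x = s • b x + τ • e := by abel
      rw [e1, map_add, map_smul, map_smul, hDGb, hDGe] at this
      simp at this
      linarith
    -- The supporting hyperplane at `x + D s`, evaluated at `x`, gives `s * DG (b x) ≥ G (x + s • b
    -- x)`.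
    have h4 : 0 ≤ fderiv ℝ G (x + D s) (b x) := by
      have e1 : x - (x + D s) = -(s • b x - G (x + s • b x) • e) := by simp only [hD]; module
      rw [e1, map_neg, map_sub, map_smul, map_smul, hDGe, smul_eq_mul, smul_eq_mul, mul_one] at h2
      have : 0 ≤ s * fderiv ℝ G (x + D s) (b x) := by linarith
      exact nonneg_of_mul_nonneg_right this hs
    rw [map_smul, map_sub, h1, zero_sub, smul_eq_mul]
    exact mul_nonpos_of_nonneg_of_nonpos (by positivity) (by linarith)
  -- every direction pointing strictly inwards enters the domain
  have hdir : ∀ v, fderiv ℝ G x v < 0 → inner ℝ ν v ≤ 0 := by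
    intro v hv
    have h := ((hGd x).hasFDerivAt.hasLineDerivAt v).tendsto_slope_zero_right
    have ht : Tendsto (fun t : ℝ => x + t • v) (𝓝[>] 0) (𝓝 x) := by
      have : Tendsto (fun t : ℝ => x + t • v) (𝓝 0) (𝓝 (x + (0:ℝ) • v)) :=
        Continuous.tendsto (by fun_prop) 0
      simpa using this.mono_left nhdsWithin_le_nhds
    obtain ⟨t, ⟨ht1, htU⟩, ht0⟩ := (((h.eventually (gt_mem_nhds hv)).and
      (ht.eventually (hU.mem_nhds hxU))).and self_mem_nhdsWithin).exists
    have ht0 : (0 : ℝ) < t := ht0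
    rw [hGx, sub_zero, smul_eq_mul] at ht1
    have hneg : G (x + t • v) < 0 := by
      by_contra hcon
      have := mul_nonneg (inv_nonneg.2 ht0.le) (not_lt.1 hcon)
      linarith
    have := hν _ ((hUΩ _ htU).2 hneg)
    rw [add_sub_cancel_left, real_inner_smul_right] at this
    exact nonpos_of_mul_nonpos_right this ht0
  -- The vector `L (b x)` points inwards only in the weak sense; subtracting `η • e` makes it
  -- strictly inward.
  have hpert : ∀ η : ℝ, 0 < η → inner ℝ ν (L (b x) - η • e) ≤ 0 := fun η hη =>
    hdir _ (by rw [map_sub, map_smul, hDGe, smul_eq_mul]; linarith)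
  have ht : Tendsto (fun η : ℝ => inner ℝ ν (L (b x) - η • e)) (𝓝[>] 0)
      (𝓝 (inner ℝ ν (L (b x)))) := by
    have : Tendsto (fun η : ℝ => (inner ℝ ν (L (b x) - η • e) : ℝ)) (𝓝 0)
        (𝓝 (inner ℝ ν (L (b x) - (0:ℝ) • e))) := Continuous.tendsto (by fun_prop) 0
    simpa using this.mono_left nhdsWithin_le_nhds
  exact le_of_tendsto ht (by filter_upwards [self_mem_nhdsWithin] with η hη using hpert η hη)

end Boundary

end

noncomputable section

open Filter Topology Metric

set_option linter.unusedSectionVars false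

/-! ### Calculus on the space-time cylinder up to its lateral boundary -/

section SpaceTime

variable {E : Type*} [NormedAddCommGroup E] [InnerProductSpace ℝ E] [FiniteDimensional ℝ E]
  {G : Type*} [NormedAddCommGroup G] [NormedSpace ℝ G]

/-- The space-time cylinder `(0, T) × closure Ω`. -/
def tube (Ω : Set E) (T : ℝ) : Set (ℝ × E) := Ioo 0 T ×ˢ closure Ω

/-- The time derivative on the cylinder, up to the lateral boundary. -/
def timeDeriv (Ω : Set E) (T : ℝ) (F : ℝ × E → G) (z : ℝ × E) : G :=
  fderivWithin ℝ F (tube Ω T) z (1, 0)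

/-- The space derivative on the cylinder, up to the lateral boundary. -/
def spaceDeriv (Ω : Set E) (T : ℝ) (F : ℝ × E → G) (z : ℝ × E) : E →L[ℝ] G :=
  (fderivWithin ℝ F (tube Ω T) z).comp (ContinuousLinearMap.inr ℝ ℝ E)

variable {Ω : Set E} {T : ℝ} {F : ℝ × E → G}

theorem uniqueDiffOn_tube (hΩ : IsOpen Ω) (hc : Convex ℝ Ω) (hne : Ω.Nonempty) :
    UniqueDiffOn ℝ (tube Ω T) := by
  refine (isOpen_Ioo.uniqueDiffOn).prod (uniqueDiffOn_convex hc.closure ?_)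
  exact hne.mono (hΩ.subset_interior_iff.2 subset_closure)

theorem ContDiffOn.continuousOn_timeDeriv (hΩ : IsOpen Ω) (hc : Convex ℝ Ω) (hne : Ω.Nonempty)
    (hF : ContDiffOn ℝ 1 F (tube Ω T)) : ContinuousOn (timeDeriv Ω T F) (tube Ω T) :=
  (hF.continuousOn_fderivWithin (uniqueDiffOn_tube hΩ hc hne) le_rfl).clm_apply
    continuousOn_const

theorem ContDiffOn.continuousOn_spaceDeriv (hΩ : IsOpen Ω) (hc : Convex ℝ Ω) (hne : Ω.Nonempty)
    (hF : ContDiffOn ℝ 1 F (tube Ω T)) : ContinuousOn (spaceDeriv Ω T F) (tube Ω T) :=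
  (hF.continuousOn_fderivWithin (uniqueDiffOn_tube hΩ hc hne) le_rfl).clm_comp
    continuousOn_const

theorem ContDiffOn.hasDerivAt_timeDeriv (hF : ContDiffOn ℝ 1 F (tube Ω T)) {t : ℝ} {x : E}
    (ht : t ∈ Ioo 0 T) (hx : x ∈ closure Ω) :
    HasDerivAt (fun s => F (s, x)) (timeDeriv Ω T F (t, x)) t := by
  have h := (hF.differentiableOn (by simp) (t, x) ⟨ht, hx⟩).hasFDerivWithinAt
  have h1 : HasFDerivWithinAt (fun s : ℝ => (s, x)) (ContinuousLinearMap.inl ℝ ℝ E) (Ioo 0 T) t :=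
    (hasFDerivAt_prodMk_left t x).hasFDerivWithinAt
  have hmaps : MapsTo (fun s : ℝ => (s, x)) (Ioo 0 T) (tube Ω T) := fun s hs => ⟨hs, hx⟩
  have h3 := (HasFDerivWithinAt.comp t h h1 hmaps).hasFDerivAt (isOpen_Ioo.mem_nhds ht)
  have h4 := h3.hasDerivAt
  simp only [ContinuousLinearMap.comp_apply, ContinuousLinearMap.inl_apply] at h4
  exact h4

theorem ContDiffOn.hasFDerivWithinAt_spaceDeriv (hF : ContDiffOn ℝ 1 F (tube Ω T)) {t : ℝ}
    {x : E} (ht : t ∈ Ioo 0 T) (hx : x ∈ closure Ω) :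
    HasFDerivWithinAt (fun y => F (t, y)) (spaceDeriv Ω T F (t, x)) (closure Ω) x := by
  have h := (hF.differentiableOn (by simp) (t, x) ⟨ht, hx⟩).hasFDerivWithinAt
  have h1 : HasFDerivWithinAt (fun y : E => (t, y)) (ContinuousLinearMap.inr ℝ ℝ E) (closure Ω) x :=
    (hasFDerivAt_prodMk_right t x).hasFDerivWithinAt
  have hmaps : MapsTo (fun y : E => (t, y)) (closure Ω) (tube Ω T) := fun y hy => ⟨ht, hy⟩
  exact HasFDerivWithinAt.comp x h h1 hmaps

theorem ContDiffOn.hasFDerivAt_spaceDeriv (hΩ : IsOpen Ω) (hF : ContDiffOn ℝ 1 F (tube Ω T))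
    {t : ℝ} {x : E} (ht : t ∈ Ioo 0 T) (hx : x ∈ Ω) :
    HasFDerivAt (fun y => F (t, y)) (spaceDeriv Ω T F (t, x)) x :=
  (hF.hasFDerivWithinAt_spaceDeriv ht (subset_closure hx)).hasFDerivAt
    (mem_of_superset (hΩ.mem_nhds hx) subset_closure)

theorem ContDiffOn.contDiffOn_slice (hF : ContDiffOn ℝ 1 F (tube Ω T)) {t : ℝ}
    (ht : t ∈ Ioo 0 T) : ContDiffOn ℝ 1 (fun y => F (t, y)) (closure Ω) :=
  hF.comp (contDiff_prodMk_right t).contDiffOn fun _ hy => ⟨ht, hy⟩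

theorem ContinuousOn.slice {F : ℝ × E → G} (hF : ContinuousOn F (tube Ω T)) {t : ℝ}
    (ht : t ∈ Ioo 0 T) : ContinuousOn (fun y => F (t, y)) (closure Ω) :=
  hF.comp (by fun_prop) fun _ hy => ⟨ht, hy⟩

variable [MeasurableSpace E] [BorelSpace E]

theorem ContinuousOn.integrableOn_of_closure (hb : Bornology.IsBounded Ω)
    {f : E → ℝ} (hf : ContinuousOn f (closure Ω)) : IntegrableOn f Ω :=
  (hf.integrableOn_compact hb.isCompact_closure).mono_set subset_closure

/-- Differentiation under the integral sign at a single time. -/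
theorem hasDerivAt_integral_of_bound (hΩ : IsOpen Ω) (hb : Bornology.IsBounded Ω)
    {F : ℝ → E → ℝ} {F' : E → ℝ} {t M : ℝ} (ht : t ∈ Ioo 0 T)
    (hF : ∀ s ∈ Ioo 0 T, ContinuousOn (F s) (closure Ω)) (hF' : ContinuousOn F' Ω)
    (hd : ∀ x ∈ Ω, HasDerivAt (fun s => F s x) (F' x) t)
    (hM : ∀ᶠ s in 𝓝 t, ∀ x ∈ Ω, |F s x - F t x| ≤ M * |s - t|) :
    HasDerivAt (fun s => ∫ x in Ω, F s x) (∫ x in Ω, F' x) t := by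
  obtain ⟨ε, hε, hball⟩ := Metric.eventually_nhds_iff_ball.1
    (hM.and (isOpen_Ioo.mem_nhds ht))
  have hfin : volume Ω ≠ ⊤ := hb.measure_lt_top.ne
  have key := hasFDerivAt_integral_of_dominated_loc_of_lip' (μ := volume.restrict Ω)
    (F := F) (F' := fun x => ContinuousLinearMap.toSpanSingleton ℝ (F' x)) (x₀ := t)
    (bound := fun _ => M) (Metric.ball_mem_nhds t hε)
    (fun s hs => ((hF s (hball s hs).2).integrableOn_of_closure hb).aestronglyMeasurable)
    ((hF t ht).integrableOn_of_closure hb)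
    ((ContinuousLinearMap.toSpanSingletonCLE (𝕜 := ℝ) (E := ℝ)).continuous.comp_aestronglyMeasurable
      (hF'.aestronglyMeasurable hΩ.measurableSet))
    ((ae_restrict_iff' hΩ.measurableSet).2 (Eventually.of_forall fun x hx s hs => by
      simpa using (hball s hs).1 x hx))
    (integrable_const_iff.2 (Or.inr ⟨by simpa using hfin.lt_top⟩))
    ((ae_restrict_iff' hΩ.measurableSet).2 (Eventually.of_forall fun x hx =>
      (hd x hx).hasFDerivAt))
  have h2 := key.2.hasDerivAt
  rw [ContinuousLinearMap.integral_apply key.1] at h2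
  simpa using h2

/-- A function with continuous time derivative on the cylinder is locally Lipschitz in time,
uniformly in space. -/
theorem exists_timeLipschitz (hb : Bornology.IsBounded Ω) {F F' : ℝ × E → ℝ} {t : ℝ}
    (ht : t ∈ Ioo 0 T) (hF' : ContinuousOn F' (tube Ω T))
    (hd : ∀ s ∈ Ioo 0 T, ∀ x ∈ Ω, HasDerivAt (fun s => F (s, x)) (F' (s, x)) s) :
    ∃ M, ∀ᶠ s in 𝓝 t, ∀ x ∈ Ω, |F (s, x) - F (t, x)| ≤ M * |s - t| := by
  obtain ⟨ε, hε, hball⟩ := Metric.nhds_basis_closedBall.mem_iff.1 (isOpen_Ioo.mem_nhds ht)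
  obtain ⟨M, hM⟩ := ((isCompact_closedBall t ε).prod
    hb.isCompact_closure).exists_bound_of_continuousOn
    (hF'.mono (prod_mono hball subset_rfl))
  refine ⟨M, ?_⟩
  filter_upwards [Metric.closedBall_mem_nhds t hε] with s hs x hx
  exact (convex_closedBall t ε).norm_image_sub_le_of_norm_hasDerivWithin_le
    (fun r hr => (hd r (hball hr) x hx).hasDerivWithinAt)
    (fun r hr => hM (r, x) ⟨hr, subset_closure hx⟩) (Metric.mem_closedBall_self hε.le) hs

theorem hasDerivAt_integral_tube (hΩ : IsOpen Ω) (hb : Bornology.IsBounded Ω)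
    {F F' : ℝ × E → ℝ} {t : ℝ} (ht : t ∈ Ioo 0 T) (hF : ContinuousOn F (tube Ω T))
    (hF' : ContinuousOn F' (tube Ω T))
    (hd : ∀ s ∈ Ioo 0 T, ∀ x ∈ Ω, HasDerivAt (fun s => F (s, x)) (F' (s, x)) s) :
    HasDerivAt (fun s => ∫ x in Ω, F (s, x)) (∫ x in Ω, F' (t, x)) t := by
  obtain ⟨M, hM⟩ := exists_timeLipschitz hb ht hF' hd
  exact hasDerivAt_integral_of_bound hΩ hb (F := fun s x => F (s, x)) ht
    (fun s hs => hF.slice hs) ((hF'.slice ht).mono subset_closure) (fun x hx => hd t ht x hx) hM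

/-- If only the factor vanishing at time `t` is differentiable, the product still is, at `t`. -/
theorem hasDerivAt_integral_sub_mul (hΩ : IsOpen Ω) (hb : Bornology.IsBounded Ω)
    {F F' c : ℝ × E → ℝ} {t : ℝ} (ht : t ∈ Ioo 0 T) (hF : ContinuousOn F (tube Ω T))
    (hF' : ContinuousOn F' (tube Ω T)) (hc : ContinuousOn c (tube Ω T))
    (hd : ∀ s ∈ Ioo 0 T, ∀ x ∈ Ω, HasDerivAt (fun s => F (s, x)) (F' (s, x)) s) :
    HasDerivAt (fun s => ∫ x in Ω, (F (s, x) - F (t, x)) * c (s, x))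
      (∫ x in Ω, F' (t, x) * c (t, x)) t := by
  obtain ⟨M, hM⟩ := exists_timeLipschitz hb ht hF' hd
  obtain ⟨ε, hε, hball⟩ := Metric.nhds_basis_closedBall.mem_iff.1 (isOpen_Ioo.mem_nhds ht)
  obtain ⟨A, hA⟩ := ((isCompact_closedBall t ε).prod
    hb.isCompact_closure).exists_bound_of_continuousOn (hc.mono (prod_mono hball subset_rfl))
  refine hasDerivAt_integral_of_bound hΩ hb (F := fun s x => (F (s, x) - F (t, x)) * c (s, x))
    (M := M * A) ht ?_ ?_ ?_ ?_
  · exact fun s hs => ((hF.slice hs).sub (hF.slice ht)).mul (hc.slice hs)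
  · exact ((hF'.slice ht).mul (hc.slice ht)).mono subset_closure
  · intro x hx
    have hct : ContinuousAt (fun s => c (s, x)) t := by
      have : ContinuousOn (fun s => c (s, x)) (Ioo 0 T) :=
        hc.comp (by fun_prop) fun s hs => ⟨hs, subset_closure hx⟩
      exact this.continuousAt (isOpen_Ioo.mem_nhds ht)
    have h1 := (hd t ht x hx).tendsto_slope
    rw [hasDerivAt_iff_tendsto_slope]
    have h2 := h1.mul (hct.tendsto.mono_left (nhdsWithin_le_nhds (s := {t}ᶜ)))
    refine h2.congr fun s => ?_
    simp only [slope, sub_self, zero_mul, vsub_eq_sub, smul_eq_mul, sub_zero]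
    ring
  · filter_upwards [hM, Metric.closedBall_mem_nhds t hε] with s hs hsb x hx
    simp only [sub_self, zero_mul, sub_zero]
    rw [abs_mul]
    have h1 := hA (s, x) ⟨hsb, subset_closure hx⟩
    have h2 := mul_le_mul (hs x hx) h1 (abs_nonneg _) ((abs_nonneg _).trans (hs x hx))
    rw [Real.norm_eq_abs] at h2
    linarith

end SpaceTime

end

noncomputable section

open Filter Topology Metric

set_option linter.unusedSectionVars false

/-! ### Displacement convexity along a transported density -/

section Energy

/-- A convex internal energy density satisfying McCann's displacement convexity condition in every
dimension, with its first two derivatives, which is affine on `(0, r₀]`. -/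
structure IsEnergy (r₀ : ℝ) (h h₁ h₂ : ℝ → ℝ) : Prop where
  hasDerivAt : ∀ s, 0 < s → HasDerivAt h (h₁ s) s
  hasDerivAt' : ∀ s, 0 < s → HasDerivAt h₁ (h₂ s) s
  continuousOn : ContinuousOn h₂ (Ioi 0)
  nonneg : ∀ s, 0 < s → 0 ≤ h₂ s
  eq_zero : ∀ s, 0 < s → s ≤ r₀ → h₂ s = 0
  pressure_nonneg : ∀ s, 0 < s → 0 ≤ s * h₁ s - h s
  pressure_le : ∀ s, 0 < s → s * h₁ s - h s ≤ s ^ 2 * h₂ s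

namespace IsEnergy

variable {r₀ : ℝ} {h h₁ h₂ : ℝ → ℝ}

theorem continuousOn_fst (H : IsEnergy r₀ h h₁ h₂) : ContinuousOn h₁ (Ioi 0) :=
  fun s hs => (H.hasDerivAt' s hs).continuousAt.continuousWithinAt

theorem continuousOn_self (H : IsEnergy r₀ h h₁ h₂) : ContinuousOn h (Ioi 0) :=
  fun s hs => (H.hasDerivAt s hs).continuousAt.continuousWithinAt

theorem contDiffOn (H : IsEnergy r₀ h h₁ h₂) : ContDiffOn ℝ 1 h (Ioi 0) := by
  rw [contDiffOn_one_iff_derivWithin (uniqueDiffOn_Ioi 0)]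
  refine ⟨fun s hs => (H.hasDerivAt s hs).differentiableAt.differentiableWithinAt, ?_⟩
  exact H.continuousOn_fst.congr fun s hs =>
    ((H.hasDerivAt s hs).hasDerivWithinAt.derivWithin (uniqueDiffOn_Ioi 0 s hs))

theorem contDiffOn_fst (H : IsEnergy r₀ h h₁ h₂) : ContDiffOn ℝ 1 h₁ (Ioi 0) := by
  rw [contDiffOn_one_iff_derivWithin (uniqueDiffOn_Ioi 0)]
  refine ⟨fun s hs => (H.hasDerivAt' s hs).differentiableAt.differentiableWithinAt, ?_⟩
  exact H.continuousOn.congr fun s hs =>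
    ((H.hasDerivAt' s hs).hasDerivWithinAt.derivWithin (uniqueDiffOn_Ioi 0 s hs))

/-- The terms in `h₁` cancel, so the pressure is `C¹` although `h` is only `C²`; it can multiply a
weak divergence. -/
theorem hasDerivAt_pressure (H : IsEnergy r₀ h h₁ h₂) {s : ℝ} (hs : 0 < s) :
    HasDerivAt (fun s => s * h₁ s - h s) (s * h₂ s) s := by
  exact (((hasDerivAt_id' s).fun_mul (H.hasDerivAt' s hs)).fun_sub
    (H.hasDerivAt s hs)).congr_deriv (by ring)

theorem contDiffOn_pressure (H : IsEnergy r₀ h h₁ h₂) :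
    ContDiffOn ℝ 1 (fun s => s * h₁ s - h s) (Ioi 0) :=
  (contDiffOn_id.mul H.contDiffOn_fst).sub H.contDiffOn

end IsEnergy

variable {d : ℕ}


/-- A positive `C¹` density transported by a `C¹` field `-b` tangent to the boundary of a smooth
convex domain. -/
structure IsTransport (Ω : Set (EuclideanSpace ℝ (Fin d))) (T : ℝ)
    (m : ℝ × EuclideanSpace ℝ (Fin d) → ℝ)
    (b : ℝ × EuclideanSpace ℝ (Fin d) → EuclideanSpace ℝ (Fin d)) : Prop where
  domain : IsSmoothConvexDomain Ω
  contDiffOn_m : ContDiffOn ℝ 1 m (tube Ω T)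
  contDiffOn_b : ContDiffOn ℝ 1 b (tube Ω T)
  pos : ∀ z ∈ tube Ω T, 0 < m z
  continuity : ∀ t ∈ Ioo 0 T, ∀ x ∈ Ω, timeDeriv Ω T m (t, x)
    = spaceDeriv Ω T m (t, x) (b (t, x)) + m (t, x) * ctrace (spaceDeriv Ω T b (t, x))
  tangent : ∀ t ∈ Ioo 0 T, ∀ x ∈ frontier Ω, ∀ ν, IsNormalVector Ω x ν → inner ℝ ν (b (t, x)) = 0

namespace IsTransport

variable {Ω : Set (EuclideanSpace ℝ (Fin d))} {T : ℝ} {m : ℝ × EuclideanSpace ℝ (Fin d) → ℝ}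
  {b : ℝ × EuclideanSpace ℝ (Fin d) → EuclideanSpace ℝ (Fin d)} {r₀ : ℝ} {h h₁ h₂ : ℝ → ℝ}

section
variable (S : IsTransport Ω T m b)
include S

theorem continuousOn_comp {g : ℝ → ℝ} (hg : ContinuousOn g (Ioi 0)) :
    ContinuousOn (fun z => g (m z)) (tube Ω T) :=
  hg.comp S.contDiffOn_m.continuousOn fun z hz => S.pos z hz

theorem continuousOn_dm : ContinuousOn (spaceDeriv Ω T m) (tube Ω T) :=
  S.contDiffOn_m.continuousOn_spaceDeriv S.domain.isOpen S.domain.convex S.domain.nonempty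

theorem continuousOn_db : ContinuousOn (spaceDeriv Ω T b) (tube Ω T) :=
  S.contDiffOn_b.continuousOn_spaceDeriv S.domain.isOpen S.domain.convex S.domain.nonempty

theorem continuousOn_mt : ContinuousOn (timeDeriv Ω T m) (tube Ω T) :=
  S.contDiffOn_m.continuousOn_timeDeriv S.domain.isOpen S.domain.convex S.domain.nonempty

theorem continuousOn_bt : ContinuousOn (timeDeriv Ω T b) (tube Ω T) :=
  S.contDiffOn_b.continuousOn_timeDeriv S.domain.isOpen S.domain.convex S.domain.nonempty

theorem continuousOn_div : ContinuousOn (fun z => ctrace (spaceDeriv Ω T b z)) (tube Ω T) :=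
  ctrace.continuous.comp_continuousOn S.continuousOn_db

theorem integrableOn {g : ℝ × EuclideanSpace ℝ (Fin d) → ℝ} (hg : ContinuousOn g (tube Ω T))
    {t : ℝ} (ht : t ∈ Ioo 0 T) : IntegrableOn (fun x => g (t, x)) Ω :=
  (hg.slice ht).integrableOn_of_closure S.domain.isBounded

theorem contDiffOn_slice_comp {g : ℝ → ℝ} (hg : ContDiffOn ℝ 1 g (Ioi 0)) {t : ℝ}
    (ht : t ∈ Ioo 0 T) : ContDiffOn ℝ 1 (fun x => g (m (t, x))) Ω :=
  hg.comp ((S.contDiffOn_m.contDiffOn_slice ht).mono subset_closure)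
    fun x hx => S.pos (t, x) ⟨ht, subset_closure hx⟩

theorem hasFDerivAt_comp {g g' : ℝ → ℝ} (hg : ∀ s, 0 < s → HasDerivAt g (g' s) s) {t : ℝ}
    (ht : t ∈ Ioo 0 T) {x : EuclideanSpace ℝ (Fin d)} (hx : x ∈ Ω) :
    HasFDerivAt (fun x => g (m (t, x))) (g' (m (t, x)) • spaceDeriv Ω T m (t, x)) x :=
  (hg _ (S.pos (t, x) ⟨ht, subset_closure hx⟩)).comp_hasFDerivAt x
    (S.contDiffOn_m.hasFDerivAt_spaceDeriv S.domain.isOpen ht hx)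

/-- Integration by parts against the tangential field `b` at another time. -/
theorem integral_mul_div {g g' : ℝ → ℝ} (hg1 : ContDiffOn ℝ 1 g (Ioi 0))
    (hg : ∀ s, 0 < s → HasDerivAt g (g' s) s) (hg' : ContinuousOn g' (Ioi 0)) {t r : ℝ}
    (ht : t ∈ Ioo 0 T) (hr : r ∈ Ioo 0 T) :
    ∫ x in Ω, g (m (t, x)) * ctrace (spaceDeriv Ω T b (r, x))
      = - ∫ x in Ω, g' (m (t, x)) * spaceDeriv Ω T m (t, x) (b (r, x)) := by
  have hbr : ContDiffOn ℝ 1 (fun x => b (r, x)) Ω :=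
    (S.contDiffOn_b.contDiffOn_slice hr).mono subset_closure
  have hw := (hasWeakDivergence_of_contDiffOn S.domain.isOpen hbr).smul S.domain.isOpen
    hbr.continuousOn (ctrace.continuous.comp_continuousOn
      (hbr.continuousOn_fderiv_of_isOpen S.domain.isOpen le_rfl)) (S.contDiffOn_slice_comp hg1 ht)
  have heq : EqOn (fun x => fderiv ℝ (fun x => g (m (t, x))) x (b (r, x))
      + g (m (t, x)) * ctrace (fderiv ℝ (fun x => b (r, x)) x))
      (fun x => g' (m (t, x)) * spaceDeriv Ω T m (t, x) (b (r, x))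
        + g (m (t, x)) * ctrace (spaceDeriv Ω T b (r, x))) Ω := by
    intro x hx
    simp only
    rw [(S.hasFDerivAt_comp hg ht hx).fderiv,
      (S.contDiffOn_b.hasFDerivAt_spaceDeriv S.domain.isOpen hr hx).fderiv]
    simp
  have i1 : IntegrableOn (fun x => g' (m (t, x)) * spaceDeriv Ω T m (t, x) (b (r, x))) Ω := by
    refine ContinuousOn.integrableOn_of_closure S.domain.isBounded ?_
    exact ((S.continuousOn_comp hg').slice ht).mul
      ((S.continuousOn_dm.slice ht).clm_apply (S.contDiffOn_b.continuousOn.slice hr))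
  have i2 : IntegrableOn (fun x => g (m (t, x)) * ctrace (spaceDeriv Ω T b (r, x))) Ω := by
    refine ContinuousOn.integrableOn_of_closure S.domain.isBounded ?_
    exact ((S.continuousOn_comp hg1.continuousOn).slice ht).mul (S.continuousOn_div.slice hr)
  have h0 := hw.integral_eq_zero S.domain.isOpen S.domain.convex S.domain.nonempty
    S.domain.isBounded
    (((S.continuousOn_comp hg1.continuousOn).slice ht).smul (S.contDiffOn_b.continuousOn.slice hr))
    ((i1.add i2).congr_fun heq.symm S.domain.isOpen.measurableSet)
    (fun x hx ν hν => by rw [real_inner_smul_right, S.tangent r hr x hx ν hν, mul_zero])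
  rw [setIntegral_congr_fun S.domain.isOpen.measurableSet heq, integral_add i1 i2] at h0
  linarith

/-- Insert `m_t = Dm · b + m div b`. The term `h₁(m) Dm · b = D(h(m)) · b` integrates by parts to
`-h(m) div b`, without boundary term because `b` is tangent. -/
theorem hasDerivAt_energy (H : IsEnergy r₀ h h₁ h₂) {t : ℝ} (ht : t ∈ Ioo 0 T) :
    HasDerivAt (fun t => ∫ x in Ω, h (m (t, x)))
      (∫ x in Ω, (m (t, x) * h₁ (m (t, x)) - h (m (t, x))) * ctrace (spaceDeriv Ω T b (t, x))) t := by
  have h1 := hasDerivAt_integral_tube S.domain.isOpen S.domain.isBounded ht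
    (F := fun z => h (m z)) (F' := fun z => h₁ (m z) * timeDeriv Ω T m z)
    (S.continuousOn_comp H.continuousOn_self)
    ((S.continuousOn_comp H.continuousOn_fst).mul S.continuousOn_mt)
    (fun s hs x hx => (H.hasDerivAt _ (S.pos (s, x) ⟨hs, subset_closure hx⟩)).comp s
      (S.contDiffOn_m.hasDerivAt_timeDeriv hs (subset_closure hx)))
  convert h1 using 1
  have h2 := S.integral_mul_div H.contDiffOn H.hasDerivAt H.continuousOn_fst ht ht
  have i1 : IntegrableOn (fun x => h (m (t, x)) * ctrace (spaceDeriv Ω T b (t, x))) Ω :=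
    S.integrableOn ((S.continuousOn_comp H.continuousOn_self).mul S.continuousOn_div) ht
  have i2 : IntegrableOn (fun x => h₁ (m (t, x)) * spaceDeriv Ω T m (t, x) (b (t, x))) Ω :=
    S.integrableOn ((S.continuousOn_comp H.continuousOn_fst).mul
      (S.continuousOn_dm.clm_apply S.contDiffOn_b.continuousOn)) ht
  have i3 : IntegrableOn (fun x => m (t, x) * h₁ (m (t, x)) * ctrace (spaceDeriv Ω T b (t, x))) Ω :=
    S.integrableOn ((S.contDiffOn_m.continuousOn.mul (S.continuousOn_comp H.continuousOn_fst)).mul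
      S.continuousOn_div) ht
  have e1 : ∫ x in Ω, h₁ (m (t, x)) * timeDeriv Ω T m (t, x)
      = (∫ x in Ω, h₁ (m (t, x)) * spaceDeriv Ω T m (t, x) (b (t, x)))
        + ∫ x in Ω, m (t, x) * h₁ (m (t, x)) * ctrace (spaceDeriv Ω T b (t, x)) := by
    rw [← integral_add i2 i3]
    refine setIntegral_congr_fun S.domain.isOpen.measurableSet fun x hx => ?_
    simp only [S.continuity t ht x hx]
    ring
  simp only [sub_mul]
  rw [e1, integral_sub i3 i1]
  linarith

/-- The factor `div b` is only continuous in time, so the integrand cannot be differentiated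
directly. Near a fixed `t`, split `P(m(s))` as `P(m(s)) - P(m(t))` plus `P(m(t))`. The first part
vanishes at `s = t`, so continuity of `div b` suffices. In the second, integration by parts replaces
`div b(s)` by `b(s)`, which is differentiable in time. -/
theorem hasDerivAt_energy_deriv (H : IsEnergy r₀ h h₁ h₂) {t : ℝ} (ht : t ∈ Ioo 0 T) :
    HasDerivAt (fun t => ∫ x in Ω,
        (m (t, x) * h₁ (m (t, x)) - h (m (t, x))) * ctrace (spaceDeriv Ω T b (t, x)))
      (∫ x in Ω, m (t, x) * h₂ (m (t, x)) * (timeDeriv Ω T m (t, x)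
        * ctrace (spaceDeriv Ω T b (t, x)) - spaceDeriv Ω T m (t, x) (timeDeriv Ω T b (t, x)))) t := by
  set P : ℝ → ℝ := fun s => s * h₁ s - h s with hP
  have hPd : ∀ s, 0 < s → HasDerivAt P (s * h₂ s) s := fun s hs => H.hasDerivAt_pressure hs
  have hP' : ContinuousOn (fun s => s * h₂ s) (Ioi 0) := continuousOn_id.mul H.continuousOn
  have hPc : ContinuousOn P (Ioi 0) := H.contDiffOn_pressure.continuousOn
  have h1 := hasDerivAt_integral_sub_mul S.domain.isOpen S.domain.isBounded ht
    (F := fun z => P (m z)) (F' := fun z => m z * h₂ (m z) * timeDeriv Ω T m z)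
    (c := fun z => ctrace (spaceDeriv Ω T b z))
    (S.continuousOn_comp hPc) ((S.continuousOn_comp hP').mul S.continuousOn_mt)
    S.continuousOn_div
    (fun s hs x hx => HasDerivAt.comp (h₂ := P) (h := fun s => m (s, x)) s
      (hPd (m (s, x)) (S.pos (s, x) ⟨hs, subset_closure hx⟩)) (S.contDiffOn_m.hasDerivAt_timeDeriv hs (subset_closure hx)))
  have hfix : ∀ z ∈ tube Ω T, (t, z.2) ∈ tube Ω T := fun z hz => ⟨ht, hz.2⟩
  have hfixc : ContinuousOn (fun z : ℝ × EuclideanSpace ℝ (Fin d) => (t, z.2)) (tube Ω T) := by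
    fun_prop
  have hw : ContinuousOn (fun z : ℝ × EuclideanSpace ℝ (Fin d) =>
      (m (t, z.2) * h₂ (m (t, z.2))) • spaceDeriv Ω T m (t, z.2)) (tube Ω T) :=
    ((S.continuousOn_comp hP').comp hfixc hfix).smul (S.continuousOn_dm.comp hfixc hfix)
  have h2 := hasDerivAt_integral_tube S.domain.isOpen S.domain.isBounded ht
    (F := fun z => ((m (t, z.2) * h₂ (m (t, z.2))) • spaceDeriv Ω T m (t, z.2)) (b z))
    (F' := fun z => ((m (t, z.2) * h₂ (m (t, z.2))) • spaceDeriv Ω T m (t, z.2))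
      (timeDeriv Ω T b z))
    (hw.clm_apply S.contDiffOn_b.continuousOn) (hw.clm_apply S.continuousOn_bt)
    (fun s hs x hx => (ContinuousLinearMap.hasFDerivAt
      ((m (t, x) * h₂ (m (t, x))) • spaceDeriv Ω T m (t, x))).comp_hasDerivAt s
      (S.contDiffOn_b.hasDerivAt_timeDeriv hs (subset_closure hx)))
  have h3 := h1.sub h2
  have i1 : IntegrableOn (fun x => m (t, x) * h₂ (m (t, x)) * timeDeriv Ω T m (t, x)
      * ctrace (spaceDeriv Ω T b (t, x))) Ω :=
    S.integrableOn (((S.continuousOn_comp hP').mul S.continuousOn_mt).mul S.continuousOn_div) ht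
  have i2 : IntegrableOn (fun x => ((m (t, x) * h₂ (m (t, x))) • spaceDeriv Ω T m (t, x))
      (timeDeriv Ω T b (t, x))) Ω :=
    S.integrableOn (((S.continuousOn_comp hP').smul S.continuousOn_dm).clm_apply
      S.continuousOn_bt) ht
  rw [← integral_sub i1 i2] at h3
  refine (h3.congr_of_eventuallyEq ?_).congr_deriv ?_
  · filter_upwards [isOpen_Ioo.mem_nhds ht] with s hs
    have e := S.integral_mul_div H.contDiffOn_pressure hPd hP' ht hs
    have i3 : IntegrableOn (fun x => P (m (s, x)) * ctrace (spaceDeriv Ω T b (s, x))) Ω :=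
      S.integrableOn ((S.continuousOn_comp hPc).mul S.continuousOn_div) hs
    have i4 : IntegrableOn (fun x => P (m (t, x)) * ctrace (spaceDeriv Ω T b (s, x))) Ω :=
      ContinuousOn.integrableOn_of_closure S.domain.isBounded
        (((S.continuousOn_comp hPc).slice ht).mul (S.continuousOn_div.slice hs))
    simp only [Pi.sub_apply, smul_apply, smul_eq_mul]
    change ∫ x in Ω, P (m (s, x)) * ctrace (spaceDeriv Ω T b (s, x)) = _
    change ∫ x in Ω, P (m (t, x)) * ctrace (spaceDeriv Ω T b (s, x)) = _ at e
    simp only [sub_mul]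
    rw [integral_sub i3 i4]
    linarith
  · refine setIntegral_congr_fun S.domain.isOpen.measurableSet fun x hx => ?_
    simp only [smul_apply, smul_eq_mul]
    ring

/-- McCann's displacement convexity in an integrated form that needs only one derivative of the
field. -/
theorem integral_nonneg_displacement (H : IsEnergy r₀ h h₁ h₂) {t : ℝ} (ht : t ∈ Ioo 0 T) :
    0 ≤ ∫ x in Ω, (m (t, x) * h₂ (m (t, x)) * spaceDeriv Ω T m (t, x)
        (ctrace (spaceDeriv Ω T b (t, x)) • b (t, x) - spaceDeriv Ω T b (t, x) (b (t, x)))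
      + (m (t, x) * h₁ (m (t, x)) - h (m (t, x))) * (ctrace (spaceDeriv Ω T b (t, x)) ^ 2
        - ctrace ((spaceDeriv Ω T b (t, x)).comp (spaceDeriv Ω T b (t, x))))) := by
  set P : ℝ → ℝ := fun s => s * h₁ s - h s with hP
  have hPd : ∀ s, 0 < s → HasDerivAt P (s * h₂ s) s := fun s hs => H.hasDerivAt_pressure hs
  have hP' : ContinuousOn (fun s => s * h₂ s) (Ioi 0) := continuousOn_id.mul H.continuousOn
  have hPc : ContinuousOn P (Ioi 0) := H.contDiffOn_pressure.continuousOn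
  have hbt : ContDiffOn ℝ 1 (fun x => b (t, x)) Ω :=
    (S.contDiffOn_b.contDiffOn_slice ht).mono subset_closure
  have hDb := hbt.continuousOn_fderiv_of_isOpen S.domain.isOpen le_rfl
  have hY : ContinuousOn (fun z => ctrace (spaceDeriv Ω T b z) • b z - spaceDeriv Ω T b z (b z))
      (tube Ω T) := (S.continuousOn_div.smul S.contDiffOn_b.continuousOn).sub
        (S.continuousOn_db.clm_apply S.contDiffOn_b.continuousOn)
  have hθ : ContinuousOn (fun z => ctrace (spaceDeriv Ω T b z) ^ 2
      - ctrace ((spaceDeriv Ω T b z).comp (spaceDeriv Ω T b z))) (tube Ω T) :=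
    (S.continuousOn_div.pow 2).sub (ctrace.continuous.comp_continuousOn
      (S.continuousOn_db.clm_comp S.continuousOn_db))
  have hw := ((hasWeakDivergence_piola S.domain.isOpen hbt).smul S.domain.isOpen
    (((ctrace.continuous.comp_continuousOn hDb).smul hbt.continuousOn).sub
      (hDb.clm_apply hbt.continuousOn))
    (((ctrace.continuous.comp_continuousOn hDb).pow 2).sub
      (ctrace.continuous.comp_continuousOn (hDb.clm_comp hDb)))
    (S.contDiffOn_slice_comp H.contDiffOn_pressure ht)).neg
  have hfb : ∀ x ∈ Ω, fderiv ℝ (fun x => b (t, x)) x = spaceDeriv Ω T b (t, x) := fun x hx =>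
    (S.contDiffOn_b.hasFDerivAt_spaceDeriv S.domain.isOpen ht hx).fderiv
  have hint : IntegrableOn (fun x => (m (t, x) * h₂ (m (t, x)) * spaceDeriv Ω T m (t, x)
        (ctrace (spaceDeriv Ω T b (t, x)) • b (t, x) - spaceDeriv Ω T b (t, x) (b (t, x)))
      + P (m (t, x)) * (ctrace (spaceDeriv Ω T b (t, x)) ^ 2
        - ctrace ((spaceDeriv Ω T b (t, x)).comp (spaceDeriv Ω T b (t, x)))))) Ω :=
    S.integrableOn (((S.continuousOn_comp hP').mul (S.continuousOn_dm.clm_apply hY)).add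
      ((S.continuousOn_comp hPc).mul hθ)) ht
  have hw' : HasWeakDivergence Ω (fun x => -(P (m (t, x)) •
        (ctrace (spaceDeriv Ω T b (t, x)) • b (t, x) - spaceDeriv Ω T b (t, x) (b (t, x)))))
      (fun x => -(m (t, x) * h₂ (m (t, x)) * spaceDeriv Ω T m (t, x)
        (ctrace (spaceDeriv Ω T b (t, x)) • b (t, x) - spaceDeriv Ω T b (t, x) (b (t, x)))
      + P (m (t, x)) * (ctrace (spaceDeriv Ω T b (t, x)) ^ 2
        - ctrace ((spaceDeriv Ω T b (t, x)).comp (spaceDeriv Ω T b (t, x)))))) := by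
    intro χ hχ
    have := hw χ hχ
    convert this using 1
    · refine setIntegral_congr_fun S.domain.isOpen.measurableSet fun x hx => ?_
      simp only
      rw [hfb x hx, (S.hasFDerivAt_comp hPd ht hx).fderiv]
      simp only [smul_apply, smul_eq_mul, hP]
    · congr 1
      refine setIntegral_congr_fun S.domain.isOpen.measurableSet fun x hx => ?_
      simp only
      rw [hfb x hx]
  -- The flux of this field is `-P (div b · b - Db b) · ν`. Tangency removes the first term, and the
  -- curvature sign together with `P ≥ 0` makes the other nonpositive.
  have key := hw'.integral_nonpos S.domain.isOpen S.domain.convex S.domain.nonempty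
    S.domain.isBounded (((S.continuousOn_comp hPc).slice ht).smul (hY.slice ht)).neg hint.neg
    (fun x hx ν hν => by
      have hxc := frontier_subset_closure hx
      have h1 := S.tangent t ht x hx ν hν
      have h2 := inner_apply_self_nonpos S.domain.isOpen S.domain.convex S.domain.boundary
        (S.tangent t ht) hx (S.contDiffOn_b.hasFDerivWithinAt_spaceDeriv ht hxc) hν
      have h3 : 0 ≤ P (m (t, x)) := H.pressure_nonneg _ (S.pos (t, x) ⟨ht, hxc⟩)
      rw [inner_neg_right, real_inner_smul_right, inner_sub_right, real_inner_smul_right, h1,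
        mul_zero, zero_sub]
      nlinarith)
  rw [integral_neg] at key
  linarith

/-- The second derivative of the energy is bounded below by the work of the acceleration
`b_t - Db b`. -/
theorem le_energy_deriv2 (H : IsEnergy r₀ h h₁ h₂) {t : ℝ} (ht : t ∈ Ioo 0 T)
    (htr : ∀ x ∈ Ω, 0 ≤ ctrace ((spaceDeriv Ω T b (t, x)).comp (spaceDeriv Ω T b (t, x)))) :
    ∫ x in Ω, -(m (t, x) * h₂ (m (t, x)) * spaceDeriv Ω T m (t, x)
        (timeDeriv Ω T b (t, x) - spaceDeriv Ω T b (t, x) (b (t, x))))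
      ≤ ∫ x in Ω, m (t, x) * h₂ (m (t, x)) * (timeDeriv Ω T m (t, x)
        * ctrace (spaceDeriv Ω T b (t, x)) - spaceDeriv Ω T m (t, x) (timeDeriv Ω T b (t, x))) := by
  have hP' : ContinuousOn (fun s => s * h₂ s) (Ioi 0) := continuousOn_id.mul H.continuousOn
  have hPc : ContinuousOn (fun s => s * h₁ s - h s) (Ioi 0) := H.contDiffOn_pressure.continuousOn
  have hY : ContinuousOn (fun z => ctrace (spaceDeriv Ω T b z) • b z - spaceDeriv Ω T b z (b z))
      (tube Ω T) := (S.continuousOn_div.smul S.contDiffOn_b.continuousOn).sub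
        (S.continuousOn_db.clm_apply S.contDiffOn_b.continuousOn)
  have hθ : ContinuousOn (fun z => ctrace (spaceDeriv Ω T b z) ^ 2
      - ctrace ((spaceDeriv Ω T b z).comp (spaceDeriv Ω T b z))) (tube Ω T) :=
    (S.continuousOn_div.pow 2).sub (ctrace.continuous.comp_continuousOn
      (S.continuousOn_db.clm_comp S.continuousOn_db))
  have i1 : IntegrableOn (fun x => -(m (t, x) * h₂ (m (t, x)) * spaceDeriv Ω T m (t, x)
        (timeDeriv Ω T b (t, x) - spaceDeriv Ω T b (t, x) (b (t, x))))) Ω :=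
    S.integrableOn ((S.continuousOn_comp hP').mul (S.continuousOn_dm.clm_apply
      (S.continuousOn_bt.sub (S.continuousOn_db.clm_apply S.contDiffOn_b.continuousOn)))).neg ht
  have i2 : IntegrableOn (fun x => (m (t, x) * h₂ (m (t, x)) * spaceDeriv Ω T m (t, x)
        (ctrace (spaceDeriv Ω T b (t, x)) • b (t, x) - spaceDeriv Ω T b (t, x) (b (t, x)))
      + (m (t, x) * h₁ (m (t, x)) - h (m (t, x))) * (ctrace (spaceDeriv Ω T b (t, x)) ^ 2
        - ctrace ((spaceDeriv Ω T b (t, x)).comp (spaceDeriv Ω T b (t, x)))))) Ω :=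
    S.integrableOn (((S.continuousOn_comp hP').mul (S.continuousOn_dm.clm_apply hY)).add
      ((S.continuousOn_comp hPc).mul hθ)) ht
  have i3 : IntegrableOn (fun x => m (t, x) * h₂ (m (t, x)) * (timeDeriv Ω T m (t, x)
        * ctrace (spaceDeriv Ω T b (t, x)) - spaceDeriv Ω T m (t, x) (timeDeriv Ω T b (t, x)))) Ω :=
    S.integrableOn ((S.continuousOn_comp hP').mul ((S.continuousOn_mt.mul S.continuousOn_div).sub
      (S.continuousOn_dm.clm_apply S.continuousOn_bt))) ht
  have key := S.integral_nonneg_displacement H ht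
  -- With `P` the pressure, the right integrand exceeds the left one by `(m² h₂(m) - P(m)) (div b)²
  -- + P(m) tr (Db)²`, where every factor is nonnegative.
  have hle := setIntegral_mono_on (i1.add i2) i3 S.domain.isOpen.measurableSet (fun x hx => by
    have h1 := htr x hx
    have hpos := S.pos (t, x) ⟨ht, subset_closure hx⟩
    have h2 := H.pressure_nonneg _ hpos
    have h3 := H.pressure_le _ hpos
    simp only [Pi.add_apply, S.continuity t ht x hx, map_sub, map_smul, smul_eq_mul]
    have h4 := mul_nonneg h2 h1
    have h5 := mul_le_mul_of_nonneg_right h3 (sq_nonneg (ctrace (spaceDeriv Ω T b (t, x))))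
    nlinarith)
  simp only [Pi.add_apply] at hle
  rw [integral_add i1 i2] at hle
  linarith

end

end IsTransport

end Energy

end

noncomputable section

open Filter Topology Metric

set_option linter.unusedSectionVars false

/-! ### The trace inequality for the derivative of the drift -/

section LinearAlgebra

variable {E : Type*} [NormedAddCommGroup E] [InnerProductSpace ℝ E] [FiniteDimensional ℝ E]

/-- `tr (A M A M) ≥ 0` for symmetric `M` and symmetric positive semidefinite `A`. -/
theorem ctrace_comp_nonneg {A M : E →L[ℝ] E} (hA : ∀ v w, inner ℝ (A v) w = inner ℝ v (A w))
    (hM : ∀ v w, inner ℝ (M v) w = inner ℝ v (M w)) (hpos : ∀ v, 0 ≤ inner ℝ (A v) v) :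
    0 ≤ ctrace ((A.comp M).comp (A.comp M)) := by
  have hAs : (A : E →ₗ[ℝ] E).IsSymmetric := hA
  let e := hAs.eigenvectorBasis rfl
  have he : ∀ i, A (e i) = hAs.eigenvalues rfl i • e i := fun i =>
    hAs.apply_eigenvectorBasis rfl i
  have hl : ∀ i, 0 ≤ hAs.eigenvalues rfl i := by
    intro i
    have := hpos (e i)
    rwa [he, real_inner_smul_left, real_inner_self_eq_norm_sq, e.norm_eq_one, one_pow,
      mul_one] at this
  -- In an eigenbasis of `A` with eigenvalues `λ_i`, the trace is the sum of `λ_i ⟨A M e_i, M e_i⟩`.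
  rw [ctrace_eq_sum e]
  refine Finset.sum_nonneg fun i _ => ?_
  simp only [ContinuousLinearMap.comp_apply]
  rw [← hA, he, real_inner_smul_left, ← hM, real_inner_comm]
  exact mul_nonneg (hl i) (hpos _)

end LinearAlgebra

/-! ### From the planning system to the energy inequality -/

section Solution

variable {d : ℕ}


theorem divergence_eq_ctrace (F : EuclideanSpace ℝ (Fin d) → EuclideanSpace ℝ (Fin d)) (x : EuclideanSpace ℝ (Fin d)) : divergence F x = ctrace (fderiv ℝ F x) := by
  rw [ctrace_eq_sum (EuclideanSpace.basisFun (Fin d) ℝ)]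
  refine Finset.sum_congr rfl fun i _ => ?_
  rw [EuclideanSpace.basisFun_apply, EuclideanSpace.inner_single_left]
  simp

namespace IsUniformlyConvexHamiltonian

variable {α β : ℝ} {H : EuclideanSpace ℝ (Fin d) → ℝ}

theorem contDiff_gradient (hH : IsUniformlyConvexHamiltonian α β H) :
    ContDiff ℝ 1 (gradient H) :=
  (InnerProductSpace.toDual ℝ (EuclideanSpace ℝ (Fin d))).symm.contDiff.comp (hH.contDiff.fderiv_right (by norm_num))

theorem inner_fderiv_gradient (hH : IsUniformlyConvexHamiltonian α β H) (p v w : EuclideanSpace ℝ (Fin d)) :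
    inner ℝ (fderiv ℝ (gradient H) p v) w = fderiv ℝ (fderiv ℝ H) p v w := by
  have h1 : HasFDerivAt (fderiv ℝ H) (fderiv ℝ (fderiv ℝ H) p) p :=
    ((hH.contDiff.fderiv_right (m := 1) (by norm_num)).differentiable (by simp) p).hasFDerivAt
  have h2 := ((InnerProductSpace.toDual ℝ (EuclideanSpace ℝ (Fin d))).symm.toContinuousLinearEquiv.hasFDerivAt
    (x := fderiv ℝ H p)).comp p h1
  have h3 : fderiv ℝ (gradient H) p = _ := h2.fderiv
  rw [h3]
  exact InnerProductSpace.toDual_symm_apply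

theorem inner_fderiv_gradient_comm (hH : IsUniformlyConvexHamiltonian α β H) (p v w : EuclideanSpace ℝ (Fin d)) :
    inner ℝ (fderiv ℝ (gradient H) p v) w = inner ℝ v (fderiv ℝ (gradient H) p w) := by
  rw [real_inner_comm _ v, hH.inner_fderiv_gradient, hH.inner_fderiv_gradient]
  exact (hH.contDiff.contDiffAt.isSymmSndFDerivAt (by simp)) v w

end IsUniformlyConvexHamiltonian

namespace IsClassicalPlanningSolution

variable {Ω : Set (EuclideanSpace ℝ (Fin d))} {T ε : ℝ} {H V m₀ m₁ : EuclideanSpace ℝ (Fin d) → ℝ} {f : ℝ → ℝ} {u m : ℝ → EuclideanSpace ℝ (Fin d) → ℝ}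
  {α β c₀ r₀ : ℝ} {Λ : ℝ≥0}

/-- The gradient of `u` on the tube. -/
def momentum (Ω : Set (EuclideanSpace ℝ (Fin d))) (u : ℝ → EuclideanSpace ℝ (Fin d) → ℝ) (z : ℝ × EuclideanSpace ℝ (Fin d)) : EuclideanSpace ℝ (Fin d) := spaceGradient Ω u z.1 z.2

/-- The field `H_p(Du)` on the tube. -/
def drift (Ω : Set (EuclideanSpace ℝ (Fin d))) (H : EuclideanSpace ℝ (Fin d) → ℝ) (u : ℝ → EuclideanSpace ℝ (Fin d) → ℝ) (z : ℝ × EuclideanSpace ℝ (Fin d)) : EuclideanSpace ℝ (Fin d) :=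
  gradient H (momentum Ω u z)

variable (S : IsClassicalPlanningSolution Ω T ε H f V m₀ m₁ u m) (hΩ : IsSmoothConvexDomain Ω)
  (hH : IsUniformlyConvexHamiltonian α β H)
include S hΩ

/-- Identifies the gradient on each time slice with the spatial part of the space-time derivative of
`u`, which is `C¹` in time and space together. -/
theorem momentum_eq {z : ℝ × EuclideanSpace ℝ (Fin d)} (hz : z ∈ tube Ω T) : momentum Ω u z
    = (InnerProductSpace.toDual ℝ (EuclideanSpace ℝ (Fin d))).symm (spaceDeriv Ω T (fun z => u z.1 z.2) z) := by
  have h := (S.contDiffOn_u.of_le one_le_two : ContDiffOn ℝ 1 (fun z : ℝ × EuclideanSpace ℝ (Fin d) => u z.1 z.2)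
    (tube Ω T)).hasFDerivWithinAt_spaceDeriv hz.1 hz.2
  have hu : UniqueDiffWithinAt ℝ (closure Ω) z.2 :=
    uniqueDiffOn_convex hΩ.convex.closure
      (hΩ.nonempty.mono (hΩ.isOpen.subset_interior_iff.2 subset_closure)) z.2 hz.2
  rw [momentum, spaceGradient, gradientWithin]
  congr 1
  exact h.fderivWithin hu

theorem contDiffOn_momentum : ContDiffOn ℝ 1 (momentum Ω u) (tube Ω T) := by
  have h1 : ContDiffOn ℝ 1 (fderivWithin ℝ (fun z : ℝ × EuclideanSpace ℝ (Fin d) => u z.1 z.2) (tube Ω T)) (tube Ω T) :=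
    S.contDiffOn_u.fderivWithin (uniqueDiffOn_tube hΩ.isOpen hΩ.convex hΩ.nonempty) (by norm_num)
  have h2 : ContDiffOn ℝ 1 (spaceDeriv Ω T (fun z : ℝ × EuclideanSpace ℝ (Fin d) => u z.1 z.2)) (tube Ω T) :=
    h1.clm_comp contDiffOn_const
  exact ((InnerProductSpace.toDual ℝ (EuclideanSpace ℝ (Fin d))).symm.contDiff.comp_contDiffOn h2).congr
    fun z hz => S.momentum_eq hΩ hz

include hH in
theorem contDiffOn_drift : ContDiffOn ℝ 1 (drift Ω H u) (tube Ω T) :=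
  hH.contDiff_gradient.comp_contDiffOn (S.contDiffOn_momentum hΩ)

include hH in
theorem isTransport : IsTransport Ω T (fun z => m z.1 z.2) (drift Ω H u) where
  domain := hΩ
  contDiffOn_m := S.contDiffOn_m
  contDiffOn_b := S.contDiffOn_drift hΩ hH
  pos := fun z hz => S.pos_m z.1 hz.1 z.2 hz.2
  continuity := by
    intro t ht x hx
    have h1 := S.continuity t ht x hx
    have hm : ContDiffOn ℝ 1 (fun z : ℝ × EuclideanSpace ℝ (Fin d) => m z.1 z.2) (tube Ω T) := S.contDiffOn_m
    have h2 := (hm.hasDerivAt_timeDeriv ht (subset_closure hx)).deriv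
    have h3 := hm.hasFDerivAt_spaceDeriv hΩ.isOpen ht hx
    have h4 := (S.contDiffOn_drift hΩ hH).hasFDerivAt_spaceDeriv hΩ.isOpen ht hx
    have h5 : HasFDerivAt (fun y => m t y • gradient H (spaceGradient Ω u t y)) _ x := h3.smul h4
    rw [divergence_eq_ctrace, h5.fderiv] at h1
    simp only at h2
    rw [h2, map_add, map_smul, ctrace_smulRight, smul_eq_mul] at h1
    have h6 : gradient H (spaceGradient Ω u t x) = drift Ω H u (t, x) := rfl
    rw [h6] at h1
    linarith
  tangent := by
    intro t ht x hx ν hν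
    rcases eq_or_ne ν 0 with rfl | h0
    · exact inner_zero_left _
    have hn : 0 < ‖ν‖ := norm_pos_iff.2 h0
    have h1 := S.neumann t ht x hx (‖ν‖⁻¹ • ν) ⟨by rw [norm_smul, norm_inv, norm_norm,
      inv_mul_cancel₀ hn.ne'], fun y hy => by
        rw [real_inner_smul_left]
        exact mul_nonpos_of_nonneg_of_nonpos (by positivity) (hν y hy)⟩
    rw [real_inner_smul_right, mul_eq_zero, real_inner_comm] at h1
    exact h1.resolve_left (by positivity)

include hH in
theorem timeDeriv_drift {t : ℝ} {x : EuclideanSpace ℝ (Fin d)} (ht : t ∈ Ioo 0 T) (hx : x ∈ Ω) :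
    timeDeriv Ω T (drift Ω H u) (t, x)
      = fderiv ℝ (gradient H) (momentum Ω u (t, x)) (timeDeriv Ω T (momentum Ω u) (t, x)) := by
  have h1 := (S.contDiffOn_drift hΩ hH).hasDerivAt_timeDeriv ht (subset_closure hx)
  have h2 := (S.contDiffOn_momentum hΩ).hasDerivAt_timeDeriv ht (subset_closure hx)
  have h3 := (hH.contDiff_gradient.differentiable (by simp)
    (momentum Ω u (t, x))).hasFDerivAt.comp_hasDerivAt t h2
  exact h1.unique h3

include hH in
theorem spaceDeriv_drift {t : ℝ} {x : EuclideanSpace ℝ (Fin d)} (ht : t ∈ Ioo 0 T) (hx : x ∈ Ω) :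
    spaceDeriv Ω T (drift Ω H u) (t, x)
      = (fderiv ℝ (gradient H) (momentum Ω u (t, x))).comp
          (spaceDeriv Ω T (momentum Ω u) (t, x)) := by
  have h1 := (S.contDiffOn_drift hΩ hH).hasFDerivAt_spaceDeriv hΩ.isOpen ht hx
  have h2 := (S.contDiffOn_momentum hΩ).hasFDerivAt_spaceDeriv hΩ.isOpen ht hx
  have h3 := (hH.contDiff_gradient.differentiable (by simp)
    (momentum Ω u (t, x))).hasFDerivAt.comp x h2
  exact h1.unique h3

/-- Derivatives of the momentum in terms of the second derivative of `u`. -/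
theorem exists_second_deriv {t : ℝ} {x : EuclideanSpace ℝ (Fin d)} (ht : t ∈ Ioo 0 T) (hx : x ∈ Ω) :
    (∀ v w, inner ℝ (spaceDeriv Ω T (momentum Ω u) (t, x) v) w
      = inner ℝ v (spaceDeriv Ω T (momentum Ω u) (t, x) w)) ∧
    HasFDerivAt (fun y => deriv (fun s => u s y) t)
      (innerSL ℝ (timeDeriv Ω T (momentum Ω u) (t, x))) x := by
  set U : ℝ × EuclideanSpace ℝ (Fin d) → ℝ := fun z => u z.1 z.2 with hU
  have hO : IsOpen (Ioo 0 T ×ˢ Ω) := isOpen_Ioo.prod hΩ.isOpen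
  have hOt : Ioo 0 T ×ˢ Ω ⊆ tube Ω T := prod_mono subset_rfl subset_closure
  have hmem : ((t, x) : ℝ × EuclideanSpace ℝ (Fin d)) ∈ Ioo 0 T ×ˢ Ω := ⟨ht, hx⟩
  have hnh : ∀ z ∈ Ioo 0 T ×ˢ Ω, tube Ω T ∈ 𝓝 z := fun z hz =>
    mem_of_superset (hO.mem_nhds hz) hOt
  have hUc : ContDiffAt ℝ 2 U (t, x) := S.contDiffOn_u.contDiffAt (hnh _ hmem)
  have hsymm : IsSymmSndFDerivAt ℝ U (t, x) := hUc.isSymmSndFDerivAt (by simp)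
  have hD : HasFDerivAt (fderiv ℝ U) (fderiv ℝ (fderiv ℝ U) (t, x)) (t, x) :=
    ((hUc.fderiv_right (m := 1) (by norm_num)).differentiableAt (by simp)).hasFDerivAt
  set B := fderiv ℝ (fderiv ℝ U) (t, x) with hB
  have hinner : ∀ z ∈ Ioo 0 T ×ˢ Ω, ∀ v, inner ℝ (momentum Ω u z) v = fderiv ℝ U z (0, v) := by
    intro z hz v
    rw [S.momentum_eq hΩ (hOt hz), InnerProductSpace.toDual_symm_apply, spaceDeriv,
      fderivWithin_of_mem_nhds (hnh z hz)]
    rfl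
  have hx1 : HasFDerivAt (fun y : EuclideanSpace ℝ (Fin d) => fderiv ℝ U (t, y)) (B.comp (ContinuousLinearMap.inr ℝ ℝ (EuclideanSpace ℝ (Fin d))))
      x := HasFDerivAt.comp x hD (hasFDerivAt_prodMk_right t x)
  have ht1 : HasDerivAt (fun s : ℝ => fderiv ℝ U (s, x)) (B (1, 0)) t := by
    have := (HasFDerivAt.comp t hD (hasFDerivAt_prodMk_left t x)).hasDerivAt
    simp only [ContinuousLinearMap.comp_apply, ContinuousLinearMap.inl_apply] at this
    exact this
  have hsp : ∀ v w, inner ℝ (spaceDeriv Ω T (momentum Ω u) (t, x) v) w = B (0, v) (0, w) := by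
    intro v w
    have h1 := (S.contDiffOn_momentum hΩ).hasFDerivAt_spaceDeriv hΩ.isOpen ht hx
    have h2 : HasFDerivAt (fun y => inner ℝ w (momentum Ω u (t, y)))
        ((innerSL ℝ w).comp (spaceDeriv Ω T (momentum Ω u) (t, x))) x :=
      (innerSL ℝ w).hasFDerivAt.comp x h1
    have h3 : HasFDerivAt (fun y => fderiv ℝ U (t, y) (0, w))
        ((ContinuousLinearMap.apply ℝ ℝ ((0 : ℝ), w)).comp
          (B.comp (ContinuousLinearMap.inr ℝ ℝ (EuclideanSpace ℝ (Fin d))))) x :=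
      (ContinuousLinearMap.apply ℝ ℝ ((0 : ℝ), w)).hasFDerivAt.comp x hx1
    have h4 : (fun y => fderiv ℝ U (t, y) (0, w)) =ᶠ[𝓝 x] fun y => inner ℝ w (momentum Ω u (t, y)) := by
      filter_upwards [hΩ.isOpen.mem_nhds hx] with y hy
      rw [real_inner_comm, hinner (t, y) ⟨ht, hy⟩]
    have h5 := (h2.congr_of_eventuallyEq h4).unique h3
    have h6 := congrArg (fun L => L v) h5
    simp only [ContinuousLinearMap.comp_apply, innerSL_apply_apply] at h6
    rw [real_inner_comm, h6]
    rfl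
  have htm : ∀ w, inner ℝ (timeDeriv Ω T (momentum Ω u) (t, x)) w = B (1, 0) (0, w) := by
    intro w
    have h1 := (S.contDiffOn_momentum hΩ).hasDerivAt_timeDeriv ht (subset_closure hx)
    have h2 : HasDerivAt (fun s => inner ℝ w (momentum Ω u (s, x)))
        (inner ℝ w (timeDeriv Ω T (momentum Ω u) (t, x))) t :=
      (innerSL ℝ w).hasFDerivAt.comp_hasDerivAt t h1
    have h3 : HasDerivAt (fun s => fderiv ℝ U (s, x) (0, w)) (B (1, 0) (0, w)) t :=
      (ContinuousLinearMap.apply ℝ ℝ ((0 : ℝ), w)).hasFDerivAt.comp_hasDerivAt t ht1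
    have h4 : (fun s => fderiv ℝ U (s, x) (0, w)) =ᶠ[𝓝 t] fun s => inner ℝ w (momentum Ω u (s, x)) := by
      filter_upwards [isOpen_Ioo.mem_nhds ht] with s hs
      rw [real_inner_comm, hinner (s, x) ⟨hs, hx⟩]
    rw [real_inner_comm]
    exact (h2.congr_of_eventuallyEq h4).unique h3
  refine ⟨fun v w => ?_, ?_⟩
  · rw [real_inner_comm _ v, hsp, hsp]
    exact hsymm (0, v) (0, w)
  · have h3 : HasFDerivAt (fun y => fderiv ℝ U (t, y) (1, 0))
        ((ContinuousLinearMap.apply ℝ ℝ ((1 : ℝ), (0 : EuclideanSpace ℝ (Fin d)))).comp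
          (B.comp (ContinuousLinearMap.inr ℝ ℝ (EuclideanSpace ℝ (Fin d))))) x :=
      (ContinuousLinearMap.apply ℝ ℝ ((1 : ℝ), (0 : EuclideanSpace ℝ (Fin d)))).hasFDerivAt.comp x hx1
    have h4 : (fun y => deriv (fun s => u s y) t) =ᶠ[𝓝 x] fun y => fderiv ℝ U (t, y) (1, 0) := by
      filter_upwards [hΩ.isOpen.mem_nhds hx] with y hy
      have h5 : DifferentiableAt ℝ U (t, y) :=
        (S.contDiffOn_u.contDiffAt (hnh (t, y) ⟨ht, hy⟩)).differentiableAt (by simp)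
      have h6 := (HasFDerivAt.comp t h5.hasFDerivAt (hasFDerivAt_prodMk_left t y)).hasDerivAt
      have h7 : HasDerivAt (fun s => u s y) _ t := h6
      rw [h7.deriv]
      simp
    refine (h3.congr_of_eventuallyEq h4).congr_fderiv ?_
    ext v
    rw [innerSL_apply_apply, htm]
    exact (hsymm (1, 0) (0, v)).symm

include hH in
/-- The second derivative of an energy along a solution of the planning system. -/
theorem le_energy_deriv2 (hα : 0 < α) (hβ : 0 < β) (hc₀ : 0 < c₀) (hε : 0 ≤ ε)
    (hV : LipschitzOnWith Λ V Ω) (hf : IsCoerciveCoupling c₀ r₀ f) {h h₁ h₂ : ℝ → ℝ}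
    (he : IsEnergy r₀ h h₁ h₂) :
    ∃ φ₁ φ₂ : ℝ → ℝ, ∀ t ∈ Ioo 0 T,
      HasDerivAt (fun t => ∫ x in Ω, h (m t x)) (φ₁ t) t ∧ HasDerivAt φ₁ (φ₂ t) t ∧
      c₀ * α / 2 * (∫ x in Ω, h₂ (m t x) * ‖fderiv ℝ (m t) x‖ ^ 2)
        - β * Λ ^ 2 / (2 * c₀) * (∫ x in Ω, m t x ^ 2 * h₂ (m t x)) ≤ φ₂ t := by
  have hS := S.isTransport hΩ hH
  refine ⟨_, _, fun t ht => ⟨hS.hasDerivAt_energy he ht, hS.hasDerivAt_energy_deriv he ht, ?_⟩⟩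
  have hA : ∀ p v, 0 ≤ inner ℝ (fderiv ℝ (gradient H) p v) v := fun p v => by
    rw [hH.inner_fderiv_gradient]
    exact (by positivity : (0 : ℝ) ≤ α * ‖v‖ ^ 2).trans (hH.lower p v)
  refine le_trans ?_ (hS.le_energy_deriv2 he ht fun x hx => by
    rw [S.spaceDeriv_drift hΩ hH ht hx]
    exact ctrace_comp_nonneg (fun v w => hH.inner_fderiv_gradient_comm _ v w)
      (S.exists_second_deriv hΩ ht hx).1 (hA _))
  have hm : ContDiffOn ℝ 1 (fun z : ℝ × EuclideanSpace ℝ (Fin d) => m z.1 z.2) (tube Ω T) := S.contDiffOn_m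
  have hfd : ∀ x ∈ Ω, fderiv ℝ (m t) x = spaceDeriv Ω T (fun z : ℝ × EuclideanSpace ℝ (Fin d) => m z.1 z.2) (t, x) :=
    fun x hx => (hm.hasFDerivAt_spaceDeriv hΩ.isOpen ht hx).fderiv
  have i1 : IntegrableOn (fun x => h₂ (m t x) * ‖fderiv ℝ (m t) x‖ ^ 2) Ω := by
    refine (hS.integrableOn ((hS.continuousOn_comp he.continuousOn).mul
      (hS.continuousOn_dm.norm.pow 2)) ht).congr_fun (fun x hx => ?_) hΩ.isOpen.measurableSet
    simp only [hfd x hx]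
    rfl
  have i2 : IntegrableOn (fun x => m t x ^ 2 * h₂ (m t x)) Ω :=
    hS.integrableOn ((hS.contDiffOn_m.continuousOn.pow 2).mul
      (hS.continuousOn_comp he.continuousOn)) ht
  rw [← integral_const_mul, ← integral_const_mul, ← integral_sub (i1.const_mul _) (i2.const_mul _)]
  refine setIntegral_mono_on ((i1.const_mul _).sub (i2.const_mul _)) ?_ hΩ.isOpen.measurableSet
    fun x hx => ?_
  · exact hS.integrableOn ((hS.contDiffOn_m.continuousOn.mul
      (hS.continuousOn_comp he.continuousOn)).mul (hS.continuousOn_dm.clm_apply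
      (hS.continuousOn_bt.sub (hS.continuousOn_db.clm_apply hS.contDiffOn_b.continuousOn)))).neg ht
  have hpos : 0 < m t x := S.pos_m t ht x (subset_closure hx)
  simp only
  -- Nothing is known about `f'` below `r₀`, but there `h₂` vanishes and both sides are zero.
  rcases le_or_gt (m t x) r₀ with hle | hgt
  · rw [he.eq_zero _ hpos hle]; simp
  have hh2 := he.nonneg _ hpos
  rw [hfd x hx]
  set Dm := spaceDeriv Ω T (fun z : ℝ × EuclideanSpace ℝ (Fin d) => m z.1 z.2) (t, x) with hDm
  set p := momentum Ω u (t, x) with hp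
  set Dp := spaceDeriv Ω T (momentum Ω u) (t, x) with hDp
  set A := fderiv ℝ (gradient H) p with hAdef
  set g : EuclideanSpace ℝ (Fin d) := (InnerProductSpace.toDual ℝ (EuclideanSpace ℝ (Fin d))).symm Dm with hg
  have hgv : ∀ v, Dm v = inner ℝ g v := fun v => (InnerProductSpace.toDual_symm_apply).symm
  have hgn : ‖Dm‖ = ‖g‖ := by rw [hg, LinearIsometryEquiv.norm_map]
  -- the potential is differentiable by the Hamilton-Jacobi equation
  obtain ⟨hDpsym, hut⟩ := S.exists_second_deriv hΩ ht hx
  have hmx : HasFDerivAt (fun y => m t y) Dm x := hm.hasFDerivAt_spaceDeriv hΩ.isOpen ht hx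
  have hpx : HasFDerivAt (fun y => momentum Ω u (t, y)) Dp x :=
    (S.contDiffOn_momentum hΩ).hasFDerivAt_spaceDeriv hΩ.isOpen ht hx
  have hfm : HasFDerivAt (fun y => f (m t y)) (deriv f (m t x) • Dm) x :=
    ((hf.contDiffOn.contDiffAt (isOpen_Ioi.mem_nhds hpos)).differentiableAt
      (by simp)).hasDerivAt.comp_hasFDerivAt x hmx
  have hlog : HasFDerivAt (fun y => Real.log (m t y)) ((m t x)⁻¹ • Dm) x :=
    hmx.log hpos.ne'
  have hHp : HasFDerivAt (fun y => H (momentum Ω u (t, y))) ((fderiv ℝ H p).comp Dp) x :=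
    (hH.contDiff.differentiable (by simp) p).hasFDerivAt.comp x hpx
  have hVd : HasFDerivAt V (-(innerSL ℝ (timeDeriv Ω T (momentum Ω u) (t, x)))
      + (fderiv ℝ H p).comp Dp - deriv f (m t x) • Dm - ε • ((m t x)⁻¹ • Dm)) x := by
    refine ((((hut.neg.add hHp).sub hfm).sub (hlog.const_mul ε))).congr_of_eventuallyEq ?_
    filter_upwards [hΩ.isOpen.mem_nhds hx] with y hy
    have := S.hamilton_jacobi t ht y hy
    simp only [Pi.add_apply, Pi.sub_apply, Pi.neg_apply, momentum]
    linarith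
  have hVn : ‖fderiv ℝ V x‖ ≤ Λ := norm_fderiv_le_of_lipschitzOn ℝ (hΩ.isOpen.mem_nhds hx) hV
  set w : EuclideanSpace ℝ (Fin d) := (InnerProductSpace.toDual ℝ (EuclideanSpace ℝ (Fin d))).symm (fderiv ℝ V x) with hw
  have hwn : ‖w‖ ≤ Λ := by rw [hw, LinearIsometryEquiv.norm_map]; exact hVn
  -- The space derivative of the Hamilton-Jacobi equation; the symmetry of `D²u` moves `Dp` from the
  -- test vector onto the drift.
  have hacc : timeDeriv Ω T (momentum Ω u) (t, x) - Dp (drift Ω H u (t, x))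
      = -((deriv f (m t x) + ε * (m t x)⁻¹) • g + w) := by
    refine ext_inner_right ℝ fun v => ?_
    have h1 : inner ℝ w v = fderiv ℝ V x v := InnerProductSpace.toDual_symm_apply
    rw [hVd.fderiv] at h1
    have h2 : fderiv ℝ H p (Dp v) = inner ℝ (drift Ω H u (t, x)) (Dp v) := by
      rw [drift, gradient, InnerProductSpace.toDual_symm_apply]
    simp only [sub_apply, add_apply, neg_apply, smul_apply, smul_eq_mul,
      ContinuousLinearMap.comp_apply, innerSL_apply_apply, hgv] at h1
    rw [inner_sub_left, hDpsym, inner_neg_left, inner_add_left, real_inner_smul_left, h1, h2]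
    ring
  have hacc2 : timeDeriv Ω T (drift Ω H u) (t, x)
      - spaceDeriv Ω T (drift Ω H u) (t, x) (drift Ω H u (t, x))
      = -((deriv f (m t x) + ε * (m t x)⁻¹) • A g + A w) := by
    rw [S.timeDeriv_drift hΩ hH ht hx, S.spaceDeriv_drift hΩ hH ht hx,
      ContinuousLinearMap.comp_apply, ← map_sub, hacc, map_neg, map_add, map_smul]
  rw [hacc2, hgv, inner_neg_right, inner_add_right, real_inner_smul_right, hgn]
  have a1 : inner ℝ g (A g) = inner ℝ (A g) g := real_inner_comm _ _
  have a2 : α * ‖g‖ ^ 2 ≤ inner ℝ (A g) g := by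
    rw [hAdef, hH.inner_fderiv_gradient]; exact hH.lower p g
  have a3 : inner ℝ (A w) w ≤ β * Λ ^ 2 := by
    rw [hAdef, hH.inner_fderiv_gradient]
    refine (hH.upper p w).trans ?_
    gcongr
  -- Young's inequality for the form `A`: the cross term with `w = DV` costs half of the coercive
  -- term `c₀ ⟨A g, g⟩` and a multiple of `m² ⟨A w, w⟩`.
  have a4 : 0 ≤ inner ℝ (A (c₀ • g + m t x • w)) (c₀ • g + m t x • w) := hA p _
  have a5 : inner ℝ (A w) g = inner ℝ g (A w) := real_inner_comm _ _
  have a6 : inner ℝ (A g) w = inner ℝ g (A w) := hH.inner_fderiv_gradient_comm _ _ _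
  rw [map_add, map_smul, map_smul, inner_add_left, inner_add_right, inner_add_right] at a4
  simp only [real_inner_smul_left, real_inner_smul_right, a5, a6] at a4
  have hcoer : c₀ ≤ m t x * deriv f (m t x) := by
    have := hf.coercive _ hgt.le
    rwa [div_le_iff₀ hpos, mul_comm] at this
  have hmm : m t x * (m t x)⁻¹ = 1 := mul_inv_cancel₀ hpos.ne'
  have hX := hA p g
  rw [← hAdef] at hX
  rw [a1]
  have b1 : c₀ * inner ℝ (A g) g ≤ m t x * ((deriv f (m t x) + ε * (m t x)⁻¹) * inner ℝ (A g) g) := by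
    have : m t x * ((deriv f (m t x) + ε * (m t x)⁻¹) * inner ℝ (A g) g)
        = (m t x * deriv f (m t x)) * inner ℝ (A g) g
          + ε * (m t x * (m t x)⁻¹) * inner ℝ (A g) g := by ring
    rw [this, hmm]
    nlinarith [mul_le_mul_of_nonneg_right hcoer hX, mul_nonneg hε hX]
  have b2 : c₀ * α / 2 * ‖g‖ ^ 2 - β * Λ ^ 2 / (2 * c₀) * m t x ^ 2
      ≤ m t x * ((deriv f (m t x) + ε * (m t x)⁻¹) * inner ℝ (A g) g) + m t x * inner ℝ g (A w) := by
    have c1 : -(m t x ^ 2 / (2 * c₀) * inner ℝ (A w) w) - c₀ / 2 * inner ℝ (A g) g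
        ≤ m t x * inner ℝ g (A w) := by
      have : 0 ≤ (2 * c₀)⁻¹ * (c₀ * (c₀ * inner ℝ (A g) g) + c₀ * (m t x * inner ℝ g (A w))
          + (m t x * (c₀ * inner ℝ g (A w)) + m t x * (m t x * inner ℝ (A w) w))) := by
        refine mul_nonneg (by positivity) ?_
        linarith
      have e : (2 * c₀)⁻¹ * (c₀ * (c₀ * inner ℝ (A g) g) + c₀ * (m t x * inner ℝ g (A w))
          + (m t x * (c₀ * inner ℝ g (A w)) + m t x * (m t x * inner ℝ (A w) w)))
          = c₀ / 2 * inner ℝ (A g) g + m t x * inner ℝ g (A w)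
            + m t x ^ 2 / (2 * c₀) * inner ℝ (A w) w := by
        field_simp; ring
      rw [e] at this
      linarith
    have c2 : m t x ^ 2 / (2 * c₀) * inner ℝ (A w) w ≤ m t x ^ 2 / (2 * c₀) * (β * Λ ^ 2) :=
      mul_le_mul_of_nonneg_left a3 (by positivity)
    have c3 : c₀ / 2 * (α * ‖g‖ ^ 2) ≤ c₀ / 2 * inner ℝ (A g) g :=
      mul_le_mul_of_nonneg_left a2 (by positivity)
    have c4 : β * Λ ^ 2 / (2 * c₀) * m t x ^ 2 = m t x ^ 2 / (2 * c₀) * (β * Λ ^ 2) := by ring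
    linarith
  have := mul_le_mul_of_nonneg_left b2 hh2
  linarith

end IsClassicalPlanningSolution

end Solution

end

noncomputable section

open Filter Topology Metric

set_option linter.unusedSectionVars false

/-! ### Nash's inequality on convex sets with explicit constants -/

section Nash

variable {E : Type*} [NormedAddCommGroup E] [InnerProductSpace ℝ E] [FiniteDimensional ℝ E]
  [MeasurableSpace E] [BorelSpace E] {Ω : Set E}

theorem sq_intervalIntegral_le {g : ℝ → ℝ} {s : ℝ} (hs : 0 < s) (hg : ContinuousOn g (Icc 0 s)) :
    (∫ τ in 0..s, g τ) ^ 2 ≤ s * ∫ τ in 0..s, g τ ^ 2 := by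
  have hu : uIcc 0 s = Icc 0 s := uIcc_of_le hs.le
  have i1 : IntervalIntegrable g volume 0 s := ContinuousOn.intervalIntegrable (by rwa [hu])
  have i2 : IntervalIntegrable (fun τ => g τ ^ 2) volume 0 s :=
    ContinuousOn.intervalIntegrable (by rw [hu]; exact hg.pow 2)
  set I := ∫ τ in 0..s, g τ with hI
  have h0 : 0 ≤ ∫ τ in 0..s, (s * g τ - I) ^ 2 :=
    intervalIntegral.integral_nonneg hs.le fun τ _ => sq_nonneg _
  have e : ∫ τ in 0..s, (s * g τ - I) ^ 2
      = s ^ 2 * (∫ τ in 0..s, g τ ^ 2) - 2 * s * I * I + s * I ^ 2 := by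
    have : ∀ τ, (s * g τ - I) ^ 2 = s ^ 2 * g τ ^ 2 - 2 * s * I * g τ + I ^ 2 := fun τ => by ring
    simp only [this]
    rw [intervalIntegral.integral_add ((i2.const_mul _).sub (i1.const_mul _))
      intervalIntegrable_const, intervalIntegral.integral_sub (i2.const_mul _) (i1.const_mul _),
      intervalIntegral.integral_const_mul, intervalIntegral.integral_const_mul,
      intervalIntegral.integral_const, ← hI]
    simp
  rw [e] at h0
  have : 0 ≤ s * (s * (∫ τ in 0..s, g τ ^ 2) - I ^ 2) := by nlinarith
  linarith [nonneg_of_mul_nonneg_right this hs]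

theorem Convex.add_smul_sub_mem_of_open (hc : Convex ℝ Ω) {x y : E} (hx : x ∈ Ω) (hy : y ∈ Ω)
    {τ : ℝ} (h0 : 0 ≤ τ) (h1 : τ ≤ 1) : x + τ • (y - x) ∈ Ω :=
  hc.add_smul_sub_mem hx hy ⟨h0, h1⟩

/-- Contracting a convex set towards one of its points increases integrals at most by the inverse
Jacobian. -/
theorem lintegral_contraction_le (hΩ : IsOpen Ω) (hc : Convex ℝ Ω) {y : E} (hy : y ∈ Ω) {r : ℝ}
    (hr : 0 < r) (hr1 : r ≤ 1) (g : E → ℝ≥0∞) :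
    ∫⁻ x in Ω, g (x + (1 - r) • (y - x)) ≤ ENNReal.ofReal (r ^ Module.finrank ℝ E)⁻¹ * ∫⁻ x in Ω, g x := by
  set F : E → E := fun x => x + (1 - r) • (y - x) with hF
  have hFe : ∀ x, F x = r • x + (1 - r) • y := fun x => by simp only [hF]; module
  have hinj : InjOn F Ω := by
    intro a _ b _ hab
    simp only [hFe] at hab
    exact smul_right_injective E hr.ne' (add_right_cancel hab)
  have hd : ∀ x ∈ Ω, HasFDerivWithinAt F (r • ContinuousLinearMap.id ℝ E) Ω x := by
    intro x _
    have : F = fun x => r • x + (1 - r) • y := funext hFe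
    rw [this]
    exact (((hasFDerivAt_id x).const_smul r).add_const _).hasFDerivWithinAt
  have key := lintegral_image_eq_lintegral_abs_det_fderiv_mul volume hΩ.measurableSet hd hinj g
  have hdet : |(r • ContinuousLinearMap.id ℝ E).det| = r ^ Module.finrank ℝ E := by
    rw [ContinuousLinearMap.det, ContinuousLinearMap.toLinearMap_smul, LinearMap.det_smul]
    simp [abs_of_pos hr]
  have himg : F '' Ω ⊆ Ω := by
    rintro _ ⟨x, hx, rfl⟩
    exact hc.add_smul_sub_mem_of_open hx hy (by linarith) (by linarith)
  simp only [hdet] at key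
  have hpos : (0 : ℝ) < r ^ Module.finrank ℝ E := by positivity
  have hne : ENNReal.ofReal (r ^ Module.finrank ℝ E) ≠ 0 := by simpa using hpos
  rw [lintegral_const_mul' _ _ ENNReal.ofReal_ne_top] at key
  calc ∫⁻ x in Ω, g (F x)
      = ENNReal.ofReal (r ^ Module.finrank ℝ E)⁻¹ *
          (ENNReal.ofReal (r ^ Module.finrank ℝ E) * ∫⁻ x in Ω, g (F x)) := by
        rw [← mul_assoc, ENNReal.ofReal_inv_of_pos hpos,
          ENNReal.inv_mul_cancel hne ENNReal.ofReal_ne_top, one_mul]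
    _ ≤ _ := by
        rw [← key]
        gcongr

variable {w : E → ℝ}

/-- The fundamental theorem of calculus and Cauchy-Schwarz on the segment from `x` towards `y`. -/
theorem ofReal_sq_sub_le (hΩ : IsOpen Ω) (hc : Convex ℝ Ω) (hb : Bornology.IsBounded Ω)
    (hw : ContDiffOn ℝ 1 w Ω) {x y : E} (hx : x ∈ Ω) (hy : y ∈ Ω) {s : ℝ} (hs : 0 < s)
    (hs1 : s ≤ 1) :
    ENNReal.ofReal ((w x - w (x + s • (y - x))) ^ 2) ≤ ENNReal.ofReal (s * diam Ω ^ 2) *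
      ∫⁻ τ in Ioc 0 s, ENNReal.ofReal (‖fderiv ℝ w (x + τ • (y - x))‖ ^ 2) := by
  have hmem : ∀ τ ∈ Icc 0 s, x + τ • (y - x) ∈ Ω := fun τ hτ =>
    hc.add_smul_sub_mem_of_open hx hy hτ.1 (hτ.2.trans hs1)
  have hDw : ContinuousOn (fderiv ℝ w) Ω := hw.continuousOn_fderiv_of_isOpen hΩ le_rfl
  have hline : ContinuousOn (fun τ : ℝ => x + τ • (y - x)) (Icc 0 s) := by fun_prop
  have hcont : ContinuousOn (fun τ : ℝ => fderiv ℝ w (x + τ • (y - x)) (y - x)) (Icc 0 s) :=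
    (hDw.comp hline hmem).clm_apply continuousOn_const
  have hcont2 : ContinuousOn (fun τ : ℝ => ‖fderiv ℝ w (x + τ • (y - x))‖ ^ 2) (Icc 0 s) :=
    ((hDw.comp hline hmem).norm).pow 2
  have hu : uIcc 0 s = Icc 0 s := uIcc_of_le hs.le
  have ftc : ∫ τ in 0..s, fderiv ℝ w (x + τ • (y - x)) (y - x)
      = w (x + s • (y - x)) - w (x + (0 : ℝ) • (y - x)) := by
    refine intervalIntegral.integral_eq_sub_of_hasDerivAt (f := fun τ : ℝ => w (x + τ • (y - x)))
      (fun τ hτ => ?_) (ContinuousOn.intervalIntegrable (by rwa [hu]))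
    rw [hu] at hτ
    have h1 : HasDerivAt (fun τ : ℝ => x + τ • (y - x)) (y - x) τ := by
      simpa using ((hasDerivAt_id τ).smul_const (y - x)).const_add x
    exact ((hw.contDiffAt (hΩ.mem_nhds (hmem τ hτ))).differentiableAt
      (by simp)).hasFDerivAt.comp_hasDerivAt τ h1
  rw [zero_smul, add_zero] at ftc
  have h1 := sq_intervalIntegral_le hs hcont
  rw [ftc] at h1
  have hdiam : ‖y - x‖ ≤ diam Ω := by
    rw [← dist_eq_norm]; exact dist_le_diam_of_mem hb hy hx
  have h2 : ∫ τ in 0..s, (fderiv ℝ w (x + τ • (y - x)) (y - x)) ^ 2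
      ≤ ∫ τ in 0..s, diam Ω ^ 2 * ‖fderiv ℝ w (x + τ • (y - x))‖ ^ 2 := by
    refine intervalIntegral.integral_mono_on hs.le
      (ContinuousOn.intervalIntegrable (by rw [hu]; exact hcont.pow 2))
      (ContinuousOn.intervalIntegrable (by rw [hu]; exact continuousOn_const.mul hcont2))
      fun τ _ => ?_
    rw [← mul_pow, ← sq_abs]
    refine pow_le_pow_left₀ (abs_nonneg _) ?_ 2
    refine ((fderiv ℝ w _).le_opNorm _).trans ?_
    rw [mul_comm]
    gcongr
  have h3 : (w x - w (x + s • (y - x))) ^ 2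
      ≤ s * diam Ω ^ 2 * ∫ τ in Ioc 0 s, ‖fderiv ℝ w (x + τ • (y - x))‖ ^ 2 := by
    rw [← intervalIntegral.integral_of_le hs.le, mul_assoc]
    rw [intervalIntegral.integral_const_mul] at h2
    have h4 := mul_le_mul_of_nonneg_left h2 hs.le
    have h5 : (w x - w (x + s • (y - x))) ^ 2 = (w (x + s • (y - x)) - w x) ^ 2 := by ring
    linarith
  refine (ENNReal.ofReal_le_ofReal h3).trans ?_
  rw [ENNReal.ofReal_mul (by positivity)]
  gcongr
  rw [ofReal_integral_eq_lintegral_ofReal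
    ((hcont2.integrableOn_compact isCompact_Icc).mono_set Ioc_subset_Icc_self)
    (Eventually.of_forall fun τ => by positivity)]

/-- The pointwise estimate is integrated in `x`. Each map `x ↦ x + τ • (y - x)` contracts by `1 - τ
≥ 1/2`, so its inverse Jacobian is at most `2 ^ n` in dimension `n`; this is the reason for the
restriction on `s`. -/
theorem lintegral_sq_sub_le (hΩ : IsOpen Ω) (hc : Convex ℝ Ω) (hb : Bornology.IsBounded Ω)
    (hw : ContDiffOn ℝ 1 w Ω) {y : E} (hy : y ∈ Ω) {s : ℝ} (hs : 0 < s) (hs1 : s ≤ 1 / 2) :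
    ∫⁻ x in Ω, ENNReal.ofReal ((w x - w (x + s • (y - x))) ^ 2)
      ≤ ENNReal.ofReal (2 ^ Module.finrank ℝ E * s ^ 2 * diam Ω ^ 2) *
        ∫⁻ x in Ω, ENNReal.ofReal (‖fderiv ℝ w x‖ ^ 2) := by
  set J := ∫⁻ x in Ω, ENNReal.ofReal (‖fderiv ℝ w x‖ ^ 2) with hJ
  have hmeas : Measurable fun p : E × ℝ =>
      ENNReal.ofReal (‖fderiv ℝ w (p.1 + p.2 • (y - p.1))‖ ^ 2) := by
    have h1 : Measurable fun x => ENNReal.ofReal (‖fderiv ℝ w x‖ ^ 2) :=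
      ((measurable_fderiv ℝ w).norm.pow_const 2).ennreal_ofReal
    exact h1.comp (by fun_prop : Continuous fun p : E × ℝ => p.1 + p.2 • (y - p.1)).measurable
  calc ∫⁻ x in Ω, ENNReal.ofReal ((w x - w (x + s • (y - x))) ^ 2)
      ≤ ∫⁻ x in Ω, ENNReal.ofReal (s * diam Ω ^ 2) *
          ∫⁻ τ in Ioc 0 s, ENNReal.ofReal (‖fderiv ℝ w (x + τ • (y - x))‖ ^ 2) :=
        setLIntegral_mono' hΩ.measurableSet fun x hx =>
          ofReal_sq_sub_le hΩ hc hb hw hx hy hs (by linarith)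
    _ = ENNReal.ofReal (s * diam Ω ^ 2) * ∫⁻ τ in Ioc 0 s, ∫⁻ x in Ω,
          ENNReal.ofReal (‖fderiv ℝ w (x + τ • (y - x))‖ ^ 2) := by
        rw [lintegral_const_mul' _ _ ENNReal.ofReal_ne_top,
          lintegral_lintegral_swap hmeas.aemeasurable]
    _ ≤ ENNReal.ofReal (s * diam Ω ^ 2) * ∫⁻ _ in Ioc 0 s,
          ENNReal.ofReal (2 ^ Module.finrank ℝ E) * J := by
        gcongr ENNReal.ofReal (s * diam Ω ^ 2) * ?_
        refine setLIntegral_mono' measurableSet_Ioc fun τ hτ => ?_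
        have hτ2 : τ ≤ 1 / 2 := hτ.2.trans hs1
        have := lintegral_contraction_le hΩ hc hy (r := 1 - τ) (by linarith) (by linarith [hτ.1])
          (fun x => ENNReal.ofReal (‖fderiv ℝ w x‖ ^ 2))
        rw [sub_sub_cancel] at this
        refine this.trans ?_
        gcongr
        rw [← inv_pow]
        refine pow_le_pow_left₀ (by rw [inv_nonneg]; linarith) ?_ _
        rw [inv_le_comm₀ (by linarith) (by norm_num)]
        linarith
    _ = _ := by
        rw [setLIntegral_const, Real.volume_Ioc, sub_zero, mul_comm _ (ENNReal.ofReal s),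
          ← mul_assoc, ← mul_assoc, ← ENNReal.ofReal_mul (by positivity),
          ← ENNReal.ofReal_mul (by positivity)]
        congr 2
        ring

/-- Nash's inequality on a bounded convex open set, with a free scale `s`. -/
theorem nash_inequality (hΩ : IsOpen Ω) (hc : Convex ℝ Ω) (hb : Bornology.IsBounded Ω)
    (hne : Ω.Nonempty) (hw : ContDiffOn ℝ 1 w Ω) {W : ℝ} (hw0 : ∀ x ∈ Ω, 0 ≤ w x)
    (hwW : ∀ x ∈ Ω, w x ≤ W) (hDw : IntegrableOn (fun x => ‖fderiv ℝ w x‖ ^ 2) Ω)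
    {s : ℝ} (hs : 0 < s) (hs1 : s ≤ 1 / 2) :
    ∫ x in Ω, w x ^ 2 ≤ 2 ^ Module.finrank ℝ E * s ^ 2 * diam Ω ^ 2 *
        (∫ x in Ω, ‖fderiv ℝ w x‖ ^ 2)
      + 2 * (s ^ Module.finrank ℝ E)⁻¹ * (volume.real Ω)⁻¹ * (∫ x in Ω, w x) ^ 2 := by
  have hfin : volume Ω < ⊤ := hb.measure_lt_top
  have hvol : 0 < volume.real Ω :=
    ENNReal.toReal_pos (hΩ.measure_pos volume hne).ne' hfin.ne
  set μ := volume.restrict Ω with hμ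
  have : IsFiniteMeasure μ := ⟨by simpa [hμ] using hfin⟩
  have hmap : ∀ x ∈ Ω, ∀ y ∈ Ω, x + s • (y - x) ∈ Ω := fun x hx y hy =>
    hc.add_smul_sub_mem_of_open hx hy hs.le (by linarith)
  have hwabs : ∀ x ∈ Ω, ‖w x‖ ≤ W := fun x hx => by
    rw [Real.norm_eq_abs, abs_of_nonneg (hw0 x hx)]; exact hwW x hx
  have hae : ∀ {f : E → ℝ} {C : ℝ}, ContinuousOn f Ω → (∀ x ∈ Ω, ‖f x‖ ≤ C) →
      IntegrableOn f Ω := fun hf hC =>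
    IntegrableOn.of_bound hfin (hf.aestronglyMeasurable hΩ.measurableSet) _
      ((ae_restrict_iff' hΩ.measurableSet).2 (Eventually.of_forall hC))
  have hwc := hw.continuousOn
  have iw : IntegrableOn w Ω := hae hwc hwabs
  have iw2 : IntegrableOn (fun x => w x ^ 2) Ω := hae (C := W ^ 2) (hwc.pow 2) fun x hx => by
    rw [norm_pow]; exact pow_le_pow_left₀ (norm_nonneg _) (hwabs x hx) 2
  have hcy : ∀ y ∈ Ω, ContinuousOn (fun x => w (x + s • (y - x))) Ω := fun y hy =>
    hwc.comp (by fun_prop) fun x hx => hmap x hx y hy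
  have hcx : ∀ x ∈ Ω, ContinuousOn (fun y => w (x + s • (y - x))) Ω := fun x hx =>
    hwc.comp (by fun_prop) fun y hy => hmap x hx y hy
  set I1 := ∫ x in Ω, w x with hI1
  set I2 := ∫ x in Ω, w x ^ 2 with hI2
  set J := ∫ x in Ω, ‖fderiv ℝ w x‖ ^ 2 with hJ
  have hJ0 : 0 ≤ J := integral_nonneg fun x => by positivity
  set CJ := 2 ^ Module.finrank ℝ E * s ^ 2 * diam Ω ^ 2 with hCJ
  have hCJ0 : 0 ≤ CJ := by positivity
  -- comparison with the contracted function, for a fixed centre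
  have step1 : ∀ y ∈ Ω, I2 / 2 - CJ * J / 2 ≤ ∫ x in Ω, w x * w (x + s • (y - x)) := by
    intro y hy
    have ip : IntegrableOn (fun x => w x * w (x + s • (y - x))) Ω :=
      hae (C := W * W) (hwc.mul (hcy y hy)) fun x hx => by
        rw [norm_mul]
        exact mul_le_mul (hwabs x hx) (hwabs _ (hmap x hx y hy)) (norm_nonneg _)
          ((norm_nonneg _).trans (hwabs x hx))
    have iq : IntegrableOn (fun x => (w x - w (x + s • (y - x))) ^ 2) Ω :=
      hae (C := (W + W) ^ 2) ((hwc.sub (hcy y hy)).pow 2) fun x hx => by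
        rw [norm_pow]
        exact pow_le_pow_left₀ (norm_nonneg _) ((norm_sub_le _ _).trans
          (add_le_add (hwabs x hx) (hwabs _ (hmap x hx y hy)))) 2
    have h1 : ∫ x in Ω, (w x - w (x + s • (y - x))) ^ 2 ≤ CJ * J := by
      have h2 := lintegral_sq_sub_le hΩ hc hb hw hy hs hs1
      rw [← ofReal_integral_eq_lintegral_ofReal iq (Eventually.of_forall fun x => sq_nonneg _),
        ← ofReal_integral_eq_lintegral_ofReal hDw (Eventually.of_forall fun x => sq_nonneg _),
        ← ENNReal.ofReal_mul hCJ0] at h2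
      exact (ENNReal.ofReal_le_ofReal_iff (by positivity)).1 h2
    -- From `a b ≥ a² / 2 - (a - b)² / 2`.
    have h3 : ∫ x in Ω, (w x ^ 2 / 2 - (w x - w (x + s • (y - x))) ^ 2 / 2)
        ≤ ∫ x in Ω, w x * w (x + s • (y - x)) := by
      refine integral_mono ((iw2.div_const 2).sub (iq.div_const 2)) ip fun x => ?_
      simp only
      nlinarith [sq_nonneg (w (x + s • (y - x)))]
    rw [integral_sub (iw2.div_const 2) (iq.div_const 2), integral_div, integral_div] at h3
    linarith
  -- averaging over the centre
  have step2 : ∀ x ∈ Ω, ∫ y in Ω, w (x + s • (y - x)) ≤ (s ^ Module.finrank ℝ E)⁻¹ * I1 := by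
    intro x hx
    have h1 := lintegral_contraction_le hΩ hc hx (r := s) hs (by linarith)
      (fun z => ENNReal.ofReal (w z))
    -- As a function of the centre, with `x` fixed, the contracted point is a homothety of ratio `s`
    -- towards `x`. This gives the factor `s` to the minus dimension.
    have e : ∀ z, z + (1 - s) • (x - z) = x + s • (z - x) := fun z => by module
    simp only [e] at h1
    have ix : IntegrableOn (fun y => w (x + s • (y - x))) Ω :=
      hae (hcx x hx) fun y hy => hwabs _ (hmap x hx y hy)
    rw [← ofReal_integral_eq_lintegral_ofReal ix
        ((ae_restrict_iff' hΩ.measurableSet).2 (Eventually.of_forall fun y hy =>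
          hw0 _ (hmap x hx y hy))),
      ← ofReal_integral_eq_lintegral_ofReal iw
        ((ae_restrict_iff' hΩ.measurableSet).2 (Eventually.of_forall hw0)),
      ← ENNReal.ofReal_mul (by positivity)] at h1
    refine (ENNReal.ofReal_le_ofReal_iff ?_).1 h1
    exact mul_nonneg (by positivity) (setIntegral_nonneg hΩ.measurableSet hw0)
  have hprod : Integrable (Function.uncurry fun x y => w x * w (x + s • (y - x))) (μ.prod μ) := by
    have hc2 : ContinuousOn (Function.uncurry fun x y => w x * w (x + s • (y - x))) (Ω ×ˢ Ω) := by
      refine ContinuousOn.mul (hwc.comp continuousOn_fst fun p hp => hp.1) ?_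
      exact hwc.comp (by fun_prop) fun p hp => hmap p.1 hp.1 p.2 hp.2
    rw [hμ, Measure.prod_restrict]
    refine IntegrableOn.of_bound (C := W * W) ?_
      (hc2.aestronglyMeasurable (hΩ.prod hΩ).measurableSet)
      ((ae_restrict_iff' (hΩ.prod hΩ).measurableSet).2 (Eventually.of_forall fun p hp => ?_))
    · rw [Measure.prod_prod]; exact ENNReal.mul_lt_top hfin hfin
    · simp only [Function.uncurry]
      rw [norm_mul]
      exact mul_le_mul (hwabs _ hp.1) (hwabs _ (hmap _ hp.1 _ hp.2)) (norm_nonneg _)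
          ((norm_nonneg _).trans (hwabs _ hp.1))
  have hswap := integral_integral_swap hprod
  have hA : volume.real Ω * (I2 / 2 - CJ * J / 2)
      ≤ ∫ y in Ω, ∫ x in Ω, w x * w (x + s • (y - x)) := by
    have := setIntegral_mono_on (integrableOn_const (C := I2 / 2 - CJ * J / 2) hfin.ne)
      hprod.integral_prod_right hΩ.measurableSet step1
    rwa [setIntegral_const, smul_eq_mul] at this
  have hB : ∫ x in Ω, ∫ y in Ω, w x * w (x + s • (y - x))
      ≤ (s ^ Module.finrank ℝ E)⁻¹ * I1 * I1 := by
    have := setIntegral_mono_on hprod.integral_prod_left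
      (iw.mul_const ((s ^ Module.finrank ℝ E)⁻¹ * I1)) hΩ.measurableSet fun x hx => by
        simp only [Function.uncurry]
        rw [integral_const_mul]
        exact mul_le_mul_of_nonneg_left (step2 x hx) (hw0 x hx)
    rw [integral_mul_const] at this
    simp only [Function.uncurry] at this
    linarith
  have hC : volume.real Ω * (I2 / 2 - CJ * J / 2) ≤ (s ^ Module.finrank ℝ E)⁻¹ * I1 * I1 := by
    refine hA.trans (le_trans (le_of_eq ?_) hB)
    exact hswap.symm
  have hD : I2 / 2 - CJ * J / 2 ≤ (volume.real Ω)⁻¹ * ((s ^ Module.finrank ℝ E)⁻¹ * I1 * I1) := by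
    rw [le_inv_mul_iff₀ hvol]; exact hC
  nlinarith

end Nash

end

noncomputable section

open Filter Topology Metric

set_option linter.unusedSectionVars false

/-! ### Second derivative tests for weighted functions of time -/

section MaximumPrinciple

/-- The second derivative is nonpositive at a local maximum. -/
theorem IsLocalMax.deriv2_nonpos {f f₁ : ℝ → ℝ} {t f₂ : ℝ} (hmax : IsLocalMax f t)
    (hf : ∀ᶠ s in 𝓝 t, HasDerivAt f (f₁ s) s) (hf₁ : HasDerivAt f₁ f₂ t) : f₂ ≤ 0 := by
  by_contra! hpos
  have h0 : f₁ t = 0 := hmax.hasDerivAt_eq_zero hf.self_of_nhds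
  have he : deriv f =ᶠ[𝓝 t] f₁ := hf.mono fun s hs => hs.deriv
  have hmin : IsLocalMin f t := by
    refine isLocalMin_of_deriv_deriv_pos ?_ ?_ hf.self_of_nhds.continuousAt
    · rw [he.deriv_eq, hf₁.deriv]; exact hpos
    · rw [he.self_of_nhds, h0]
  have hc : f =ᶠ[𝓝 t] fun _ => f t := by
    filter_upwards [hmax, hmin] with s h1 h2 using le_antisymm h1 h2
  have hz : f₁ =ᶠ[𝓝 t] fun _ => 0 := by
    refine he.symm.trans ?_
    simpa using hc.deriv
  have := (hf₁.congr_of_eventuallyEq hz.symm).unique (hasDerivAt_const t (0 : ℝ))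
  linarith

/-- Maximum principle for `φ`, with a weight `ψ`. -/
theorem le_of_weighted_maximum {T Y : ℝ} (hT : 0 < T) {ψ ψ₁ ψ₂ φ φ₁ φ₂ : ℝ → ℝ}
    (hc : ContinuousOn (fun t => ψ t * φ t) (Icc 0 T))
    (hψ : ∀ t ∈ Ioo 0 T, HasDerivAt ψ (ψ₁ t) t) (hψ₁ : ∀ t ∈ Ioo 0 T, HasDerivAt ψ₁ (ψ₂ t) t)
    (hφ : ∀ t ∈ Ioo 0 T, HasDerivAt φ (φ₁ t) t) (hφ₁ : ∀ t ∈ Ioo 0 T, HasDerivAt φ₁ (φ₂ t) t)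
    (h0 : ψ 0 * φ 0 ≤ Y) (h1 : ψ T * φ T ≤ Y)
    (hY : ∀ t ∈ Ioo 0 T, ψ t ^ 2 * φ₂ t ≤ (2 * ψ₁ t ^ 2 - ψ t * ψ₂ t) * φ t → 0 ≤ ψ t →
      ψ t * φ t ≤ Y) (hψ0 : ∀ t ∈ Ioo 0 T, 0 ≤ ψ t) :
    ∀ t ∈ Icc 0 T, ψ t * φ t ≤ Y := by
  obtain ⟨τ, hτ, hmax⟩ := isCompact_Icc.exists_isMaxOn (nonempty_Icc.2 hT.le) hc
  suffices h : ψ τ * φ τ ≤ Y from fun t ht => (hmax ht).trans h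
  rcases eq_or_lt_of_le hτ.1 with rfl | hτ0
  · exact h0
  rcases eq_or_lt_of_le hτ.2 with rfl | hτ1
  · exact h1
  have hmem : τ ∈ Ioo 0 T := ⟨hτ0, hτ1⟩
  have hloc : IsLocalMax (fun t => ψ t * φ t) τ := hmax.isLocalMax (Icc_mem_nhds hτ0 hτ1)
  have hd : ∀ s ∈ Ioo 0 T, HasDerivAt (fun t => ψ t * φ t) (ψ₁ s * φ s + ψ s * φ₁ s) s :=
    fun s hs => (hψ s hs).fun_mul (hφ s hs)
  have h2 := hloc.deriv2_nonpos (eventually_of_mem (isOpen_Ioo.mem_nhds hmem) hd)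
    (((hψ₁ τ hmem).fun_mul (hφ τ hmem)).fun_add ((hψ τ hmem).fun_mul (hφ₁ τ hmem)))
  have h3 := hloc.hasDerivAt_eq_zero (hd τ hmem)
  refine hY τ hmem ?_ (hψ0 τ hmem)
  -- The first-order condition `ψ' φ + ψ φ' = 0` eliminates `φ'` from the second-order one after
  -- multiplication by `ψ`.
  have h4 := mul_le_mul_of_nonneg_left h2 (hψ0 τ hmem)
  have h5 : ψ₁ τ * (ψ τ * φ₁ τ) = -(ψ₁ τ ^ 2 * φ τ) := by linear_combination ψ₁ τ * h3
  linarith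

/-- A time weight: `0 ≤ ζ ≤ 1` on `[0, T]`, positive in the interior, with bounds on its first two
derivatives. -/
structure IsTimeWeight (T L : ℝ) (ζ ζ₁ ζ₂ : ℝ → ℝ) : Prop where
  continuousOn : ContinuousOn ζ (Icc 0 T)
  hasDerivAt : ∀ t ∈ Ioo 0 T, HasDerivAt ζ (ζ₁ t) t
  hasDerivAt' : ∀ t ∈ Ioo 0 T, HasDerivAt ζ₁ (ζ₂ t) t
  pos : ∀ t ∈ Ioo 0 T, 0 < ζ t
  nonneg : ∀ t ∈ Icc 0 T, 0 ≤ ζ t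
  le_one : ∀ t ∈ Icc 0 T, ζ t ≤ 1
  abs_le : ∀ t ∈ Ioo 0 T, |ζ₁ t| ≤ L
  neg_le : ∀ t ∈ Ioo 0 T, -ζ₂ t ≤ L

theorem isTimeWeight_one {T L : ℝ} (hL : 0 ≤ L) :
    IsTimeWeight T L (fun _ => 1) (fun _ => 0) (fun _ => 0) where
  continuousOn := continuousOn_const
  hasDerivAt t _ := hasDerivAt_const _ _
  hasDerivAt' t _ := hasDerivAt_const _ _
  pos _ _ := one_pos
  nonneg _ _ := zero_le_one
  le_one _ _ := le_rfl
  abs_le _ _ := by simpa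
  neg_le _ _ := by simpa

/-- A single constant serves both derivatives: the slope is at most `1 / T` and the curvature term
is `2 / T ^ 2`. -/
theorem isTimeWeight_parabola {T : ℝ} (hT : 0 < T) :
    IsTimeWeight T (1 / T + 2 / T ^ 2) (fun t => t * (T - t) / T ^ 2)
      (fun t => (T - 2 * t) / T ^ 2) (fun _ => -2 / T ^ 2) where
  continuousOn := by fun_prop
  hasDerivAt t _ := by
    refine (((hasDerivAt_id' t).fun_mul ((hasDerivAt_id' t).const_sub T)).div_const
      (T ^ 2)).congr_deriv ?_
    ring
  hasDerivAt' t _ := by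
    refine ((((hasDerivAt_id' t).const_mul 2).const_sub T).div_const (T ^ 2)).congr_deriv ?_
    ring
  pos t ht := by
    have := mul_pos ht.1 (sub_pos.2 ht.2)
    positivity
  nonneg t ht := by
    have := mul_nonneg ht.1 (sub_nonneg.2 ht.2)
    positivity
  le_one t ht := by
    rw [div_le_one (by positivity)]
    nlinarith [ht.1, ht.2]
  abs_le t ht := by
    have h1 : |T - 2 * t| ≤ T := abs_le.2 ⟨by linarith [ht.2], by linarith [ht.1]⟩
    rw [abs_div, abs_of_pos (by positivity : (0 : ℝ) < T ^ 2)]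
    have h2 : |T - 2 * t| / T ^ 2 ≤ T / T ^ 2 := by gcongr
    have h3 : T / T ^ 2 = 1 / T := by field_simp
    have : 0 ≤ 2 / T ^ 2 := by positivity
    linarith
  neg_le t _ := by
    have : 0 ≤ 1 / T := by positivity
    rw [neg_div, neg_neg]
    linarith

/-- One step of the iteration: a function satisfying a Nash type differential inequality is
controlled by the source term in that inequality. -/
theorem IsTimeWeight.pow_mul_le {T L : ℝ} {ζ ζ₁ ζ₂ : ℝ → ℝ} (hζ : IsTimeWeight T L ζ ζ₁ ζ₂)
    (hT : 0 < T) (hL : 0 ≤ L) {φ φ₁ φ₂ I : ℝ → ℝ} (hc : ContinuousOn φ (Icc 0 T))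
    (hφ : ∀ t ∈ Ioo 0 T, HasDerivAt φ (φ₁ t) t) (hφ₁ : ∀ t ∈ Ioo 0 T, HasDerivAt φ₁ (φ₂ t) t)
    (hφ0 : ∀ t ∈ Ioo 0 T, 0 ≤ φ t) {c C v : ℝ} (hc0 : 0 < c) (hC : 0 ≤ C) (hv : 0 < v) {d k a : ℕ}
    (hk : 1 ≤ k) (hka : k ≤ a) (ha : 2 ≤ a)
    (hineq : ∀ t ∈ Ioo 0 T, ∀ s : ℝ, 0 < s → s ≤ 1 / 2 →
      c / s ^ 2 * (φ t - 2 * (s ^ d)⁻¹ * v⁻¹ * I t ^ 2) - C * k ^ 2 * (φ t + v) ≤ φ₂ t)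
    {σ : ℝ} (hσ : 0 < σ) (hσ1 : σ ≤ 1 / 2) (hσ2 : 2 * (2 * L ^ 2 + L + C) ≤ c / σ ^ 2) {Y : ℝ}
    (h0 : ζ 0 ^ a * φ 0 ≤ Y) (h1 : ζ T ^ a * φ T ≤ Y)
    (hY : ∀ t ∈ Ioo 0 T, ζ t ^ d * φ t ≤ 4 * (a / σ) ^ d * v⁻¹ * I t ^ 2 + ζ t ^ d * v →
      ζ t ^ a * φ t ≤ Y) :
    ∀ t ∈ Icc 0 T, ζ t ^ a * φ t ≤ Y := by
  obtain ⟨b, rfl⟩ : ∃ b, a = b + 2 := ⟨a - 2, by omega⟩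
  refine le_of_weighted_maximum hT (ψ₁ := fun t => (b + 2) * ζ t ^ (b + 1) * ζ₁ t)
    (ψ₂ := fun t => (b + 2) * ((b + 1) * ζ t ^ b * ζ₁ t * ζ₁ t + ζ t ^ (b + 1) * ζ₂ t))
    ((hζ.continuousOn.pow _).mul hc) (fun t ht => ?_) (fun t ht => ?_) hφ hφ₁ h0 h1
    (fun t ht hmax _ => hY t ht ?_) fun t ht => pow_nonneg (hζ.pos t ht).le _
  · refine ((hζ.hasDerivAt t ht).fun_pow (b + 2)).congr_deriv ?_
    push_cast
    rfl
  · refine ((((hζ.hasDerivAt t ht).fun_pow (b + 1)).const_mul ((b : ℝ) + 2)).fun_mul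
      (hζ.hasDerivAt' t ht)).congr_deriv ?_
    rw [Nat.add_sub_cancel]
    push_cast
    ring
  · set z := ζ t with hz
    have hzp : 0 < z := hζ.pos t ht
    have hz1 : z ≤ 1 := hζ.le_one t (Ioo_subset_Icc_self ht)
    set a : ℝ := (b : ℝ) + 2 with ha'
    have hacast : ((b + 2 : ℕ) : ℝ) = a := by push_cast; rfl
    have ha2 : 2 ≤ a := by rw [ha']; linarith [(Nat.cast_nonneg b : (0 : ℝ) ≤ b)]
    have hp := hφ0 t ht
    -- the inequality at the maximum
    have e1 : φ₂ t * z ^ 2 ≤ a ^ 2 * (2 * L ^ 2 + L) * φ t := by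
      have h2 : z ^ (2 * b + 2) * (φ₂ t * z ^ 2) ≤ z ^ (2 * b + 2) *
          ((2 * a ^ 2 * ζ₁ t ^ 2 - a * (b + 1) * ζ₁ t ^ 2 - a * z * ζ₂ t) * φ t) := by
        refine le_of_eq_of_le ?_ (hmax.trans_eq ?_) <;> ring
      have h3 := le_of_mul_le_mul_left h2 (by positivity)
      refine h3.trans (mul_le_mul_of_nonneg_right ?_ hp)
      have h4 : ζ₁ t ^ 2 ≤ L ^ 2 := by
        rw [← sq_abs]; exact pow_le_pow_left₀ (abs_nonneg _) (hζ.abs_le t ht) 2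
      have h5 : z * -ζ₂ t ≤ L :=
        (mul_le_mul_of_nonneg_left (hζ.neg_le t ht) hzp.le).trans
          (mul_le_of_le_one_left hL hz1)
      have h6 : a * (z * -ζ₂ t) ≤ a * L := by gcongr
      have h7 : a * L ≤ a ^ 2 * L := by
        have : a ≤ a ^ 2 := by nlinarith
        gcongr
      have h8 : 0 ≤ a * (b + 1) * ζ₁ t ^ 2 := by positivity
      have h9 : 2 * a ^ 2 * ζ₁ t ^ 2 ≤ 2 * a ^ 2 * L ^ 2 := by gcongr
      linarith
    -- The Nash scale is `s = σ z / a`. Then `(c / s²) z² = a² c / σ²` has the same order in `a` as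
    -- the derivatives of the weight and as `C k²`, so one `σ` absorbs them for every exponent. The
    -- price is `s ^ (-d) = (a / σ) ^ d z ^ (-d)`, which explains the factor `ζ ^ d` in `hY`.
    have hs0 : 0 < σ * z / a := by positivity
    have hs1 : σ * z / a ≤ 1 / 2 := by
      rw [div_le_iff₀ (by linarith)]
      nlinarith [mul_le_mul hσ1 hz1 hzp.le (by norm_num)]
    have e2 := hineq t ht (σ * z / a) hs0 hs1
    set X := 2 * ((σ * z / a) ^ d)⁻¹ * v⁻¹ * I t ^ 2 with hX
    set R := c / σ ^ 2 with hR
    have hR0 : 0 < R := by positivity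
    have e3 : c / (σ * z / a) ^ 2 * z ^ 2 = a ^ 2 * R := by rw [hR]; field_simp
    have e4 : a ^ 2 * (R * (φ t - X)) ≤ a ^ 2 * (C * (φ t + v) + (2 * L ^ 2 + L) * φ t) := by
      have h2 := mul_le_mul_of_nonneg_right e2 (sq_nonneg z)
      have h3 : C * k ^ 2 * (φ t + v) * z ^ 2 ≤ C * a ^ 2 * (φ t + v) * 1 := by
        have hka' : (k : ℝ) ≤ a := by rw [← hacast]; exact_mod_cast hka
        gcongr
        exact pow_le_one₀ hzp.le hz1
      have h4 : c / (σ * z / a) ^ 2 * (φ t - X) * z ^ 2 = a ^ 2 * R * (φ t - X) := by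
        rw [← e3]; ring
      rw [sub_mul, h4] at h2
      linarith
    have e5 := le_of_mul_le_mul_left e4 (by positivity)
    have e6 : φ t ≤ 2 * X + v := by
      have h2 : (2 * L ^ 2 + L + C) * φ t ≤ R / 2 * φ t := by
        gcongr
        linarith
      have h3 : C * v ≤ R / 2 * v := by
        have h4 : 0 ≤ L ^ 2 := sq_nonneg L
        gcongr
        linarith
      have h4 : R * φ t ≤ R * (2 * X + v) := by linarith
      exact le_of_mul_le_mul_left h4 hR0
    have e7 : z ^ d * X = 2 * (a / σ) ^ d * v⁻¹ * I t ^ 2 := by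
      have hzd : z ^ d ≠ 0 := by positivity
      have h2 : ((σ * z / a) ^ d)⁻¹ = (a / σ) ^ d * (z ^ d)⁻¹ := by
        rw [← inv_pow, ← inv_pow, ← mul_pow]
        congr 1
        field_simp
      rw [hX, h2]
      calc z ^ d * (2 * ((a / σ) ^ d * (z ^ d)⁻¹) * v⁻¹ * I t ^ 2)
          = z ^ d * (z ^ d)⁻¹ * (2 * (a / σ) ^ d * v⁻¹ * I t ^ 2) := by ring
        _ = _ := by rw [mul_inv_cancel₀ hzd, one_mul]
    have e8 := mul_le_mul_of_nonneg_left e6 (by positivity : (0 : ℝ) ≤ z ^ d)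
    rw [hacast]
    have e9 : z ^ d * (2 * X + v) = 2 * (z ^ d * X) + z ^ d * v := by ring
    rw [e9, e7] at e8
    refine e8.trans_eq ?_
    ring

end MaximumPrinciple

/-! ### Moser's iteration over dyadic moments -/

section Iteration

/-- The sequence of bounds produced by the iteration. -/
def momentBound (A G B₀ : ℝ) : ℕ → ℝ
  | 0 => B₀
  | j + 1 => A * G ^ j * momentBound A G B₀ j ^ 2

/-- The factor `A * G ^ (j + 1)` turns the recursion into pure squaring; the growing constants thus
cost only a fixed factor in the base. -/
theorem momentBound_mul (A G B₀ : ℝ) (j : ℕ) :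
    momentBound A G B₀ j * (A * G ^ (j + 1)) = (B₀ * (A * G)) ^ 2 ^ j := by
  induction j with
  | zero => simp [momentBound]
  | succ j ih =>
    rw [pow_succ 2 j, pow_mul, ← ih, momentBound]
    ring

theorem pow_le_momentBound {A G B₀ : ℝ} (hA : 1 ≤ A) (hG : 1 ≤ G) (hB : 1 ≤ B₀) (j : ℕ) :
    B₀ ^ 2 ^ j ≤ momentBound A G B₀ j := by
  induction j with
  | zero => simp [momentBound]
  | succ j ih =>
    rw [pow_succ 2 j, pow_mul, momentBound]
    have h1 : 1 ≤ A * G ^ j := one_le_mul_of_one_le_of_one_le hA (one_le_pow₀ hG)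
    have h2 : 0 ≤ B₀ ^ 2 ^ j := by positivity
    calc (B₀ ^ 2 ^ j) ^ 2 ≤ momentBound A G B₀ j ^ 2 := by gcongr
      _ ≤ A * G ^ j * momentBound A G B₀ j ^ 2 := le_mul_of_one_le_left (sq_nonneg _) h1

theorem momentBound_le {A G B₀ : ℝ} (hA : 1 ≤ A) (hG : 1 ≤ G) (hB : 1 ≤ B₀) (j : ℕ) :
    momentBound A G B₀ j ≤ (B₀ * (A * G)) ^ 2 ^ j := by
  rw [← momentBound_mul]
  refine le_mul_of_one_le_right ?_ (one_le_mul_of_one_le_of_one_le hA (one_le_pow₀ hG))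
  exact (by positivity : (0 : ℝ) ≤ B₀ ^ 2 ^ j).trans (pow_le_momentBound hA hG hB j)

/-- The limiting constant of the iteration. -/
def momentConst (d : ℕ) (σ v b : ℝ) : ℝ :=
  ((4 * (3 * d / σ) ^ d * v⁻¹ + v + 1) ^ 3 + b) *
    ((4 * (8 * d / σ) ^ d * v⁻¹ + v + 1) * 2 ^ d)

/-- Moser's iteration in time for the moments `M i = ∫ n ^ i`. -/
theorem IsTimeWeight.moment_le {T L : ℝ} {ζ ζ₁ ζ₂ : ℝ → ℝ} (hζ : IsTimeWeight T L ζ ζ₁ ζ₂)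
    (hT : 0 < T) (hL : 0 ≤ L) {M : ℕ → ℝ → ℝ} (hM : ∀ i, ContinuousOn (M i) (Icc 0 T))
    (hM0 : ∀ i, ∀ t ∈ Icc 0 T, 0 ≤ M i t) (hM24 : ∀ t ∈ Icc 0 T, M 2 t ^ 3 ≤ M 4 t)
    {c C v : ℝ} (hc0 : 0 < c) (hC : 0 ≤ C) (hv : 0 < v) {d : ℕ} (hd : 1 ≤ d)
    (hineq : ∀ k : ℕ, 2 ≤ k → ∃ φ₁ φ₂ : ℝ → ℝ, ∀ t ∈ Ioo 0 T,
      HasDerivAt (M (2 * k)) (φ₁ t) t ∧ HasDerivAt φ₁ (φ₂ t) t ∧ ∀ s : ℝ, 0 < s → s ≤ 1 / 2 →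
      c / s ^ 2 * (M (2 * k) t - 2 * (s ^ d)⁻¹ * v⁻¹ * M k t ^ 2)
        - C * k ^ 2 * (M (2 * k) t + v) ≤ φ₂ t)
    {σ : ℝ} (hσ : 0 < σ) (hσ1 : σ ≤ 1 / 2) (hσ2 : 2 * (2 * L ^ 2 + L + C) ≤ c / σ ^ 2) {b : ℝ}
    (hb : 1 ≤ b)
    (h0 : ∀ j, ζ 0 ^ (4 * 2 ^ j * d - d) * M (4 * 2 ^ j) 0 ≤ b ^ 2 ^ j)
    (h1 : ∀ j, ζ T ^ (4 * 2 ^ j * d - d) * M (4 * 2 ^ j) T ≤ b ^ 2 ^ j) (j : ℕ) :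
    ∀ t ∈ Icc 0 T, ζ t ^ (4 * 2 ^ j * d) * M (4 * 2 ^ j) t ≤ momentConst d σ v b ^ 2 ^ j := by
  set A := 4 * (8 * d / σ) ^ d * v⁻¹ + v + 1 with hA
  set K := 4 * (3 * d / σ) ^ d * v⁻¹ with hK
  have hK0 : 0 ≤ K := by positivity
  have hA1 : 1 ≤ A := by
    have : 0 ≤ 4 * (8 * d / σ) ^ d * v⁻¹ := by positivity
    linarith
  have hG1 : (1 : ℝ) ≤ 2 ^ d := one_le_pow₀ (by norm_num)
  have hK1 : 1 ≤ (K + v + 1) ^ 3 := one_le_pow₀ (by linarith)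
  set B₀ := (K + v + 1) ^ 3 + b with hB₀
  have hB1 : 1 ≤ B₀ := by linarith
  have hbB : ∀ j, b ^ 2 ^ j ≤ momentBound A (2 ^ d) B₀ j := fun j =>
    (pow_le_pow_left₀ (by linarith) (by linarith) _).trans (pow_le_momentBound hA1 hG1 hB1 j)
  have hB1' : ∀ j, 1 ≤ momentBound A (2 ^ d) B₀ j := fun j =>
    (one_le_pow₀ hB1).trans (pow_le_momentBound hA1 hG1 hB1 j)
  -- The weight exponents `4 * 2 ^ j * d - d` start at `3 * d` and satisfy `a' = 2 a + d`: squaring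
  -- doubles the exponent and each step adds one factor `ζ ^ d`. They stay of order `2 ^ j`, hence a
  -- fixed power of `ζ` after taking roots.
  have key : ∀ j, ∀ t ∈ Icc 0 T,
      ζ t ^ (4 * 2 ^ j * d - d) * M (4 * 2 ^ j) t ≤ momentBound A (2 ^ d) B₀ j := by
    intro j
    induction j with
    | zero =>
      obtain ⟨φ₁, φ₂, hφ⟩ := hineq 2 le_rfl
      have hsub : 4 * 2 ^ 0 * d - d = 3 * d := by omega
      rw [hsub]
      refine hζ.pow_mul_le hT hL (hM 4) (fun t ht => (hφ t ht).1) (fun t ht => (hφ t ht).2.1)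
        (fun t ht => hM0 _ t (Ioo_subset_Icc_self ht)) hc0 hC hv (k := 2) (by norm_num)
        (by omega) (by omega) (fun t ht s hs hs1 => (hφ t ht).2.2 s hs hs1) hσ hσ1 hσ2
        ((by have h := h0 0; rw [hsub] at h; simpa using h : _ ≤ b).trans (by simpa using hbB 0))
        ((by have h := h1 0; rw [hsub] at h; simpa using h : _ ≤ b).trans (by simpa using hbB 0)) fun t ht hle => ?_
      have htI := Ioo_subset_Icc_self ht
      set x := ζ t ^ d with hx
      have hx0 : 0 ≤ x := pow_nonneg (hζ.nonneg t htI) _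
      have hx1 : x ≤ 1 := pow_le_one₀ (hζ.nonneg t htI) (hζ.le_one t htI)
      have hx3 : ζ t ^ (3 * d) = x ^ 3 := by rw [hx, ← pow_mul, mul_comm]
      push_cast at hle
      rw [← hK] at hle
      rw [hx3, momentBound]
      set z := x * M 2 t with hz
      have hz0 : 0 ≤ z := mul_nonneg hx0 (hM0 _ t htI)
      have e1 : x ^ 3 * M 4 t ≤ K * z ^ 2 + v := by
        have := mul_le_mul_of_nonneg_left hle (sq_nonneg x)
        have h3 : x ^ 3 * v ≤ 1 * v := by
          gcongr; exact pow_le_one₀ hx0 hx1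
        have h4 : x ^ 2 * (x * M 4 t) = x ^ 3 * M 4 t := by ring
        have h5 : x ^ 2 * (K * M 2 t ^ 2 + x * v) = K * z ^ 2 + x ^ 3 * v := by rw [hz]; ring
        linarith
      have e2 : z ^ 3 ≤ x ^ 3 * M 4 t := by
        rw [hz, mul_pow]
        exact mul_le_mul_of_nonneg_left (hM24 t htI) (by positivity)
      -- The second moment is not known beforehand, but `z ^ 3 ≤ K * z ^ 2 + v` closes the estimate:
      -- interpolation with unit mass gives the left side a higher power than the Nash term.
      have e3 : z ≤ K + v + 1 := by
        by_contra! hcon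
        have hz1 : 1 ≤ z ^ 2 := one_le_pow₀ (by linarith)
        have h3 : (K + v + 1) * z ^ 2 ≤ z * z ^ 2 := by gcongr
        have h4 : v ≤ v * z ^ 2 := le_mul_of_one_le_right hv.le hz1
        have h5 : z * z ^ 2 = z ^ 3 := by ring
        linarith
      have e4 : K * z ^ 2 + v ≤ (K + v + 1) ^ 3 := by
        have h3 : K * z ^ 2 ≤ K * (K + v + 1) ^ 2 := by gcongr
        have h4 : v ≤ v * (K + v + 1) ^ 2 :=
          le_mul_of_one_le_right hv.le (one_le_pow₀ (by linarith))
        have h5 : (K + v + 1) ^ 3 = K * (K + v + 1) ^ 2 + v * (K + v + 1) ^ 2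
          + (K + v + 1) ^ 2 := by ring
        have h6 : 0 ≤ (K + v + 1) ^ 2 := sq_nonneg _
        linarith
      linarith
    | succ j ih =>
      have h2j : 1 ≤ 2 ^ j := Nat.one_le_two_pow
      have hdj : d ≤ 2 ^ j * d := Nat.le_mul_of_pos_left d (by positivity)
      have hjd : 2 ^ j ≤ 2 ^ j * d := Nat.le_mul_of_pos_right _ (by omega)
      obtain ⟨φ₁, φ₂, hφ⟩ := hineq (4 * 2 ^ j) (by omega)
      have hmul : 2 * (4 * 2 ^ j) = 4 * 2 ^ (j + 1) := by ring
      have hexp : 4 * 2 ^ (j + 1) * d - d = 2 * (4 * 2 ^ j * d - d) + d := by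
        have : 4 * 2 ^ (j + 1) * d = 8 * (2 ^ j * d) := by ring
        have h' : 4 * 2 ^ j * d = 4 * (2 ^ j * d) := by ring
        omega
      have hexp' : 4 * 2 ^ (j + 1) * d - d ≤ 8 * (2 ^ j * d) := by
        have : 4 * 2 ^ (j + 1) * d = 8 * (2 ^ j * d) := by ring
        omega
      have hexp2 : 7 * (2 ^ j * d) ≤ 4 * 2 ^ (j + 1) * d - d := by
        have : 4 * 2 ^ (j + 1) * d = 8 * (2 ^ j * d) := by ring
        omega
      rw [hmul] at hφ
      refine hζ.pow_mul_le hT hL (hM _) (fun t ht => (hφ t ht).1) (fun t ht => (hφ t ht).2.1)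
        (fun t ht => hM0 _ t (Ioo_subset_Icc_self ht)) hc0 hC hv (k := 4 * 2 ^ j) (by omega)
        (by omega) (by omega) (fun t ht s hs hs1 => (hφ t ht).2.2 s hs hs1) hσ hσ1 hσ2
        ((h0 _).trans (hbB _)) ((h1 _).trans (hbB _)) fun t ht hle => ?_
      have htI := Ioo_subset_Icc_self ht
      set a := 4 * 2 ^ (j + 1) * d - d with ha
      have hz0 : 0 ≤ ζ t := hζ.nonneg t htI
      have hz1 : ζ t ≤ 1 := hζ.le_one t htI
      set y := ζ t ^ (4 * 2 ^ j * d - d) with hy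
      have hy0 : 0 ≤ y := pow_nonneg hz0 _
      have e0 : ζ t ^ a = y ^ 2 * ζ t ^ d := by rw [hexp, pow_add, mul_comm 2, pow_mul]
      have e1 := mul_le_mul_of_nonneg_left hle (sq_nonneg y)
      have e2 : (a / σ : ℝ) ^ d ≤ (8 * d / σ) ^ d * (2 ^ d) ^ j := by
        have : (a : ℝ) ≤ 8 * d * 2 ^ j := by
          have : (a : ℝ) ≤ ((8 * (2 ^ j * d) : ℕ) : ℝ) := by exact_mod_cast hexp'
          push_cast at this
          linarith
        calc (a / σ : ℝ) ^ d ≤ (8 * d * 2 ^ j / σ) ^ d := by gcongr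
          _ = _ := by
            rw [← pow_mul, mul_comm d j, pow_mul, ← mul_pow]
            congr 1; ring
      have e3 : (y * M (4 * 2 ^ j) t) ^ 2 ≤ momentBound A (2 ^ d) B₀ j ^ 2 :=
        pow_le_pow_left₀ (mul_nonneg hy0 (hM0 _ t htI)) (ih t htI) 2
      have e4 : y ^ 2 * (ζ t ^ d * v) ≤ v := by
        rw [← mul_assoc, ← e0]
        exact mul_le_of_le_one_left hv.le (pow_le_one₀ hz0 hz1)
      set Bj := momentBound A (2 ^ d) B₀ j with hBj
      have e5 : 4 * (a / σ : ℝ) ^ d * v⁻¹ * (y * M (4 * 2 ^ j) t) ^ 2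
          ≤ 4 * ((8 * d / σ) ^ d * (2 ^ d) ^ j) * v⁻¹ * Bj ^ 2 := by
        gcongr
      have e6 : v ≤ (v + 1) * (2 ^ d) ^ j * Bj ^ 2 := by
        have h3 : 1 ≤ ((2 : ℝ) ^ d) ^ j * Bj ^ 2 :=
          one_le_mul_of_one_le_of_one_le (one_le_pow₀ hG1) (one_le_pow₀ (hB1' j))
        nlinarith
      rw [momentBound, e0]
      calc y ^ 2 * ζ t ^ d * M (4 * 2 ^ (j + 1)) t
          ≤ 4 * (a / σ : ℝ) ^ d * v⁻¹ * (y * M (4 * 2 ^ j) t) ^ 2 + y ^ 2 * (ζ t ^ d * v) := by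
            linarith
        _ ≤ 4 * ((8 * d / σ) ^ d * (2 ^ d) ^ j) * v⁻¹ * Bj ^ 2
              + (v + 1) * (2 ^ d) ^ j * Bj ^ 2 := by linarith
        _ = A * (2 ^ d) ^ j * Bj ^ 2 := by rw [hA]; ring
  intro t ht
  refine le_trans (mul_le_mul_of_nonneg_right ?_ (hM0 _ t ht))
    ((key j t ht).trans (momentBound_le hA1 hG1 hB1 j))
  exact pow_le_pow_of_le_one (hζ.nonneg t ht) (hζ.le_one t ht) (Nat.sub_le _ _)

end Iteration

end

noncomputable section

open Filter Topology Metric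

set_option linter.unusedSectionVars false

/-! ### Energy densities: powers of the excess and a flattened power -/

section Densities

/-- Truncation leaves a corner only if the derivative at `0` is nonzero; with `G₁ 0 = 0` the
constant left branch matches. -/
theorem hasDerivAt_comp_max_zero {G G₁ : ℝ → ℝ} (hG : ∀ y, 0 ≤ y → HasDerivAt G (G₁ y) y)
    (h0 : G₁ 0 = 0) (x : ℝ) : HasDerivAt (fun x => G (max x 0)) (G₁ (max x 0)) x := by
  rcases lt_trichotomy x 0 with hx | rfl | hx
  · rw [max_eq_right hx.le, h0]
    refine (hasDerivAt_const x (G 0)).congr_of_eventuallyEq ?_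
    filter_upwards [gt_mem_nhds hx] with y hy
    rw [max_eq_right (le_of_lt hy)]
  · rw [max_self, h0]
    have h1 := hG 0 le_rfl
    rw [h0, hasDerivAt_iff_isLittleO_nhds_zero] at h1
    rw [hasDerivAt_iff_isLittleO_nhds_zero]
    simp only [zero_add, smul_zero, sub_zero, max_self] at h1 ⊢
    have h2 : Tendsto (fun h : ℝ => max h 0) (𝓝 0) (𝓝 0) := by
      have : Continuous fun h : ℝ => max h 0 := by fun_prop
      simpa using this.tendsto 0
    refine (h1.comp_tendsto h2).trans_isBigO (Asymptotics.IsBigO.of_bound 1 ?_)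
    refine Eventually.of_forall fun h => ?_
    simp only [Function.comp, Real.norm_eq_abs, one_mul]
    rw [abs_of_nonneg (le_max_right h 0)]
    exact max_le (le_abs_self h) (abs_nonneg h)
  · rw [max_eq_left hx.le]
    refine (hG x hx.le).congr_of_eventuallyEq ?_
    filter_upwards [lt_mem_nhds hx] with y hy
    rw [max_eq_left (le_of_lt hy)]

/-- The excess of `s` over the level `r`. -/
def excess (r s : ℝ) : ℝ := max (s - r) 0

theorem excess_nonneg (r s : ℝ) : 0 ≤ excess r s := le_max_right _ _

theorem continuous_excess (r : ℝ) : Continuous (excess r) := by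
  unfold excess; fun_prop

theorem le_add_excess (r s : ℝ) : s ≤ r + excess r s := by
  have := le_max_left (s - r) 0
  unfold excess; linarith

theorem excess_le {r s : ℝ} (hr : 0 ≤ r) (hs : 0 ≤ s) : excess r s ≤ s :=
  max_le (by linarith) hs

theorem excess_eq_zero {r s : ℝ} (h : s ≤ r) : excess r s = 0 := max_eq_right (by linarith)

theorem hasDerivAt_excess_pow (r : ℝ) (N : ℕ) (s : ℝ) :
    HasDerivAt (fun s => excess r s ^ (N + 2)) ((N + 2) * excess r s ^ (N + 1)) s := by
  have h := hasDerivAt_comp_max_zero (G := fun y => y ^ (N + 2))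
    (G₁ := fun y => (N + 2) * y ^ (N + 1)) (fun y _ => by
      refine (hasDerivAt_pow (N + 2) y).congr_deriv ?_
      push_cast
      rfl) (by simp) (s - r)
  exact (h.comp s ((hasDerivAt_id' s).sub_const r)).congr_deriv (mul_one _)

/-- The energy densities of the moments of the excess. -/
theorem isEnergy_excess_pow {r : ℝ} (hr : 0 < r) (l : ℕ) :
    IsEnergy r (fun s => (l + 2) / (2 * (2 * l + 3)) * excess r s ^ (2 * l + 4))
      (fun s => (l + 2) ^ 2 / (2 * l + 3) * excess r s ^ (2 * l + 3))
      (fun s => (l + 2) ^ 2 * excess r s ^ (2 * l + 2)) where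
  hasDerivAt s _ := by
    refine ((hasDerivAt_excess_pow r (2 * l + 2) s).const_mul _).congr_deriv ?_
    push_cast
    field_simp
    ring
  hasDerivAt' s _ := by
    refine ((hasDerivAt_excess_pow r (2 * l + 1) s).const_mul _).congr_deriv ?_
    push_cast
    field_simp
    ring
  continuousOn := ((continuous_const.mul ((continuous_excess r).pow _))).continuousOn
  nonneg s _ := mul_nonneg (by positivity) (pow_nonneg (excess_nonneg r s) _)
  eq_zero s _ hsr := by simp [excess_eq_zero hsr]
  pressure_nonneg s hs := by
    have h1 := excess_le hr.le hs.le
    have h0 := excess_nonneg r s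
    set n := excess r s
    have h2 : n * ((l + 2) ^ 2 / (2 * l + 3) * n ^ (2 * l + 3))
        ≤ s * ((l + 2) ^ 2 / (2 * l + 3) * n ^ (2 * l + 3)) := by gcongr
    have h3 : (l + 2 : ℝ) / (2 * (2 * l + 3)) ≤ (l + 2) ^ 2 / (2 * l + 3) := by
      rw [div_le_div_iff₀ (by positivity) (by positivity)]
      have : (0 : ℝ) ≤ l := Nat.cast_nonneg l
      nlinarith [mul_nonneg this this, mul_nonneg this (mul_nonneg this this)]
    have h4 := mul_le_mul_of_nonneg_right h3 (pow_nonneg h0 (2 * l + 4))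
    have h5 : n * ((l + 2) ^ 2 / (2 * l + 3) * n ^ (2 * l + 3))
      = (l + 2) ^ 2 / (2 * l + 3) * n ^ (2 * l + 4) := by ring
    linarith
  pressure_le s hs := by
    have h1 := excess_le hr.le hs.le
    have h0 := excess_nonneg r s
    set n := excess r s
    have h2 : (l + 2 : ℝ) ^ 2 / (2 * l + 3) ≤ (l + 2) ^ 2 :=
      div_le_self (by positivity) (by have : (0 : ℝ) ≤ l := Nat.cast_nonneg l
                                      linarith)
    have h3 : s * ((l + 2) ^ 2 / (2 * l + 3) * n ^ (2 * l + 3))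
        ≤ s * ((l + 2) ^ 2 * (s * n ^ (2 * l + 2))) := by
      rw [pow_succ' n (2 * l + 2)]
      gcongr
    have h4 : 0 ≤ (l + 2 : ℝ) / (2 * (2 * l + 3)) * n ^ (2 * l + 4) := by positivity
    have h5 : s * ((l + 2) ^ 2 * (s * n ^ (2 * l + 2))) = s ^ 2 * ((l + 2) ^ 2 * n ^ (2 * l + 2)) := by
      ring
    linarith

/-- Its pressure is zero, so the first derivative formula yields conservation of mass. -/
theorem isEnergy_id (r : ℝ) : IsEnergy r (fun s => s) (fun _ => 1) (fun _ => 0) where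
  hasDerivAt s _ := hasDerivAt_id' s
  hasDerivAt' s _ := hasDerivAt_const _ _
  continuousOn := continuousOn_const
  nonneg _ _ := le_rfl
  eq_zero _ _ _ := rfl
  pressure_nonneg s _ := by simp
  pressure_le s _ := by simp

/-- The third remainder of the exponential series, on the positive half line. -/
def expTail (y : ℝ) : ℝ := Real.exp y - 1 - y - y ^ 2 / 2

theorem hasDerivAt_expTail (y : ℝ) : HasDerivAt expTail (Real.exp y - 1 - y) y := by
  refine ((((Real.hasDerivAt_exp y).sub_const 1).fun_sub (hasDerivAt_id' y)).fun_sub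
    (((hasDerivAt_id' y).fun_pow 2).div_const 2)).congr_deriv ?_
  simp

theorem hasDerivAt_exp_sub (y : ℝ) :
    HasDerivAt (fun y => Real.exp y - 1 - y) (Real.exp y - 1) y :=
  (((Real.hasDerivAt_exp y).sub_const 1).fun_sub (hasDerivAt_id' y))

theorem exp_sub_one_sub_nonneg (y : ℝ) : 0 ≤ Real.exp y - 1 - y := by
  linarith [Real.add_one_le_exp y]

theorem expTail_nonneg {y : ℝ} (hy : 0 ≤ y) : 0 ≤ expTail y := by
  unfold expTail; linarith [Real.quadratic_le_exp_of_nonneg hy]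

theorem expTail_le {y : ℝ} (hy : 0 ≤ y) : expTail y ≤ Real.exp y := by
  unfold expTail; nlinarith [sq_nonneg y]

/-- Equivalent to `2 y + y² ≤ exp y + 18`, which the cubic Taylor polynomial of `exp` already gives.
The factor `2` and the additive `20` lead to the shift `φ + 10` later. -/
theorem exp_le_expTail {y : ℝ} (hy : 0 ≤ y) : Real.exp y ≤ 2 * expTail y + 20 := by
  have h1 := Real.sum_le_exp_of_nonneg hy 4
  simp only [Finset.sum_range_succ, Finset.sum_range_zero, Nat.factorial] at h1
  norm_num at h1
  unfold expTail
  nlinarith [mul_nonneg hy (sq_nonneg (y - 5)), sq_nonneg (y - 5)]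

/-- The positive part of `θ log (s / r)`. -/
def logExcess (r θ s : ℝ) : ℝ := max (θ * (Real.log s - Real.log r)) 0

theorem logExcess_nonneg (r θ s : ℝ) : 0 ≤ logExcess r θ s := le_max_right _ _

theorem logExcess_eq_zero {r θ s : ℝ} (hθ : 0 ≤ θ) (h0 : 0 < s) (hsr : s ≤ r) : logExcess r θ s = 0 :=
  max_eq_right (mul_nonpos_of_nonneg_of_nonpos hθ (sub_nonpos.2 (Real.log_le_log h0 hsr)))

theorem hasDerivAt_comp_logExcess {G G₁ : ℝ → ℝ} (hG : ∀ y, 0 ≤ y → HasDerivAt G (G₁ y) y)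
    (h0 : G₁ 0 = 0) (r θ : ℝ) {s : ℝ} (hs : 0 < s) :
    HasDerivAt (fun s => G (logExcess r θ s)) (G₁ (logExcess r θ s) * (θ / s)) s := by
  refine ((hasDerivAt_comp_max_zero hG h0 _).comp s
    (((Real.hasDerivAt_log hs.ne').sub_const (Real.log r)).const_mul θ)).congr_deriv ?_
  rw [div_eq_mul_inv]
  rfl

/-- For `s ≥ r`, `exp (logExcess r θ s)` is `(s / r) ^ θ`, so this energy behaves like `s ^ (θ + 1)`
for every real `θ > 0`. Removing the quadratic Taylor polynomial makes two derivatives vanish at `s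
= r`; a truncated power of `s - r` would not be `C²` for small `θ`. -/
theorem isEnergy_expTail {r θ : ℝ} (hθ : 0 < θ) :
    IsEnergy r (fun s => s * expTail (logExcess r θ s))
      (fun s => expTail (logExcess r θ s)
        + θ * (Real.exp (logExcess r θ s) - 1 - logExcess r θ s))
      (fun s => (θ * (Real.exp (logExcess r θ s) - 1 - logExcess r θ s)
        + θ ^ 2 * (Real.exp (logExcess r θ s) - 1)) / s) where
  hasDerivAt s hs := by
    refine ((hasDerivAt_id' s).fun_mul (hasDerivAt_comp_logExcess
      (fun y _ => hasDerivAt_expTail y) (by simp) r θ hs)).congr_deriv ?_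
    field_simp
  hasDerivAt' s hs := by
    refine ((hasDerivAt_comp_logExcess (fun y _ => hasDerivAt_expTail y) (by simp) r θ hs).fun_add
      ((hasDerivAt_comp_logExcess (fun y _ => hasDerivAt_exp_sub y) (by simp) r θ hs).const_mul
        θ)).congr_deriv ?_
    field_simp
  continuousOn := by
    have h1 : ContinuousOn (logExcess r θ) (Ioi 0) := by
      unfold logExcess
      exact (continuousOn_const.mul ((Real.continuousOn_log.mono fun s hs => (ne_of_gt hs)).sub
        continuousOn_const)).sup continuousOn_const
    have h2 : ContinuousOn (fun s => Real.exp (logExcess r θ s)) (Ioi 0) := h1.rexp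
    exact (((continuousOn_const.mul ((h2.sub continuousOn_const).sub h1)).add
      (continuousOn_const.mul (h2.sub continuousOn_const))).div continuousOn_id
        fun s hs => ne_of_gt hs)
  nonneg s hs := by
    have h1 := exp_sub_one_sub_nonneg (logExcess r θ s)
    have h2 := logExcess_nonneg r θ s
    have h3 : 0 ≤ Real.exp (logExcess r θ s) - 1 := by linarith
    positivity
  eq_zero s hs hsr := by simp [logExcess_eq_zero hθ.le hs hsr]
  pressure_nonneg s hs := by
    have h1 := exp_sub_one_sub_nonneg (logExcess r θ s)
    have : 0 ≤ s * (θ * (Real.exp (logExcess r θ s) - 1 - logExcess r θ s)) := by positivity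
    linarith
  pressure_le s hs := by
    have h1 := exp_sub_one_sub_nonneg (logExcess r θ s)
    have h2 := logExcess_nonneg r θ s
    have h3 : 0 ≤ s * (θ ^ 2 * (Real.exp (logExcess r θ s) - 1)) :=
      mul_nonneg hs.le (mul_nonneg (sq_nonneg θ) (by linarith))
    have h4 : s ^ 2 * ((θ * (Real.exp (logExcess r θ s) - 1 - logExcess r θ s)
        + θ ^ 2 * (Real.exp (logExcess r θ s) - 1)) / s)
        = s * (θ * (Real.exp (logExcess r θ s) - 1 - logExcess r θ s)
        + θ ^ 2 * (Real.exp (logExcess r θ s) - 1)) := by field_simp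
    rw [h4]
    linarith

theorem exp_logExcess {r θ s : ℝ} (hr : 0 < r) (hs : 0 < s) :
    Real.exp (logExcess r θ s) = max ((s / r) ^ θ) 1 := by
  rw [logExcess, Real.exp_monotone.map_max, Real.exp_zero, ← Real.log_div hs.ne' hr.ne',
    mul_comm, Real.rpow_def_of_pos (by positivity)]

end Densities

/-! ### Continuity in time, and pointwise bounds from moments -/

section Solution

theorem continuousOn_setIntegral {d : ℕ} {Ω : Set (EuclideanSpace ℝ (Fin d))} {T : ℝ}
    (hΩ : IsOpen Ω) (hb : Bornology.IsBounded Ω) {F : ℝ × EuclideanSpace ℝ (Fin d) → ℝ}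
    (hF : ContinuousOn F (Icc 0 T ×ˢ closure Ω)) :
    ContinuousOn (fun t => ∫ x in Ω, F (t, x)) (Icc 0 T) := by
  obtain ⟨C, hC⟩ := (isCompact_Icc.prod hb.isCompact_closure).exists_bound_of_continuousOn hF
  refine continuousOn_of_dominated (bound := fun _ => C) (fun t ht => ?_) (fun t ht => ?_)
    ?_ ?_
  · refine ContinuousOn.aestronglyMeasurable ?_ hΩ.measurableSet
    exact hF.comp (by fun_prop) fun x hx => ⟨ht, subset_closure hx⟩
  · exact (ae_restrict_iff' hΩ.measurableSet).2 (Eventually.of_forall fun x hx =>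
      hC (t, x) ⟨ht, subset_closure hx⟩)
  · exact integrableOn_const hb.measure_lt_top.ne
  · exact (ae_restrict_iff' hΩ.measurableSet).2 (Eventually.of_forall fun x hx =>
      hF.comp (by fun_prop) fun t ht => ⟨ht, subset_closure hx⟩)

/-- Pointwise bounds from a geometric control on a sequence of moments. -/
theorem pow_le_of_forall_integral_pow_le {E : Type*} [TopologicalSpace E] [MeasurableSpace E]
    [BorelSpace E] {μ : Measure E} [μ.IsOpenPosMeasure] {Ω : Set E} (hΩ : IsOpen Ω)
    (hfin : μ Ω ≠ ⊤) {w : E → ℝ} (hw : ContinuousOn w Ω) (hw0 : ∀ x ∈ Ω, 0 ≤ w x)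
    (hint : ∀ i : ℕ, IntegrableOn (fun x => w x ^ i) Ω μ) {P : ℝ} (hP : 0 < P)
    (h : ∀ j : ℕ, ∫ x in Ω, w x ^ (2 ^ j) ∂μ ≤ P ^ 2 ^ j) :
    ∀ x ∈ Ω, w x ≤ P := by
  intro x hx
  by_contra! hcon
  obtain ⟨Q, hPQ, hQ⟩ := exists_between hcon
  set U := Ω ∩ w ⁻¹' Ioi Q with hU
  have hUo : IsOpen U := hw.isOpen_inter_preimage hΩ isOpen_Ioi
  have hUpos : 0 < μ.real U :=
    ENNReal.toReal_pos (hUo.measure_pos μ ⟨x, hx, hQ⟩).ne'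
      (ne_top_of_le_ne_top hfin (measure_mono inter_subset_left))
  have hkey : ∀ j : ℕ, μ.real U * (Q / P) ^ 2 ^ j ≤ 1 := by
    intro j
    have h1 : μ.real U * Q ^ 2 ^ j ≤ P ^ 2 ^ j := by
      refine le_trans ?_ (h j)
      calc μ.real U * Q ^ 2 ^ j = ∫ _ in U, Q ^ 2 ^ j ∂μ := by
            rw [setIntegral_const, smul_eq_mul]
        _ ≤ ∫ x in U, w x ^ 2 ^ j ∂μ := by
            refine setIntegral_mono_on (integrableOn_const
              (ne_top_of_le_ne_top hfin (measure_mono inter_subset_left)))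
              ((hint _).mono_set inter_subset_left) hUo.measurableSet fun y hy => ?_
            exact pow_le_pow_left₀ (by linarith) (le_of_lt hy.2) _
        _ ≤ ∫ x in Ω, w x ^ 2 ^ j ∂μ := by
            refine setIntegral_mono_set (hint _) ?_ (Eventually.of_forall inter_subset_left)
            exact (ae_restrict_iff' hΩ.measurableSet).2 (Eventually.of_forall fun y hy =>
              pow_nonneg (hw0 y hy) _)
    rw [div_pow, ← mul_div_assoc]
    exact (div_le_one (by positivity)).2 h1
  have hlim : Tendsto (fun j : ℕ => (Q / P) ^ 2 ^ j) atTop atTop :=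
    (tendsto_pow_atTop_atTop_of_one_lt ((one_lt_div hP).2 hPQ)).comp
      (tendsto_pow_atTop_atTop_of_one_lt one_lt_two)
  obtain ⟨j, hj⟩ := (hlim.eventually_gt_atTop (μ.real U)⁻¹).exists
  have := mul_lt_mul_of_pos_left hj hUpos
  rw [mul_inv_cancel₀ hUpos.ne'] at this
  linarith [hkey j]

end Solution

end

noncomputable section

open Filter Topology Metric

set_option linter.unusedSectionVars false

/-! ### Moments of the excess along a solution -/

section Moments

namespace IsSmoothConvexDomain

variable {d : ℕ} {Ω : Set (EuclideanSpace ℝ (Fin d))}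

theorem volume_pos (hΩ : IsSmoothConvexDomain Ω) : 0 < volume.real Ω :=
  ENNReal.toReal_pos (hΩ.isOpen.measure_pos volume hΩ.nonempty).ne'
    hΩ.isBounded.measure_lt_top.ne

theorem diam_pos (hΩ : IsSmoothConvexDomain Ω) (hd : 1 ≤ d) : 0 < diam Ω := by
  have : Nonempty (Fin d) := ⟨⟨0, hd⟩⟩
  obtain ⟨x, hx⟩ := hΩ.nonempty
  obtain ⟨y, hy, hyx⟩ := (infinite_of_mem_nhds x (hΩ.isOpen.mem_nhds hx)).nontrivial.exists_ne x
  exact (dist_pos.2 hyx).trans_le (dist_le_diam_of_mem hΩ.isBounded hy hx)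

end IsSmoothConvexDomain

namespace IsClassicalPlanningSolution

variable {d : ℕ} {Ω : Set (EuclideanSpace ℝ (Fin d))} {T ε : ℝ}
  {H V m₀ m₁ : EuclideanSpace ℝ (Fin d) → ℝ} {f : ℝ → ℝ}
  {u m : ℝ → EuclideanSpace ℝ (Fin d) → ℝ} {α β c₀ r₀ : ℝ} {Λ : ℝ≥0}
  (S : IsClassicalPlanningSolution Ω T ε H f V m₀ m₁ u m)
include S

theorem continuousOn_slice {t : ℝ} (ht : t ∈ Icc 0 T) : ContinuousOn (m t) (closure Ω) :=
  S.continuousOn_m.comp (f := fun x : EuclideanSpace ℝ (Fin d) => (t, x)) (by fun_prop)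
    fun _ hx => ⟨ht, hx⟩

theorem nonneg (hT : 0 < T) {t : ℝ} (ht : t ∈ Icc 0 T) {x : EuclideanSpace ℝ (Fin d)}
    (hx : x ∈ closure Ω) : 0 ≤ m t x := by
  have h1 : ContinuousOn (fun t => m t x) (closure (Ioo 0 T)) := by
    rw [closure_Ioo hT.ne]
    exact S.continuousOn_m.comp (f := fun t : ℝ => (t, x)) (by fun_prop) fun _ ht => ⟨ht, hx⟩
  have h2 : MapsTo (fun t => m t x) (Ioo 0 T) (Ici 0) := fun s hs => (S.pos_m s hs x hx).le
  have h3 := h2.closure_of_continuousOn h1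
  rw [closure_Ioo hT.ne, isClosed_Ici.closure_eq] at h3
  exact h3 ht

theorem continuousOn_integral_comp (hΩ : IsSmoothConvexDomain Ω) {g : ℝ → ℝ}
    (hg : ∀ s, 0 ≤ s → ContinuousAt g s) (hT : 0 < T) :
    ContinuousOn (fun t => ∫ x in Ω, g (m t x)) (Icc 0 T) :=
  continuousOn_setIntegral hΩ.isOpen hΩ.isBounded (F := fun z => g (m z.1 z.2))
    fun z hz => (hg _ (S.nonneg hT hz.1 hz.2)).comp_continuousWithinAt
      (f := fun z : ℝ × EuclideanSpace ℝ (Fin d) => m z.1 z.2) (S.continuousOn_m z hz)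

theorem integrableOn_comp (hΩ : IsSmoothConvexDomain Ω) {g : ℝ → ℝ}
    (hg : ∀ s, 0 ≤ s → ContinuousAt g s) (hT : 0 < T) {t : ℝ} (ht : t ∈ Icc 0 T) :
    IntegrableOn (fun x => g (m t x)) Ω :=
  ContinuousOn.integrableOn_of_closure hΩ.isBounded fun x hx =>
    (hg _ (S.nonneg hT ht hx)).comp_continuousWithinAt (S.continuousOn_slice ht x hx)

theorem integral_eq_one (hΩ : IsSmoothConvexDomain Ω) (hH : IsUniformlyConvexHamiltonian α β H)
    (hT : 0 < T) (hm₀ : IsProbabilityDensity Ω m₀) {t : ℝ} (ht : t ∈ Icc 0 T) :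
    ∫ x in Ω, m t x = 1 := by
  have h0 : ∫ x in Ω, m 0 x = 1 := by
    rw [← hm₀.2]
    exact setIntegral_congr_fun hΩ.isOpen.measurableSet fun x hx => S.initial x hx
  rcases eq_or_lt_of_le ht.1 with rfl | h
  · exact h0
  have hc := S.continuousOn_integral_comp hΩ (g := fun s => s) (fun s _ => continuousAt_id) hT
  obtain ⟨s, hs, h1⟩ := exists_hasDerivAt_eq_slope (fun t => ∫ x in Ω, m t x) (fun _ => 0) h
    (hc.mono (Icc_subset_Icc_right ht.2)) fun s hs => by
      have := (S.isTransport hΩ hH).hasDerivAt_energy (isEnergy_id 1)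
        (⟨hs.1, hs.2.trans_le ht.2⟩ : s ∈ Ioo 0 T)
      simpa using this
  rw [eq_comm, div_eq_zero_iff, sub_eq_zero, h0] at h1
  exact h1.resolve_right (by linarith)

/-- The moments of the excess satisfy a differential inequality of Nash type. -/
theorem exists_moment_deriv2 (hd : 1 ≤ d) (hΩ : IsSmoothConvexDomain Ω)
    (hH : IsUniformlyConvexHamiltonian α β H) (hT : 0 < T) (hα : 0 < α) (hβ : 0 < β)
    (hc₀ : 0 < c₀) (hr₀ : 0 < r₀) (hε : 0 ≤ ε) (hV : LipschitzOnWith Λ V Ω)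
    (hf : IsCoerciveCoupling c₀ r₀ f) {k : ℕ} (hk : 2 ≤ k) :
    ∃ φ₁ φ₂ : ℝ → ℝ, ∀ t ∈ Ioo 0 T,
      HasDerivAt (fun t => ∫ x in Ω, excess r₀ (m t x) ^ (2 * k)) (φ₁ t) t ∧
      HasDerivAt φ₁ (φ₂ t) t ∧ ∀ s : ℝ, 0 < s → s ≤ 1 / 2 →
      c₀ * α / (2 ^ d * diam Ω ^ 2) / s ^ 2 * ((∫ x in Ω, excess r₀ (m t x) ^ (2 * k))
          - 2 * (s ^ d)⁻¹ * (volume.real Ω)⁻¹ * (∫ x in Ω, excess r₀ (m t x) ^ k) ^ 2)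
        - β * Λ ^ 2 / c₀ * (4 + 4 * r₀ ^ 2) * k ^ 2
          * ((∫ x in Ω, excess r₀ (m t x) ^ (2 * k)) + volume.real Ω) ≤ φ₂ t := by
  obtain ⟨l, rfl⟩ : ∃ l, k = l + 2 := ⟨k - 2, by omega⟩
  obtain ⟨φ₁, φ₂, hφ⟩ := S.le_energy_deriv2 hΩ hH hα hβ hc₀ hε hV hf
    (isEnergy_excess_pow hr₀ l)
  -- The energy was normalised so that `h₂(m) |Dm|² = |D(n ^ (l + 2))|²`; `κ` undoes that
  -- normalisation. It stays between `2` and `4`, which keeps the constants independent of the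
  -- exponent.
  set κ : ℝ := 2 * (2 * l + 3) / (l + 2) with hκ
  have hl : (0 : ℝ) ≤ l := Nat.cast_nonneg l
  have hκ2 : 2 ≤ κ := by
    rw [hκ, le_div_iff₀ (by positivity)]; linarith
  have hκ4 : κ ≤ 4 := by
    rw [hκ, div_le_iff₀ (by positivity)]; linarith
  have hκ1 : ∀ y : ℝ, κ * ((l + 2) / (2 * (2 * l + 3)) * y) = y := fun y => by
    rw [hκ]; field_simp
  have hdiam : 0 < diam Ω := hΩ.diam_pos hd
  have hexp : 2 * (l + 2) = 2 * l + 4 := by ring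
  rw [hexp]
  refine ⟨fun t => κ * φ₁ t, fun t => κ * φ₂ t, fun t ht => ⟨?_, (hφ t ht).2.1.const_mul κ,
    fun s hs hs1 => ?_⟩⟩
  · refine ((hφ t ht).1.const_mul κ).congr_of_eventuallyEq (Eventually.of_forall fun t => ?_)
    simp only [integral_const_mul, hκ1]
  have h3 := (hφ t ht).2.2
  have htI := Ioo_subset_Icc_self ht
  have hint : ∀ N : ℕ, IntegrableOn (fun x => excess r₀ (m t x) ^ N) Ω := fun N =>
    S.integrableOn_comp hΩ (g := fun s => excess r₀ s ^ N)
      (fun s _ => ((continuous_excess r₀).pow N).continuousAt) hT htI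
  have hmt : ContDiffOn ℝ 1 (m t) Ω :=
    ((S.contDiffOn_m : ContDiffOn ℝ 1 (fun z : ℝ × EuclideanSpace ℝ (Fin d) => m z.1 z.2)
      (tube Ω T)).contDiffOn_slice ht).mono subset_closure
  -- the gradient term
  have hfd : ∀ x ∈ Ω, HasFDerivAt (fun x => excess r₀ (m t x) ^ (l + 2))
      (((l + 2) * excess r₀ (m t x) ^ (l + 1)) • fderiv ℝ (m t) x) x := fun x hx =>
    (hasDerivAt_excess_pow r₀ l (m t x)).comp_hasFDerivAt x
      ((hmt.contDiffAt (hΩ.isOpen.mem_nhds hx)).differentiableAt (by simp)).hasFDerivAt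
  have hsq : ∀ x ∈ Ω, ‖fderiv ℝ (fun x => excess r₀ (m t x) ^ (l + 2)) x‖ ^ 2
      = (l + 2) ^ 2 * excess r₀ (m t x) ^ (2 * l + 2) * ‖fderiv ℝ (m t) x‖ ^ 2 := by
    intro x hx
    rw [(hfd x hx).fderiv, norm_smul, mul_pow, Real.norm_eq_abs, sq_abs]
    ring
  have hdm : ContinuousOn (spaceDeriv Ω T (fun z : ℝ × EuclideanSpace ℝ (Fin d) => m z.1 z.2))
      (tube Ω T) :=
    (S.contDiffOn_m : ContDiffOn ℝ 1 (fun z : ℝ × EuclideanSpace ℝ (Fin d) => m z.1 z.2)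
      (tube Ω T)).continuousOn_spaceDeriv hΩ.isOpen hΩ.convex hΩ.nonempty
  have hDint : IntegrableOn (fun x => ‖fderiv ℝ (fun x => excess r₀ (m t x) ^ (l + 2)) x‖ ^ 2) Ω := by
    have h5 : IntegrableOn (fun x => (l + 2) ^ 2 * excess r₀ (m t x) ^ (2 * l + 2)
        * ‖spaceDeriv Ω T (fun z : ℝ × EuclideanSpace ℝ (Fin d) => m z.1 z.2) (t, x)‖ ^ 2) Ω := by
      refine ContinuousOn.integrableOn_of_closure hΩ.isBounded ?_
      exact (continuousOn_const.mul (((continuous_excess r₀).comp_continuousOn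
        (S.continuousOn_slice htI)).pow _)).mul ((hdm.slice ht).norm.pow 2)
    refine h5.congr_fun (fun x hx => ?_) hΩ.isOpen.measurableSet
    simp only
    rw [hsq x hx, ((S.contDiffOn_m : ContDiffOn ℝ 1
      (fun z : ℝ × EuclideanSpace ℝ (Fin d) => m z.1 z.2) (tube Ω T)).hasFDerivAt_spaceDeriv
      hΩ.isOpen ht hx).fderiv]
  have hwc : ContDiffOn ℝ 1 (fun x => excess r₀ (m t x) ^ (l + 2)) Ω := by
    have h5 : ContDiff ℝ 1 (fun s => excess r₀ s ^ (l + 2)) := by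
      rw [contDiff_one_iff_deriv]
      refine ⟨fun s => (hasDerivAt_excess_pow r₀ l s).differentiableAt, ?_⟩
      rw [funext fun s => (hasDerivAt_excess_pow r₀ l s).deriv]
      exact continuous_const.mul ((continuous_excess r₀).pow _)
    exact h5.comp_contDiffOn hmt
  obtain ⟨W, hW⟩ := hΩ.isBounded.isCompact_closure.exists_bound_of_continuousOn
    (f := fun x => excess r₀ (m t x) ^ (l + 2))
    (((continuous_excess r₀).comp_continuousOn (S.continuousOn_slice htI)).pow _)
  have hnash := nash_inequality hΩ.isOpen hΩ.convex hΩ.isBounded hΩ.nonempty hwc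
    (fun x _ => pow_nonneg (excess_nonneg _ _) _)
    (fun x hx => (le_abs_self _).trans (hW x (subset_closure hx))) hDint hs hs1
  rw [finrank_euclideanSpace_fin, setIntegral_congr_fun hΩ.isOpen.measurableSet hsq] at hnash
  have hpow : ∀ x, (excess r₀ (m t x) ^ (l + 2)) ^ 2 = excess r₀ (m t x) ^ (2 * l + 4) :=
    fun x => by ring
  simp only [hpow] at hnash
  -- the lower order term
  have hlow : ∫ x in Ω, m t x ^ 2 * ((l + 2) ^ 2 * excess r₀ (m t x) ^ (2 * l + 2))
      ≤ (l + 2) ^ 2 * (2 + 2 * r₀ ^ 2) * ((∫ x in Ω, excess r₀ (m t x) ^ (2 * l + 4))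
        + volume.real Ω) := by
    have h6 : (∫ x in Ω, excess r₀ (m t x) ^ (2 * l + 4)) + volume.real Ω
        = ∫ x in Ω, (excess r₀ (m t x) ^ (2 * l + 4) + 1) := by
      rw [integral_add (hint _) (integrableOn_const hΩ.isBounded.measure_lt_top.ne),
        setIntegral_const, smul_eq_mul, mul_one]
    rw [h6, ← integral_const_mul]
    refine setIntegral_mono_on ?_ (((hint _).add
      (integrableOn_const hΩ.isBounded.measure_lt_top.ne)).const_mul _) hΩ.isOpen.measurableSet ?_
    · exact S.integrableOn_comp hΩ
        (g := fun s => s ^ 2 * ((l + 2) ^ 2 * excess r₀ s ^ (2 * l + 2)))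
        (fun s _ => ((continuous_id.pow 2).mul (continuous_const.mul
          ((continuous_excess r₀).pow _))).continuousAt) hT htI
    · intro x hx
      have hm0 := S.nonneg hT htI (subset_closure hx)
      have h7 := le_add_excess r₀ (m t x)
      have h8 := excess_nonneg r₀ (m t x)
      set n := excess r₀ (m t x)
      have h9 : m t x ^ 2 ≤ 2 * n ^ 2 + 2 * r₀ ^ 2 := by
        have : m t x ^ 2 ≤ (r₀ + n) ^ 2 := pow_le_pow_left₀ hm0 h7 2
        nlinarith [sq_nonneg (r₀ - n)]
      have h10 : n ^ (2 * l + 2) ≤ n ^ (2 * l + 4) + 1 := by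
        rcases le_total n 1 with h | h
        · have := pow_le_one₀ h8 h (n := 2 * l + 2)
          have := pow_nonneg h8 (2 * l + 4)
          linarith
        · have := pow_le_pow_right₀ h (by omega : 2 * l + 2 ≤ 2 * l + 4)
          linarith
      have h11 : m t x ^ 2 * n ^ (2 * l + 2) ≤ (2 + 2 * r₀ ^ 2) * (n ^ (2 * l + 4) + 1) := by
        have h12 := mul_le_mul_of_nonneg_right h9 (pow_nonneg h8 (2 * l + 2))
        have h13 := mul_le_mul_of_nonneg_left h10 (by positivity : 0 ≤ 2 * r₀ ^ 2)
        have h14 : (2 * n ^ 2 + 2 * r₀ ^ 2) * n ^ (2 * l + 2)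
          = 2 * n ^ (2 * l + 4) + 2 * r₀ ^ 2 * n ^ (2 * l + 2) := by ring
        linarith
      have h15 := mul_le_mul_of_nonneg_left h11 (by positivity : (0 : ℝ) ≤ (l + 2) ^ 2)
      linarith
  set J := ∫ x in Ω, (l + 2) ^ 2 * excess r₀ (m t x) ^ (2 * l + 2) * ‖fderiv ℝ (m t) x‖ ^ 2 with hJ
  have hJ0 : 0 ≤ J := integral_nonneg fun x =>
    mul_nonneg (mul_nonneg (sq_nonneg _) (pow_nonneg (excess_nonneg _ _) _)) (sq_nonneg _)
  set M := ∫ x in Ω, excess r₀ (m t x) ^ (2 * l + 4) with hM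
  set X := 2 * (s ^ d)⁻¹ * (volume.real Ω)⁻¹ * (∫ x in Ω, excess r₀ (m t x) ^ (l + 2)) ^ 2
    with hX
  set Q := ∫ x in Ω, m t x ^ 2 * ((l + 2) ^ 2 * excess r₀ (m t x) ^ (2 * l + 2)) with hQ
  have hM0 : 0 ≤ M := integral_nonneg fun x => pow_nonneg (excess_nonneg _ _) _
  have e1 : c₀ * α / (2 ^ d * diam Ω ^ 2) / s ^ 2 * (M - X) ≤ c₀ * α * J := by
    have h6 : M - X ≤ 2 ^ d * s ^ 2 * diam Ω ^ 2 * J := by linarith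
    calc c₀ * α / (2 ^ d * diam Ω ^ 2) / s ^ 2 * (M - X)
        ≤ c₀ * α / (2 ^ d * diam Ω ^ 2) / s ^ 2 * (2 ^ d * s ^ 2 * diam Ω ^ 2 * J) := by gcongr
      _ = c₀ * α * J := by field_simp
  have e2 : c₀ * α * J ≤ κ * (c₀ * α / 2 * J) := by
    have : 2 * (c₀ * α / 2 * J) ≤ κ * (c₀ * α / 2 * J) := by gcongr
    linarith
  have e3 : κ * (β * Λ ^ 2 / (2 * c₀) * Q)
      ≤ 4 * (β * Λ ^ 2 / (2 * c₀) * ((l + 2) ^ 2 * (2 + 2 * r₀ ^ 2) * (M + volume.real Ω))) := by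
    have hQ0 : 0 ≤ Q := integral_nonneg fun x =>
      mul_nonneg (sq_nonneg _) (mul_nonneg (sq_nonneg _) (pow_nonneg (excess_nonneg _ _) _))
    gcongr
  have e4 : 4 * (β * Λ ^ 2 / (2 * c₀) * ((l + 2) ^ 2 * (2 + 2 * r₀ ^ 2) * (M + volume.real Ω)))
      = β * Λ ^ 2 / c₀ * (4 + 4 * r₀ ^ 2) * (l + 2 : ℕ) ^ 2 * (M + volume.real Ω) := by
    push_cast
    field_simp
  have e5 := mul_le_mul_of_nonneg_left h3 (by linarith : 0 ≤ κ)
  linarith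

/-- The second moment of the excess is controlled by the fourth one. -/
theorem moment_two_pow_le (hΩ : IsSmoothConvexDomain Ω) (hH : IsUniformlyConvexHamiltonian α β H)
    (hT : 0 < T) (hr₀ : 0 < r₀) (hm₀ : IsProbabilityDensity Ω m₀) {t : ℝ} (ht : t ∈ Icc 0 T) :
    (∫ x in Ω, excess r₀ (m t x) ^ 2) ^ 3 ≤ ∫ x in Ω, excess r₀ (m t x) ^ 4 := by
  have hint : ∀ N : ℕ, IntegrableOn (fun x => excess r₀ (m t x) ^ N) Ω := fun N =>
    S.integrableOn_comp hΩ (g := fun s => excess r₀ s ^ N)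
      (fun s _ => ((continuous_excess r₀).pow N).continuousAt) hT ht
  have hint1 : IntegrableOn (fun x => excess r₀ (m t x)) Ω := by simpa using hint 1
  set c := ∫ x in Ω, excess r₀ (m t x) ^ 2 with hc
  have hc0 : 0 ≤ c := integral_nonneg fun x => sq_nonneg _
  have h1 : ∫ x in Ω, excess r₀ (m t x) ≤ 1 := by
    rw [← S.integral_eq_one hΩ hH hT hm₀ ht]
    exact setIntegral_mono_on hint1
      (S.integrableOn_comp hΩ (g := fun s => s) (fun s _ => continuousAt_id) hT ht)
      hΩ.isOpen.measurableSet fun x hx => excess_le hr₀.le (S.nonneg hT ht (subset_closure hx))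
  -- The polynomial `n⁴ - 3 c² n² + 2 c³ n` equals `n (n - c)² (n + 2 c)`. As `∫ n² = c` and `∫ n ≤
  -- 1`, integrating it gives the interpolation inequality without Hölder.
  have h2 : 0 ≤ ∫ x in Ω, (excess r₀ (m t x) ^ 4 - 3 * c ^ 2 * excess r₀ (m t x) ^ 2
      + 2 * c ^ 3 * excess r₀ (m t x)) := by
    refine integral_nonneg fun x => ?_
    have h0 := excess_nonneg r₀ (m t x)
    have : excess r₀ (m t x) ^ 4 - 3 * c ^ 2 * excess r₀ (m t x) ^ 2
        + 2 * c ^ 3 * excess r₀ (m t x)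
        = excess r₀ (m t x) * (excess r₀ (m t x) - c) ^ 2 * (excess r₀ (m t x) + 2 * c) := by ring
    simp only [Pi.zero_apply, this]
    positivity
  have i4 : IntegrableOn (fun x => excess r₀ (m t x) ^ 4 - 3 * c ^ 2 * excess r₀ (m t x) ^ 2) Ω :=
    (hint 4).sub ((hint 2).const_mul _)
  rw [integral_add i4 (hint1.const_mul _),
    integral_sub (hint 4) ((hint 2).const_mul _), integral_const_mul, integral_const_mul,
    ← hc] at h2
  have h3 : 2 * c ^ 3 * ∫ x in Ω, excess r₀ (m t x) ≤ 2 * c ^ 3 * 1 := by gcongr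
  linarith

/-- Weighted uniform bound on the density. -/
theorem weighted_excess_le (hd : 1 ≤ d) (hΩ : IsSmoothConvexDomain Ω)
    (hH : IsUniformlyConvexHamiltonian α β H) (hT : 0 < T) (hα : 0 < α) (hβ : 0 < β)
    (hc₀ : 0 < c₀) (hr₀ : 0 < r₀) (hε : 0 ≤ ε) (hV : LipschitzOnWith Λ V Ω)
    (hf : IsCoerciveCoupling c₀ r₀ f) (hm₀ : IsProbabilityDensity Ω m₀) {L : ℝ} (hL : 0 ≤ L)
    {ζ ζ₁ ζ₂ : ℝ → ℝ} (hζ : IsTimeWeight T L ζ ζ₁ ζ₂) {σ : ℝ} (hσ : 0 < σ) (hσ1 : σ ≤ 1 / 2)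
    (hσ2 : 2 * (2 * L ^ 2 + L + β * Λ ^ 2 / c₀ * (4 + 4 * r₀ ^ 2))
      ≤ c₀ * α / (2 ^ d * diam Ω ^ 2) / σ ^ 2) {b : ℝ} (hb : 1 ≤ b)
    (h0 : ∀ j : ℕ, ζ 0 ^ (4 * 2 ^ j * d - d) * (∫ x in Ω, excess r₀ (m 0 x) ^ (4 * 2 ^ j))
      ≤ b ^ 2 ^ j)
    (h1 : ∀ j : ℕ, ζ T ^ (4 * 2 ^ j * d - d) * (∫ x in Ω, excess r₀ (m T x) ^ (4 * 2 ^ j))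
      ≤ b ^ 2 ^ j) {t : ℝ} (ht : t ∈ Icc 0 T) {x : EuclideanSpace ℝ (Fin d)} (hx : x ∈ Ω) :
    (ζ t ^ d * excess r₀ (m t x)) ^ 4 ≤ momentConst d σ (volume.real Ω) b := by
  have hvol : 0 < volume.real Ω := hΩ.volume_pos
  have hdiam : 0 < diam Ω := hΩ.diam_pos hd
  have hP : 0 < momentConst d σ (volume.real Ω) b := by
    unfold momentConst; positivity
  have hmom := hζ.moment_le hT hL (M := fun i t => ∫ x in Ω, excess r₀ (m t x) ^ i)
    (fun i => S.continuousOn_integral_comp hΩ (g := fun s => excess r₀ s ^ i)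
      (fun s _ => ((continuous_excess r₀).pow i).continuousAt) hT)
    (fun i t _ => integral_nonneg fun x => pow_nonneg (excess_nonneg _ _) _)
    (fun t ht => S.moment_two_pow_le hΩ hH hT hr₀ hm₀ ht)
    (by positivity : 0 < c₀ * α / (2 ^ d * diam Ω ^ 2))
    (by positivity : 0 ≤ β * Λ ^ 2 / c₀ * (4 + 4 * r₀ ^ 2)) hvol hd
    (fun k hk => S.exists_moment_deriv2 hd hΩ hH hT hα hβ hc₀ hr₀ hε hV hf hk) hσ hσ1 hσ2 hb h0 h1
  have hwc : ContinuousOn (fun x => (ζ t ^ d * excess r₀ (m t x)) ^ 4) (closure Ω) :=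
    (continuousOn_const.mul ((continuous_excess r₀).comp_continuousOn
      (S.continuousOn_slice ht))).pow 4
  refine pow_le_of_forall_integral_pow_le (μ := volume) hΩ.isOpen
    hΩ.isBounded.measure_lt_top.ne (hwc.mono subset_closure) (fun x _ => by positivity)
    (fun i => ContinuousOn.integrableOn_of_closure hΩ.isBounded (hwc.pow i)) hP (fun j => ?_) x hx
  refine le_of_eq_of_le ?_ (hmom j t ht)
  rw [← integral_const_mul]
  refine integral_congr_ae (Eventually.of_forall fun x => ?_)
  simp only
  rw [← pow_mul, mul_pow, ← pow_mul]
  congr 2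
  ring

end IsClassicalPlanningSolution

end Moments

end

noncomputable section

open Filter Topology Metric

set_option linter.unusedSectionVars false

/-! ### Comparison of the flattened energy with the power `θ + 1` -/

section PowerEnergy

variable {r θ s : ℝ}

theorem rpow_le_expTail (hr : 0 < r) (hθ : 0 < θ) (hs : 0 ≤ s) :
    s ^ (θ + 1) ≤ r ^ θ * (2 * (s * expTail (logExcess r θ s)) + 20 * s) := by
  rcases eq_or_lt_of_le hs with rfl | hs
  · rw [Real.zero_rpow (by positivity)]; simp
  rw [Real.rpow_add_one hs.ne']
  have h1 : s ^ θ ≤ r ^ θ * Real.exp (logExcess r θ s) := by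
    rw [exp_logExcess hr hs]
    have h2 : s ^ θ = r ^ θ * (s / r) ^ θ := by
      rw [← Real.mul_rpow hr.le (by positivity), mul_div_cancel₀ _ hr.ne']
    rw [h2]
    gcongr
    exact le_max_left _ _
  have h3 := exp_le_expTail (logExcess_nonneg r θ s)
  calc s ^ θ * s ≤ r ^ θ * (2 * expTail (logExcess r θ s) + 20) * s := by
        gcongr
        exact h1.trans (by gcongr)
    _ = _ := by ring

theorem expTail_le_rpow (hr : 0 < r) (hθ : 0 < θ) (hs : 0 ≤ s) :
    s * expTail (logExcess r θ s) ≤ (r ^ θ)⁻¹ * s ^ (θ + 1) + s := by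
  rcases eq_or_lt_of_le hs with rfl | hs
  · rw [Real.zero_rpow (by positivity)]; simp
  have h1 : expTail (logExcess r θ s) ≤ (r ^ θ)⁻¹ * s ^ θ + 1 := by
    refine (expTail_le (logExcess_nonneg r θ s)).trans ?_
    rw [exp_logExcess hr hs, Real.div_rpow hs.le hr.le, div_eq_inv_mul]
    exact max_le (by linarith) (by linarith [(by positivity : 0 ≤ (r ^ θ)⁻¹ * s ^ θ)])
  calc s * expTail (logExcess r θ s) ≤ s * ((r ^ θ)⁻¹ * s ^ θ + 1) := by gcongr
    _ = _ := by rw [Real.rpow_add_one hs.ne']; ring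

theorem sq_mul_deriv2_le (hθ : 0 < θ) (hs : 0 < s) :
    s ^ 2 * ((θ * (Real.exp (logExcess r θ s) - 1 - logExcess r θ s)
        + θ ^ 2 * (Real.exp (logExcess r θ s) - 1)) / s)
      ≤ (θ + θ ^ 2) * (2 * (s * expTail (logExcess r θ s)) + 20 * s) := by
  have h1 := exp_le_expTail (logExcess_nonneg r θ s)
  have h2 := logExcess_nonneg r θ s
  have e : s ^ 2 * ((θ * (Real.exp (logExcess r θ s) - 1 - logExcess r θ s)
        + θ ^ 2 * (Real.exp (logExcess r θ s) - 1)) / s)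
      = s * (θ * (Real.exp (logExcess r θ s) - 1 - logExcess r θ s)
        + θ ^ 2 * (Real.exp (logExcess r θ s) - 1)) := by field_simp
  rw [e]
  calc s * (θ * (Real.exp (logExcess r θ s) - 1 - logExcess r θ s)
        + θ ^ 2 * (Real.exp (logExcess r θ s) - 1))
      ≤ s * (θ * (2 * expTail (logExcess r θ s) + 20)
        + θ ^ 2 * (2 * expTail (logExcess r θ s) + 20)) := by
        gcongr <;> linarith
    _ = _ := by ring

/-- The density may vanish at the end times, so continuity at `s = 0` is needed. Near `0`, on both
sides, the function is identically zero, since `Real.log` depends only on the absolute value. -/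
theorem continuousAt_mul_expTail (hr : 0 < r) (hθ : 0 < θ) (hs : 0 ≤ s) :
    ContinuousAt (fun s => s * expTail (logExcess r θ s)) s := by
  rcases eq_or_lt_of_le hs with rfl | hs
  · refine (continuousAt_const (y := (0 : ℝ))).congr ?_
    filter_upwards [Ioo_mem_nhds (neg_lt_zero.2 hr) hr] with y hy
    rcases eq_or_ne y 0 with rfl | h0
    · simp
    · have h1 : logExcess r θ y = 0 := by
        refine max_eq_right (mul_nonpos_of_nonneg_of_nonpos hθ.le (sub_nonpos.2 ?_))
        rw [← Real.log_abs]
        exact Real.log_le_log (abs_pos.2 h0) (abs_lt.2 hy).le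
      simp [h1, expTail]
  · exact ((isEnergy_expTail (r := r) hθ).hasDerivAt s hs).continuousAt

theorem logExcess_mono {s' : ℝ} (hθ : 0 < θ) (hs : 0 < s) (h : s ≤ s') :
    logExcess r θ s ≤ logExcess r θ s' := by
  unfold logExcess
  have := Real.log_le_log hs h
  gcongr

end PowerEnergy

/-! ### Uniform bounds and propagation of integral norms -/

section Bounds

theorem exists_scale {c : ℝ} (hc : 0 < c) (A : ℝ) :
    ∃ σ : ℝ, 0 < σ ∧ σ ≤ 1 / 2 ∧ A ≤ c / σ ^ 2 := by
  have h0 : 0 < c / (|A| + 1) := by positivity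
  refine ⟨min (1 / 2) √(c / (|A| + 1)), by positivity, min_le_left _ _, ?_⟩
  have h1 : min (1 / 2) √(c / (|A| + 1)) ^ 2 ≤ c / (|A| + 1) := by
    refine (pow_le_pow_left₀ (by positivity) (min_le_right _ _) 2).trans_eq ?_
    exact Real.sq_sqrt h0.le
  rw [le_div_iff₀ (by positivity)]
  calc A * min (1 / 2) √(c / (|A| + 1)) ^ 2
      ≤ (|A| + 1) * min (1 / 2) √(c / (|A| + 1)) ^ 2 := by
        gcongr; linarith [le_abs_self A]
    _ ≤ (|A| + 1) * (c / (|A| + 1)) := by gcongr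
    _ = c := by field_simp

theorem le_max_of_pow_four_le {y P : ℝ} (h : y ^ 4 ≤ P) : y ≤ max 1 P := by
  rcases le_total y 1 with h1 | h1
  · exact h1.trans (le_max_left _ _)
  · exact ((le_self_pow₀ h1 (by norm_num)).trans h).trans (le_max_right _ _)

namespace IsClassicalPlanningSolution

variable {d : ℕ} {Ω : Set (EuclideanSpace ℝ (Fin d))} {T ε : ℝ}
  {H V m₀ m₁ : EuclideanSpace ℝ (Fin d) → ℝ} {f : ℝ → ℝ}
  {u m : ℝ → EuclideanSpace ℝ (Fin d) → ℝ} {α β c₀ r₀ : ℝ} {Λ : ℝ≥0}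
  (S : IsClassicalPlanningSolution Ω T ε H f V m₀ m₁ u m) (hd : 1 ≤ d)
  (hΩ : IsSmoothConvexDomain Ω)
  (hH : IsUniformlyConvexHamiltonian α β H) (hT : 0 < T) (hα : 0 < α) (hβ : 0 < β)
  (hc₀ : 0 < c₀) (hr₀ : 0 < r₀) (hε : 0 ≤ ε) (hV : LipschitzOnWith Λ V Ω)
  (hf : IsCoerciveCoupling c₀ r₀ f) (hm₀ : IsProbabilityDensity Ω m₀)
include S hd hΩ hH hT hα hβ hc₀ hr₀ hε hV hf hm₀

/-- Interior uniform bound, independent of the initial and final densities. -/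
theorem le_interior {σ : ℝ} (hσ : 0 < σ) (hσ1 : σ ≤ 1 / 2)
    (hσ2 : 2 * (2 * (1 / T + 2 / T ^ 2) ^ 2 + (1 / T + 2 / T ^ 2)
      + β * Λ ^ 2 / c₀ * (4 + 4 * r₀ ^ 2)) ≤ c₀ * α / (2 ^ d * diam Ω ^ 2) / σ ^ 2)
    {t : ℝ} (ht : t ∈ Ioo 0 T) {x : EuclideanSpace ℝ (Fin d)} (hx : x ∈ Ω) :
    m t x ≤ r₀ + max 1 (momentConst d σ (volume.real Ω) 1) * ((t * (T - t) / T ^ 2) ^ d)⁻¹ := by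
  -- The parabola vanishes at both ends and the exponent is positive because `d ≥ 1`, so the end
  -- data drop out and `b = 1` is admissible.
  have hvan : ∀ j : ℕ, (0 : ℝ) ^ (4 * 2 ^ j * d - d) = 0 := fun j => by
    refine zero_pow ?_
    have h1 : 1 ≤ 2 ^ j := Nat.one_le_two_pow
    have h2 : d ≤ 2 ^ j * d := Nat.le_mul_of_pos_left d h1
    have : 4 * 2 ^ j * d = 4 * (2 ^ j * d) := by ring
    omega
  have h := S.weighted_excess_le hd hΩ hH hT hα hβ hc₀ hr₀ hε hV hf hm₀
    (by positivity : 0 ≤ 1 / T + 2 / T ^ 2) (isTimeWeight_parabola hT) hσ hσ1 hσ2 le_rfl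
    (fun j => by simp [hvan]) (fun j => by simp [hvan]) (Ioo_subset_Icc_self ht) hx
  have h1 := le_max_of_pow_four_le h
  have hz : 0 < (t * (T - t) / T ^ 2) ^ d := pow_pos ((isTimeWeight_parabola hT).pos t ht) d
  have h2 : excess r₀ (m t x)
      ≤ max 1 (momentConst d σ (volume.real Ω) 1) * ((t * (T - t) / T ^ 2) ^ d)⁻¹ := by
    rw [← div_eq_mul_inv, le_div_iff₀ hz, mul_comm]
    exact h1
  linarith [le_add_excess r₀ (m t x)]

/-- Uniform bound up to the initial and final times. -/
theorem le_of_endpoints {σ : ℝ} (hσ : 0 < σ) (hσ1 : σ ≤ 1 / 2)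
    (hσ2 : 2 * (β * Λ ^ 2 / c₀ * (4 + 4 * r₀ ^ 2)) ≤ c₀ * α / (2 ^ d * diam Ω ^ 2) / σ ^ 2)
    {N : ℝ} (hN : 1 ≤ N) (h0 : ∀ᵐ x ∂volume.restrict Ω, m 0 x ≤ N)
    (h1 : ∀ᵐ x ∂volume.restrict Ω, m T x ≤ N) {t : ℝ} (ht : t ∈ Icc 0 T)
    {x : EuclideanSpace ℝ (Fin d)} (hx : x ∈ Ω) :
    m t x ≤ (r₀ + max 1 (momentConst d σ (volume.real Ω) (1 + volume.real Ω))) * N := by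
  have hv := hΩ.volume_pos
  have hend : ∀ τ ∈ Icc 0 T, (∀ᵐ x ∂volume.restrict Ω, m τ x ≤ N) → ∀ j : ℕ,
      (1 : ℝ) ^ (4 * 2 ^ j * d - d) * (∫ x in Ω, excess r₀ (m τ x) ^ (4 * 2 ^ j))
        ≤ ((1 + volume.real Ω) * N ^ 4) ^ 2 ^ j := by
    intro τ hτ hN' j
    rw [one_pow, one_mul, mul_pow, ← pow_mul]
    have h2 : ∫ x in Ω, excess r₀ (m τ x) ^ (4 * 2 ^ j) ≤ ∫ _ in Ω, N ^ (4 * 2 ^ j) := by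
      refine integral_mono_ae (S.integrableOn_comp hΩ
        (g := fun s => excess r₀ s ^ (4 * 2 ^ j))
        (fun s _ => ((continuous_excess r₀).pow _).continuousAt) hT hτ)
        (integrableOn_const hΩ.isBounded.measure_lt_top.ne) ?_
      filter_upwards [hN', ae_restrict_mem hΩ.isOpen.measurableSet] with y hy hyΩ
      exact pow_le_pow_left₀ (excess_nonneg _ _)
        ((excess_le hr₀.le (S.nonneg hT hτ (subset_closure hyΩ))).trans hy) _
    rw [setIntegral_const, smul_eq_mul] at h2
    refine h2.trans ?_
    gcongr
    exact le_trans (by linarith) (le_self_pow₀ (by linarith : 1 ≤ 1 + volume.real Ω)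
      (by positivity))
  have hN4 : 1 ≤ N ^ 4 := one_le_pow₀ hN
  have h := S.weighted_excess_le hd hΩ hH hT hα hβ hc₀ hr₀ hε hV hf hm₀ le_rfl
    (isTimeWeight_one le_rfl) hσ hσ1 (by simpa using hσ2)
    (one_le_mul_of_one_le_of_one_le (by linarith : 1 ≤ 1 + volume.real Ω) hN4)
    (hend 0 (left_mem_Icc.2 hT.le) h0) (hend T (right_mem_Icc.2 hT.le) h1) ht hx
  rw [one_pow, one_mul] at h
  -- `momentConst` is affine in its last argument with nonnegative coefficients; as `N ^ 4 ≥ 1`, the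
  -- factor comes out and the final bound is linear in `N`.
  have h3 : momentConst d σ (volume.real Ω) ((1 + volume.real Ω) * N ^ 4)
      ≤ momentConst d σ (volume.real Ω) (1 + volume.real Ω) * N ^ 4 := by
    unfold momentConst
    have e : ∀ a b c : ℝ, (a + b) * c * N ^ 4 = (a * N ^ 4 + b * N ^ 4) * c := fun a b c => by ring
    rw [e]
    gcongr
    exact le_mul_of_one_le_right (by positivity) hN4
  have h4 : (excess r₀ (m t x) / N) ^ 4
      ≤ momentConst d σ (volume.real Ω) (1 + volume.real Ω) := by
    rw [div_pow, div_le_iff₀ (by positivity)]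
    exact h.trans h3
  have h5 := le_max_of_pow_four_le h4
  rw [div_le_iff₀ (by positivity)] at h5
  have h6 : r₀ ≤ r₀ * N := le_mul_of_one_le_right hr₀.le hN
  linarith [le_add_excess r₀ (m t x)]

omit hd in
/-- Propagation of Lebesgue norms, given a uniform bound away from the initial and final times. -/
theorem integral_rpow_le {θ C M : ℝ} (hθ : 0 < θ) (hC : β * Λ ^ 2 / c₀ * (θ + θ ^ 2) ≤ C)
    (hC0 : 0 < C)
    (hM : ∀ t ∈ Ioo 0 T, 3 ≤ 2 * C * (t * (T - t)) → ∀ x ∈ Ω, m t x ≤ M)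
    {t : ℝ} (ht : t ∈ Icc 0 T) :
    ∫ x in Ω, m t x ^ (θ + 1) ≤ 2 * r₀ ^ θ * (1 + 2 * C * T ^ 2)
      * ((r₀ ^ θ)⁻¹ + 12 + Real.exp (logExcess r₀ θ M))
      * ((∫ x in Ω, m 0 x ^ (θ + 1)) + (∫ x in Ω, m T x ^ (θ + 1)) + 1) := by
  set φ : ℝ → ℝ := fun t => ∫ x in Ω, m t x * expTail (logExcess r₀ θ (m t x)) with hφdef
  obtain ⟨φ₁, φ₂, hφ⟩ := S.le_energy_deriv2 hΩ hH hα hβ hc₀ hε hV hf (isEnergy_expTail (r := r₀) hθ)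
  have h0I : (0 : ℝ) ∈ Icc 0 T := left_mem_Icc.2 hT.le
  have h1I : T ∈ Icc 0 T := right_mem_Icc.2 hT.le
  have ie : ∀ t ∈ Icc 0 T, IntegrableOn (fun x => m t x * expTail (logExcess r₀ θ (m t x))) Ω :=
    fun t ht => S.integrableOn_comp hΩ (g := fun s => s * expTail (logExcess r₀ θ s))
      (fun s hs => continuousAt_mul_expTail hr₀ hθ hs) hT ht
  have im : ∀ t ∈ Icc 0 T, IntegrableOn (fun x => m t x) Ω := fun t ht =>
    S.integrableOn_comp hΩ (g := fun s => s) (fun s _ => continuousAt_id) hT ht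
  have ip : ∀ t ∈ Icc 0 T, IntegrableOn (fun x => m t x ^ (θ + 1)) Ω := fun t ht =>
    S.integrableOn_comp hΩ (g := fun s => s ^ (θ + 1))
      (fun s _ => Real.continuousAt_rpow_const _ _ (Or.inr (by linarith))) hT ht
  have hmass : ∀ t ∈ Icc 0 T, ∫ x in Ω, m t x = 1 := fun t ht =>
    S.integral_eq_one hΩ hH hT hm₀ ht
  have hφ0 : ∀ t ∈ Icc 0 T, 0 ≤ φ t := fun t ht =>
    setIntegral_nonneg hΩ.isOpen.measurableSet fun x hx =>
      mul_nonneg (S.nonneg hT ht (subset_closure hx)) (expTail_nonneg (logExcess_nonneg _ _ _))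
  have hX0 : ∀ t ∈ Icc 0 T, 0 ≤ ∫ x in Ω, m t x ^ (θ + 1) := fun t ht =>
    setIntegral_nonneg hΩ.isOpen.measurableSet fun x hx =>
      Real.rpow_nonneg (S.nonneg hT ht (subset_closure hx)) _
  -- comparison of the energy with the power
  have hup : ∀ t ∈ Icc 0 T, φ t ≤ (r₀ ^ θ)⁻¹ * (∫ x in Ω, m t x ^ (θ + 1)) + 1 := by
    intro t ht
    have e : (r₀ ^ θ)⁻¹ * (∫ x in Ω, m t x ^ (θ + 1)) + 1
        = ∫ x in Ω, ((r₀ ^ θ)⁻¹ * m t x ^ (θ + 1) + m t x) := by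
      rw [integral_add ((ip t ht).const_mul _) (im t ht), integral_const_mul, hmass t ht]
    rw [e]
    exact setIntegral_mono_on (ie t ht) (((ip t ht).const_mul _).add (im t ht))
      hΩ.isOpen.measurableSet fun x hx =>
        expTail_le_rpow hr₀ hθ (S.nonneg hT ht (subset_closure hx))
  have hsum : ∀ t ∈ Icc 0 T, ∀ c : ℝ, ∫ x in Ω, c * (2 * (m t x * expTail (logExcess r₀ θ (m t x)))
      + 20 * m t x) = c * (2 * φ t + 20) := by
    intro t ht c
    rw [integral_const_mul, integral_add ((ie t ht).const_mul _) ((im t ht).const_mul _),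
      integral_const_mul, integral_const_mul, hmass t ht, mul_one]
  have isum : ∀ t ∈ Icc 0 T, ∀ c : ℝ, IntegrableOn (fun x =>
      c * (2 * (m t x * expTail (logExcess r₀ θ (m t x))) + 20 * m t x)) Ω := fun t ht c =>
    (((ie t ht).const_mul _).add ((im t ht).const_mul _)).const_mul _
  have hdown : ∀ t ∈ Icc 0 T, ∫ x in Ω, m t x ^ (θ + 1) ≤ r₀ ^ θ * (2 * φ t + 20) := by
    intro t ht
    rw [← hsum t ht]
    exact setIntegral_mono_on (ip t ht) (isum t ht _)
      hΩ.isOpen.measurableSet fun x hx =>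
        rpow_le_expTail hr₀ hθ (S.nonneg hT ht (subset_closure hx))
  -- the differential inequality
  have hode : ∀ t ∈ Ioo 0 T, -(C * (φ t + 10)) ≤ φ₂ t := by
    intro t ht
    have htI := Ioo_subset_Icc_self ht
    have hE := isEnergy_expTail (r := r₀) hθ
    have h3 := (hφ t ht).2.2
    have h4 : 0 ≤ ∫ x in Ω, (θ * (Real.exp (logExcess r₀ θ (m t x)) - 1 - logExcess r₀ θ (m t x))
        + θ ^ 2 * (Real.exp (logExcess r₀ θ (m t x)) - 1)) / m t x * ‖fderiv ℝ (m t) x‖ ^ 2 :=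
      setIntegral_nonneg hΩ.isOpen.measurableSet fun x hx =>
        mul_nonneg (hE.nonneg _ (S.pos_m t ht x (subset_closure hx))) (sq_nonneg _)
    have hpos : MapsTo (m t) (closure Ω) (Ioi 0) := fun x hx => S.pos_m t ht x hx
    have h5 : ∫ x in Ω, m t x ^ 2 * ((θ * (Real.exp (logExcess r₀ θ (m t x)) - 1
        - logExcess r₀ θ (m t x)) + θ ^ 2 * (Real.exp (logExcess r₀ θ (m t x)) - 1)) / m t x)
        ≤ (θ + θ ^ 2) * (2 * φ t + 20) := by
      rw [← hsum t htI]
      refine setIntegral_mono_on ?_ (isum t htI _) hΩ.isOpen.measurableSet fun x hx =>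
        sq_mul_deriv2_le hθ (S.pos_m t ht x (subset_closure hx))
      refine ContinuousOn.integrableOn_of_closure hΩ.isBounded ?_
      exact ((S.continuousOn_slice htI).pow 2).mul
        (hE.continuousOn.comp (S.continuousOn_slice htI) hpos)
    have h6 := mul_le_mul_of_nonneg_left h5 (by positivity : 0 ≤ β * (Λ : ℝ) ^ 2 / (2 * c₀))
    have h7 : β * (Λ : ℝ) ^ 2 / (2 * c₀) * ((θ + θ ^ 2) * (2 * φ t + 20))
        = β * Λ ^ 2 / c₀ * (θ + θ ^ 2) * (φ t + 10) := by field_simp; ring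
    have h8 : β * Λ ^ 2 / c₀ * (θ + θ ^ 2) * (φ t + 10) ≤ C * (φ t + 10) := by
      have := hφ0 t htI
      gcongr
    have h9 := mul_nonneg (by positivity : 0 ≤ c₀ * α / 2) h4
    linarith
  -- the maximum principle
  set w : ℝ → ℝ := fun t => 1 + 2 * C * (t * (T - t)) with hw
  have hw1 : ∀ t ∈ Icc 0 T, 1 ≤ w t := fun t ht => by
    have := mul_nonneg ht.1 (sub_nonneg.2 ht.2)
    have : 0 ≤ 2 * C * (t * (T - t)) := by positivity
    rw [hw]; simp only; linarith
  have hwd : ∀ t, HasDerivAt w (2 * C * (T - 2 * t)) t := fun t => by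
    refine ((((hasDerivAt_id' t).fun_mul ((hasDerivAt_id' t).const_sub T)).const_mul
      (2 * C)).const_add 1).congr_deriv ?_
    ring
  have hwd' : ∀ t, HasDerivAt (fun t => 2 * C * (T - 2 * t)) (-(4 * C)) t := fun t => by
    refine ((((hasDerivAt_id' t).const_mul 2).const_sub T).const_mul (2 * C)).congr_deriv ?_
    ring
  set Y := φ 0 + φ T + 10 + Real.exp (logExcess r₀ θ M) with hY
  have hexp0 := Real.exp_pos (logExcess r₀ θ M)
  have hw0 : w 0 = 1 := by simp [hw]
  have hwT : w T = 1 := by simp [hw]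
  have hmax : ∀ t ∈ Icc 0 T, (w t)⁻¹ * (φ t + 10) ≤ Y := by
    refine le_of_weighted_maximum hT (φ := fun t => φ t + 10)
      (ψ₁ := fun t => -(2 * C * (T - 2 * t)) / w t ^ 2)
      (ψ₂ := fun t => 4 * C / w t ^ 2 + 2 * (2 * C * (T - 2 * t)) ^ 2 / w t ^ 3) ?_ ?_ ?_
      (fun t ht => (hφ t ht).1.add_const 10) (fun t ht => (hφ t ht).2.1) ?_ ?_ ?_ ?_
    · have h3 : ContinuousOn φ (Icc 0 T) := S.continuousOn_integral_comp hΩ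
        (g := fun s => s * expTail (logExcess r₀ θ s))
        (fun s hs => continuousAt_mul_expTail hr₀ hθ hs) hT
      have h4 : ContinuousOn w (Icc 0 T) := fun t _ => (hwd t).continuousAt.continuousWithinAt
      exact (h4.inv₀ fun t ht => (zero_lt_one.trans_le (hw1 t ht)).ne').mul (h3.add continuousOn_const)
    · intro t ht
      have hwp := zero_lt_one.trans_le (hw1 t (Ioo_subset_Icc_self ht))
      exact (hwd t).fun_inv hwp.ne'
    · intro t ht
      have hwp := zero_lt_one.trans_le (hw1 t (Ioo_subset_Icc_self ht))
      refine (((hwd' t).fun_neg).fun_div ((hwd t).fun_pow 2) (by positivity)).congr_deriv ?_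
      field_simp
      push_cast
      ring
    · rw [hw0]
      linarith [hφ0 T h1I]
    · rw [hwT]
      linarith [hφ0 0 h0I]
    · intro t ht hle _
      have htI := Ioo_subset_Icc_self ht
      have hwp := zero_lt_one.trans_le (hw1 t htI)
      have hp : 0 < φ t + 10 := by linarith [hφ0 t htI]
      -- For `ψ = 1 / w` the coefficient `2 ψ'² - ψ ψ''` collapses to `w'' / w³`, and here `w'' = -4
      -- C`.
      have e1 : φ₂ t * w t ≤ -(4 * C) * (φ t + 10) := by
        have e2 : (2 * (-(2 * C * (T - 2 * t)) / w t ^ 2) ^ 2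
            - (w t)⁻¹ * (4 * C / w t ^ 2 + 2 * (2 * C * (T - 2 * t)) ^ 2 / w t ^ 3)) * (φ t + 10)
            = (w t ^ 3)⁻¹ * (-(4 * C) * (φ t + 10)) := by
          field_simp
          ring
        have e3 : (w t)⁻¹ ^ 2 * φ₂ t = (w t ^ 3)⁻¹ * (φ₂ t * w t) := by
          field_simp
        rw [e2, e3] at hle
        exact le_of_mul_le_mul_left hle (by positivity)
      have e4 : -(C * (φ t + 10)) * w t ≤ -(4 * C) * (φ t + 10) :=
        (mul_le_mul_of_nonneg_right (hode t ht) hwp.le).trans e1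
      have e5 : (C * (φ t + 10)) * 4 ≤ (C * (φ t + 10)) * w t := by linarith
      -- Against the lower bound `-C (φ + 10)` for `φ₂`, this forces an interior maximum to stay
      -- away from the end times, where `hM` bounds the density.
      have e6 : 4 ≤ w t := le_of_mul_le_mul_left e5 (by positivity)
      have e7 : 3 ≤ 2 * C * (t * (T - t)) := by
        rw [hw] at e6; simp only at e6; linarith
      have e8 : φ t ≤ Real.exp (logExcess r₀ θ M) := by
        have e : Real.exp (logExcess r₀ θ M) = ∫ x in Ω, Real.exp (logExcess r₀ θ M) * m t x := by
          rw [integral_const_mul, hmass t htI, mul_one]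
        rw [e]
        refine setIntegral_mono_on (ie t htI) ((im t htI).const_mul _)
          hΩ.isOpen.measurableSet fun x hx => ?_
        have hmp := S.pos_m t ht x (subset_closure hx)
        rw [mul_comm]
        gcongr
        exact (expTail_le (logExcess_nonneg _ _ _)).trans
          (Real.exp_le_exp.2 (logExcess_mono hθ hmp (hM t ht e7 x hx)))
      have e9 : (w t)⁻¹ * (φ t + 10) ≤ φ t + 10 :=
        mul_le_of_le_one_left hp.le (inv_le_one_of_one_le₀ (hw1 t htI))
      linarith [hφ0 0 h0I, hφ0 T h1I]
    · intro t ht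
      have hwp := zero_lt_one.trans_le (hw1 t (Ioo_subset_Icc_self ht))
      positivity
  have hwp := zero_lt_one.trans_le (hw1 t ht)
  have f1 : φ t + 10 ≤ w t * Y := by
    have := hmax t ht
    rwa [inv_mul_le_iff₀ hwp] at this
  have hY0 : 0 ≤ Y := by linarith [hφ0 0 h0I, hφ0 T h1I]
  have f2 : w t ≤ 1 + 2 * C * T ^ 2 := by
    have : t * (T - t) ≤ T ^ 2 := by nlinarith [ht.1, ht.2]
    rw [hw]; simp only
    gcongr
  set X := (∫ x in Ω, m 0 x ^ (θ + 1)) + (∫ x in Ω, m T x ^ (θ + 1)) with hX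
  have f3 : Y ≤ ((r₀ ^ θ)⁻¹ + 12 + Real.exp (logExcess r₀ θ M)) * (X + 1) := by
    have g1 := hup 0 h0I
    have g2 := hup T h1I
    have hX' : 0 ≤ X := add_nonneg (hX0 0 h0I) (hX0 T h1I)
    have g3 : 0 ≤ (12 + Real.exp (logExcess r₀ θ M)) * X := by positivity
    have g4 : 0 < (r₀ ^ θ)⁻¹ := by positivity
    have g5 : ((r₀ ^ θ)⁻¹ + 12 + Real.exp (logExcess r₀ θ M)) * (X + 1)
        = (r₀ ^ θ)⁻¹ * (∫ x in Ω, m 0 x ^ (θ + 1)) + (r₀ ^ θ)⁻¹ * (∫ x in Ω, m T x ^ (θ + 1))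
          + (12 + Real.exp (logExcess r₀ θ M)) * X + (r₀ ^ θ)⁻¹ + 12
          + Real.exp (logExcess r₀ θ M) := by rw [hX]; ring
    linarith
  calc ∫ x in Ω, m t x ^ (θ + 1) ≤ r₀ ^ θ * (2 * φ t + 20) := hdown t ht
    _ = 2 * r₀ ^ θ * (φ t + 10) := by ring
    _ ≤ 2 * r₀ ^ θ * ((1 + 2 * C * T ^ 2)
        * (((r₀ ^ θ)⁻¹ + 12 + Real.exp (logExcess r₀ θ M)) * (X + 1))) := by
        gcongr
        exact f1.trans (mul_le_mul f2 f3 hY0 (by positivity))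
    _ = _ := by ring

end IsClassicalPlanningSolution

end Bounds

end

noncomputable section

open Filter Topology Metric

set_option linter.unusedSectionVars false

/-! ### From pointwise and integral bounds to Lebesgue norms -/

section Norms

/-- Partial fractions, `T² / (t (T - t)) = T (1 / t + 1 / (T - t))`, separate the singularities at
the two ends. -/
theorem inv_mul_sub_pow_le {T t : ℝ} (hT : 0 < T) (ht : t ∈ Ioo 0 T) (d : ℕ) :
    ((t * (T - t) / T ^ 2) ^ d)⁻¹
      ≤ (2 * T) ^ d * (t ^ (-(d : ℝ)) + (T - t) ^ (-(d : ℝ))) := by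
  have h1 : 0 < t := ht.1
  have h2 : 0 < T - t := sub_pos.2 ht.2
  rw [Real.rpow_neg h1.le, Real.rpow_neg h2.le, Real.rpow_natCast, Real.rpow_natCast, ← inv_pow,
    ← inv_pow, ← inv_pow]
  have e : (t * (T - t) / T ^ 2)⁻¹ = T * (t⁻¹ + (T - t)⁻¹) := by
    field_simp
    ring
  have h3 := add_pow_le (inv_nonneg.2 h1.le) (inv_nonneg.2 h2.le) d
  have h4 : (2 : ℝ) ^ (d - 1) ≤ 2 ^ d := pow_le_pow_right₀ one_le_two (Nat.sub_le _ _)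
  rw [e, mul_pow]
  calc T ^ d * (t⁻¹ + (T - t)⁻¹) ^ d ≤ T ^ d * (2 ^ d * (t⁻¹ ^ d + (T - t)⁻¹ ^ d)) := by
        gcongr
        exact h3.trans (by gcongr)
    _ = _ := by rw [mul_pow]; ring

theorem one_le_mul_rpow_add {T t : ℝ} (hT : 0 < T) (ht : t ∈ Ioo 0 T) (d : ℕ) :
    1 ≤ T ^ d * (t ^ (-(d : ℝ)) + (T - t) ^ (-(d : ℝ))) := by
  have h1 : 0 < t := ht.1
  have h2 : 0 < T - t := sub_pos.2 ht.2
  rw [Real.rpow_neg h1.le, Real.rpow_neg h2.le, Real.rpow_natCast, Real.rpow_natCast]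
  have h3 : T ^ d * (t ^ d)⁻¹ ≥ 1 := by
    rw [← div_eq_mul_inv, ge_iff_le, le_div_iff₀ (by positivity), one_mul]
    exact pow_le_pow_left₀ h1.le ht.2.le d
  have h4 : 0 ≤ T ^ d * ((T - t) ^ d)⁻¹ := by positivity
  rw [mul_add]
  linarith

/-- The factor `|Ω| ^ (1 / p)` is at most `1 + |Ω|` for every `p ≥ 1`, including `p = ⊤`. -/
theorem eLpNorm_restrict_le {E : Type*} [MeasurableSpace E] {μ : Measure E} {Ω : Set E}
    (hΩ : MeasurableSet Ω) (hfin : μ Ω ≠ ⊤) {p : ℝ≥0∞} (hp : 1 ≤ p) {g : E → ℝ} {C : ℝ}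
    (h : ∀ x ∈ Ω, |g x| ≤ C) :
    eLpNorm g p (μ.restrict Ω) ≤ ENNReal.ofReal ((1 + μ.real Ω) * C) := by
  have h1 := eLpNorm_le_of_ae_bound (p := p) ((ae_restrict_iff' hΩ).2
    (Eventually.of_forall h : ∀ᵐ x ∂μ, x ∈ Ω → ‖g x‖ ≤ C))
  refine h1.trans ?_
  rw [ENNReal.ofReal_mul (by positivity), Measure.restrict_apply_univ]
  gcongr
  have hv : ENNReal.ofReal (1 + μ.real Ω) = 1 + μ Ω := by
    rw [ENNReal.ofReal_add zero_le_one measureReal_nonneg, ENNReal.ofReal_one,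
      ofReal_measureReal hfin]
  have hr : p.toReal⁻¹ ≤ 1 := by
    rcases eq_or_ne p ⊤ with rfl | hpt
    · simp
    · exact inv_le_one_of_one_le₀ ((by simpa using ENNReal.toReal_mono hpt hp))
  rw [hv]
  calc μ Ω ^ p.toReal⁻¹ ≤ (1 + μ Ω) ^ p.toReal⁻¹ := by
        gcongr
        exact le_add_self
    _ ≤ (1 + μ Ω) ^ (1 : ℝ) := ENNReal.rpow_le_rpow_of_exponent_le le_self_add hr
    _ = 1 + μ Ω := ENNReal.rpow_one _

/-- As `1 / p ≤ 1`, the `p`-th root is subadditive, and it does not increase a constant `K ≥ 1`. -/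
theorem eLpNorm_le_of_integral_rpow_le {E : Type*} [MeasurableSpace E] {μ : Measure E} {p : ℝ≥0∞}
    (hp : 1 ≤ p) (hpt : p ≠ ⊤) {g a b : E → ℝ} (hg : MemLp g p μ) (ha : MemLp a p μ)
    (hb : MemLp b p μ) {K : ℝ} (hK : 1 ≤ K)
    (h : ∫ x, ‖g x‖ ^ p.toReal ∂μ
      ≤ K * ((∫ x, ‖a x‖ ^ p.toReal ∂μ) + (∫ x, ‖b x‖ ^ p.toReal ∂μ) + 1)) :
    eLpNorm g p μ ≤ ENNReal.ofReal K * (eLpNorm a p μ + eLpNorm b p μ + 1) := by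
  have hp0 : p ≠ 0 := (zero_lt_one.trans_le hp).ne'
  have hP : 1 ≤ p.toReal := (by simpa using ENNReal.toReal_mono hpt hp)
  have hP0 : 0 < p.toReal := by linarith
  rw [hg.eLpNorm_eq_integral_rpow_norm hp0 hpt, ha.eLpNorm_eq_integral_rpow_norm hp0 hpt,
    hb.eLpNorm_eq_integral_rpow_norm hp0 hpt]
  have hnn : ∀ g : E → ℝ, 0 ≤ ∫ x, ‖g x‖ ^ p.toReal ∂μ := fun g =>
    integral_nonneg fun x => Real.rpow_nonneg (norm_nonneg _) _
  set X := ∫ x, ‖a x‖ ^ p.toReal ∂μ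
  set Y := ∫ x, ‖b x‖ ^ p.toReal ∂μ
  set Z := ∫ x, ‖g x‖ ^ p.toReal ∂μ
  have hX : 0 ≤ X := hnn a
  have hY : 0 ≤ Y := hnn b
  have hZ : 0 ≤ Z := hnn g
  have hi0 : 0 ≤ p.toReal⁻¹ := by positivity
  have hi1 : p.toReal⁻¹ ≤ 1 := inv_le_one_of_one_le₀ hP
  rw [← ENNReal.ofReal_one, ← ENNReal.ofReal_add (by positivity) (by positivity),
    ← ENNReal.ofReal_add (by positivity) (by positivity), ← ENNReal.ofReal_mul (by positivity)]
  refine ENNReal.ofReal_le_ofReal ?_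
  calc Z ^ p.toReal⁻¹ ≤ (K * (X + Y + 1)) ^ p.toReal⁻¹ := by gcongr
    _ = K ^ p.toReal⁻¹ * (X + Y + 1) ^ p.toReal⁻¹ := Real.mul_rpow (by linarith) (by positivity)
    _ ≤ K * (X ^ p.toReal⁻¹ + Y ^ p.toReal⁻¹ + 1) := by
      gcongr
      · exact (Real.rpow_le_rpow_of_exponent_le hK hi1).trans_eq (Real.rpow_one K)
      · refine (Real.rpow_add_le_add_rpow (by positivity) zero_le_one hi0 hi1).trans ?_
        rw [Real.one_rpow]
        gcongr
        exact Real.rpow_add_le_add_rpow hX hY hi0 hi1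

end Norms

end

/-! ### The main theorem: choice of the constants -/

theorem mainTheorem3 (d : ℕ) (hd : 1 ≤ d) (p : ℝ≥0∞) (hp : 1 ≤ p) :
    ∃ q : ℝ, 0 < q ∧
      ∀ (c₀ r₀ T α β vol diam : ℝ) (Λ : ℝ≥0), 0 < c₀ → 0 < r₀ → 0 < T → 0 < α → 0 < β →
        ∃ K₀ K₁ : ℝ, 0 < K₀ ∧ 0 < K₁ ∧
          ∀ (Ω : Set (EuclideanSpace ℝ (Fin d))) (H V : EuclideanSpace ℝ (Fin d) → ℝ)
            (f : ℝ → ℝ) (ε : ℝ) (m₀ m₁ : EuclideanSpace ℝ (Fin d) → ℝ)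
            (u m : ℝ → EuclideanSpace ℝ (Fin d) → ℝ),
            IsSmoothConvexDomain Ω →
            volume.real Ω = vol →
            Metric.diam Ω = diam →
            IsUniformlyConvexHamiltonian α β H →
            LipschitzOnWith Λ V Ω →
            IsCoerciveCoupling c₀ r₀ f →
            0 ≤ ε →
            IsProbabilityDensity Ω m₀ →
            IsProbabilityDensity Ω m₁ →
            IsClassicalPlanningSolution Ω T ε H f V m₀ m₁ u m →
            (∀ t ∈ Icc 0 T,
              eLpNorm (m t) p (volume.restrict Ω)
                ≤ ENNReal.ofReal K₀ * (eLpNorm m₀ p (volume.restrict Ω)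
                    + eLpNorm m₁ p (volume.restrict Ω) + 1)) ∧
            (∀ t ∈ Ioo 0 T,
              eLpNorm (m t) p (volume.restrict Ω)
                ≤ ENNReal.ofReal (K₁ * (t ^ (-q) + (T - t) ^ (-q)))) := by
  -- The exponent `q = d` is the power of the time weight in `weighted_excess_le`.
  refine ⟨d, by exact_mod_cast hd, fun c₀ r₀ T α β vol diam Λ hc₀ hr₀ hT hα hβ => ?_⟩
  -- The constants are fixed before the domain; if `vol` or `diam` is not positive, no domain has
  -- these values.
  by_cases hvd : 0 < vol ∧ 0 < diam
  swap
  · refine ⟨1, 1, one_pos, one_pos, fun Ω H V f ε m₀ m₁ u m hΩ hvol hdiam => ?_⟩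
    exact absurd ⟨hvol ▸ hΩ.volume_pos, hdiam ▸ hΩ.diam_pos hd⟩ hvd
  obtain ⟨hv, hD⟩ := hvd
  set L : ℝ := 1 / T + 2 / T ^ 2 with hL
  obtain ⟨σ, hσ, hσ1, hσ2⟩ := exists_scale
    (by positivity : 0 < c₀ * α / (2 ^ d * diam ^ 2))
    (2 * (2 * L ^ 2 + L + β * Λ ^ 2 / c₀ * (4 + 4 * r₀ ^ 2)))
  have hL0 : 0 ≤ L := by positivity
  have hσ2' : 2 * (β * Λ ^ 2 / c₀ * (4 + 4 * r₀ ^ 2)) ≤ c₀ * α / (2 ^ d * diam ^ 2) / σ ^ 2 := by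
    have : 0 ≤ L ^ 2 := sq_nonneg L
    linarith
  set P := max 1 (momentConst d σ vol 1) with hP
  have hP1 : 1 ≤ P := le_max_left _ _
  -- the constant for the uniform norm
  set Q := r₀ + max 1 (momentConst d σ vol (1 + vol)) with hQ
  have hQ1 : 1 ≤ Q := by
    have := le_max_left 1 (momentConst d σ vol (1 + vol))
    linarith
  -- the constant for the finite exponents
  set θ := p.toReal - 1 with hθ
  -- The `+ 1` keeps `C` positive when `Λ = 0`.
  set C := β * Λ ^ 2 / c₀ * (θ + θ ^ 2) + 1 with hC
  -- The interior bound at times with `t (T - t) / T² ≥ 3 / (2 C T²)`, the only interior times where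
  -- the maximum in `integral_rpow_le` can occur.
  set M := r₀ + P * ((3 / (2 * C * T ^ 2)) ^ d)⁻¹ with hM
  set R := 2 * r₀ ^ θ * (1 + 2 * C * T ^ 2) * ((r₀ ^ θ)⁻¹ + 12 + Real.exp (logExcess r₀ θ M)) with hR
  set K₁ := (1 + vol) * (r₀ * T ^ d + P * (2 * T) ^ d) with hK₁
  refine ⟨max Q R, K₁, lt_max_of_lt_left (by linarith), by positivity,
    fun Ω H V f ε m₀ m₁ u m hΩ hvol hdiam hH hV hf hε hm₀ hm₁ S => ?_⟩
  have hfin : volume Ω ≠ ⊤ := hΩ.isBounded.measure_lt_top.ne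
  have hint : ∀ t ∈ Ioo 0 T, ∀ x ∈ Ω, m t x ≤ r₀ + P * ((t * (T - t) / T ^ 2) ^ d)⁻¹ := by
    intro t ht x hx
    have := S.le_interior hd hΩ hH hT hα hβ hc₀ hr₀ hε hV hf hm₀ hσ hσ1
      (by rw [hdiam]; exact hσ2) ht hx
    rwa [hvol] at this
  have h0I : (0 : ℝ) ∈ Icc 0 T := left_mem_Icc.2 hT.le
  have h1I : T ∈ Icc 0 T := right_mem_Icc.2 hT.le
  constructor
  · intro t ht
    have e0 : eLpNorm m₀ p (volume.restrict Ω) = eLpNorm (m 0) p (volume.restrict Ω) :=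
      eLpNorm_congr_ae ((ae_restrict_iff' hΩ.isOpen.measurableSet).2
        (Filter.Eventually.of_forall fun x hx => (S.initial x hx).symm))
    have e1 : eLpNorm m₁ p (volume.restrict Ω) = eLpNorm (m T) p (volume.restrict Ω) :=
      eLpNorm_congr_ae ((ae_restrict_iff' hΩ.isOpen.measurableSet).2
        (Filter.Eventually.of_forall fun x hx => (S.final x hx).symm))
    have hmem : ∀ t ∈ Icc 0 T, MemLp (m t) p (volume.restrict Ω) := by
      intro t ht
      obtain ⟨B, hB⟩ := hΩ.isBounded.isCompact_closure.exists_bound_of_continuousOn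
        (S.continuousOn_slice ht)
      exact ⟨((S.continuousOn_slice ht).mono subset_closure).aestronglyMeasurable
        hΩ.isOpen.measurableSet, (eLpNorm_restrict_le hΩ.isOpen.measurableSet hfin hp
          fun x hx => hB x (subset_closure hx)).trans_lt ENNReal.ofReal_lt_top⟩
    rw [e0, e1]
    rcases eq_or_ne p ⊤ with rfl | hpt
    · set N := (eLpNorm (m 0) ⊤ (volume.restrict Ω)).toReal
        + (eLpNorm (m T) ⊤ (volume.restrict Ω)).toReal + 1 with hN
      have hN0 := ENNReal.toReal_nonneg (a := eLpNorm (m 0) ⊤ (volume.restrict Ω))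
      have hNT := ENNReal.toReal_nonneg (a := eLpNorm (m T) ⊤ (volume.restrict Ω))
      have hle : ∀ τ ∈ Icc 0 T, ∀ᵐ x ∂volume.restrict Ω,
          m τ x ≤ (eLpNorm (m τ) ⊤ (volume.restrict Ω)).toReal := by
        intro τ hτ
        filter_upwards [ae_le_eLpNormEssSup (f := m τ) (μ := volume.restrict Ω)] with x hx
        rw [← eLpNorm_exponent_top] at hx
        have h2 := ENNReal.toReal_mono (hmem τ hτ).2.ne hx
        rw [toReal_enorm] at h2
        exact (le_abs_self _).trans h2
      have hb : ∀ x ∈ Ω, |m t x| ≤ Q * N := fun x hx => by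
        rw [abs_of_nonneg (S.nonneg hT ht (subset_closure hx))]
        have := S.le_of_endpoints hd hΩ hH hT hα hβ hc₀ hr₀ hε hV hf hm₀ hσ hσ1
          (by rw [hdiam]; exact hσ2') (by linarith : 1 ≤ N)
          ((hle 0 h0I).mono fun x hx => by linarith) ((hle T h1I).mono fun x hx => by linarith) ht hx
        rwa [hvol] at this
      have h3 := eLpNorm_le_of_ae_bound (p := ⊤) ((ae_restrict_iff' hΩ.isOpen.measurableSet).2
        (Filter.Eventually.of_forall hb : ∀ᵐ x, x ∈ Ω → ‖m t x‖ ≤ Q * N))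
      rw [ENNReal.toReal_top, inv_zero, ENNReal.rpow_zero, one_mul,
        ENNReal.ofReal_mul (by linarith)] at h3
      refine h3.trans ?_
      have h4 : ENNReal.ofReal N = eLpNorm (m 0) ⊤ (volume.restrict Ω)
          + eLpNorm (m T) ⊤ (volume.restrict Ω) + 1 := by
        rw [hN, ENNReal.ofReal_add (by positivity) zero_le_one, ENNReal.ofReal_add hN0 hNT,
          ENNReal.ofReal_toReal (hmem 0 h0I).2.ne, ENNReal.ofReal_toReal (hmem T h1I).2.ne,
          ENNReal.ofReal_one]
      rw [h4]
      gcongr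
      exact le_max_left _ _
    · have hP1' : 1 ≤ p.toReal := (by simpa using ENNReal.toReal_mono hpt hp)
      refine eLpNorm_le_of_integral_rpow_le hp hpt (hmem t ht) (hmem 0 h0I) (hmem T h1I)
        (hQ1.trans (le_max_left _ _)) ?_
      have hnorm : ∀ τ ∈ Icc 0 T, ∫ x in Ω, ‖m τ x‖ ^ p.toReal = ∫ x in Ω, m τ x ^ p.toReal :=
        fun τ hτ => setIntegral_congr_fun hΩ.isOpen.measurableSet fun x hx => by
          rw [Real.norm_of_nonneg (S.nonneg hT hτ (subset_closure hx))]
      rw [hnorm t ht, hnorm 0 h0I, hnorm T h1I]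
      have hnn : ∀ τ ∈ Icc 0 T, 0 ≤ ∫ x in Ω, m τ x ^ p.toReal := fun τ hτ =>
        setIntegral_nonneg hΩ.isOpen.measurableSet fun x hx =>
          Real.rpow_nonneg (S.nonneg hT hτ (subset_closure hx)) _
      have hS0 := hnn 0 h0I
      have hST := hnn T h1I
      rcases eq_or_lt_of_le hP1' with h1 | h1
      -- For `p = 1` all three integrals are masses and equal `1`.
      · simp only [← h1, Real.rpow_one] at *
        rw [S.integral_eq_one hΩ hH hT hm₀ ht, S.integral_eq_one hΩ hH hT hm₀ h0I,
          S.integral_eq_one hΩ hH hT hm₀ h1I]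
        linarith [le_max_left Q R]
      · have hθ0 : 0 < θ := by linarith
        have hC0 : 0 < C := by positivity
        have hpθ : p.toReal = θ + 1 := by rw [hθ]; ring
        rw [hpθ] at hS0 hST ⊢
        refine (S.integral_rpow_le hΩ hH hT hα hβ hc₀ hr₀ hε hV hf hm₀ hθ0
          (by linarith : β * Λ ^ 2 / c₀ * (θ + θ ^ 2) ≤ C) hC0 (M := M) (fun τ hτ h3 x hx => ?_)
          ht).trans (mul_le_mul_of_nonneg_right (le_max_right _ _) (by linarith))
        refine (hint τ hτ x hx).trans ?_
        have h4 : 3 / (2 * C * T ^ 2) ≤ τ * (T - τ) / T ^ 2 := by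
          rw [div_le_div_iff₀ (by positivity) (by positivity)]
          nlinarith [mul_le_mul_of_nonneg_right h3 (sq_nonneg T)]
        rw [hM]
        gcongr
  · intro t ht
    refine (eLpNorm_restrict_le (C := (r₀ * T ^ d + P * (2 * T) ^ d)
      * (t ^ (-(d : ℝ)) + (T - t) ^ (-(d : ℝ)))) hΩ.isOpen.measurableSet hfin hp
      fun x hx => ?_).trans_eq (by rw [hvol, hK₁, mul_assoc])
    rw [abs_of_pos (S.pos_m t ht x (subset_closure hx))]
    refine (hint t ht x hx).trans ?_
    have h1 := mul_le_mul_of_nonneg_left (inv_mul_sub_pow_le hT ht d) (by linarith : 0 ≤ P)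
    have h2 := mul_le_mul_of_nonneg_left (one_le_mul_rpow_add hT ht d) hr₀.le
    linarith
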